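/- **Setting.** Fix real parameters $M,a,\Lambda,C_1,\dots,C_5$ and $k=0$, and put $$\Delta_r=\Bigl(1-\tfrac{\Lambda a^2}{3}+\tfrac{C_1}{2}\Bigr)r^2+(C_2-2M)r+a^2+C_3,\quad \Delta_x=\Bigl(\tfrac{\Lambda a^2}{3}-1-\tfrac{C_1}{2}\Bigr)x^2-C_4x+1+C_5,\quad \rho^2=r^2+a^2x^2,$$ $$g=-\frac{\Delta_r}{\rho^2}\bigl(dt-a(1-x^2)d\varphi\bigr)^2+\frac{\Delta_x}{\rho^2}\bigl((r^2+a^2)d\varphi-a\,dt\bigr)^2+\frac{\rho^2}{\Delta_r}dr^2+\frac{\rho^2}{\Delta_x}dx^2 .$$ An exterior is given by a radial interval starting at a horizon $r=r_h$ and ending at a wall $r=R$, at a second horizon $r=R$, or at $r=\infty$; by an angular interval $[x_l,x_u]\subset[-1,1]$; and by a time function $\tau=t+h(r)$. Write $H=\Delta_rh'$, $N=-\rho^2g(d\tau,d\tau)$; $\Sigma$ is the slice in the variables $(r,x)$, horizons included. A finite wall carries a local law: Dirichlet, or $\Delta_r\partial_r|_tu+\gamma\,\partial_tu+\kappa u=0$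 (Neumann: $\gamma=\kappa=0$). Angular ends are regular axes ($\Delta_x$ has a simple zero and $a(1-x^2)=0$) or reflecting faces ($\Delta_x>0$, zero conormal derivative); the wall and the faces form the *imposed boundary*. All functions are axisymmetric. $P(\sigma)w:=e^{i\sigma\tau}\Box_g(e^{-i\sigma\tau}w)$; $w$ is *outgoing* at $\sigma$ if it is smooth up to the horizons, axes and imposed boundary, $e^{-i\sigma\tau}w$ satisfies the boundary conditions and, when the end is $r=\infty$, $w=e^{i\sigma(h+r_*)}r^{-1}B(1/r,x)$ near infinity with $B$ smooth up to $1/r=0$ and $dr_*/dr=(r^2+a^2)/\Delta_r$. Sobolev norms use $\partial_r$ and the geometric angular derivative $\sqrt{\Delta_x}\,\partial_x$, and integrals over the slice use $dr\,dx$. A *cutoff* is a smooth compactly supported function of $(r,x)$; a *source* is a smooth compactly supported $f$ vanishing near the imposed boundary. A *solution on $[0,T]$* of $\Box_gu=F$ with $F$ smooth means one that is smooth up to the horizons and boundary and satisfies the boundary conditions. **Package.** Fix $s_0\ge 0$ and, for each $s\ge 0$, a Hilbert space $\mathcal E^s$ of Cauchy data $U=(u,\partial_\tau u)$, bounded operators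 $e^{t\mathcal G}$ ($t\ge0$) with generator $\mathcal G$, lower semicontinuous seminorms $q_i$ on $\mathcal E^s$ with values in $[0,\infty]$ defining $\|U\|_{LE^s(J)}^2=\sup_i\int_Jq_i(U(t))^2dt$, source norms $LE^{s,*}([0,T])$, a cutoff $\chi_c$, and a bounded operator $\Pi$. Suppose that for every $s\ge s_0$: * **BH1.** $k=0$; $\rho^2>0$; $\Delta_r,\Delta_x>0$ inside and $\Delta_r>0$ at a wall; horizons are simple zeros of $\Delta_r$ with positive surface gravity; $H,N$ extend smoothly to the horizons, $H=\pm(r^2+a^2)$ at the inner/outer horizon (future regularity), and $N>0$. * **BH2.** In the wall law $\gamma,\kappa$ are smooth and $\gamma,\kappa\ge0$; at $r=\infty$ regular data of bounded support are dense in $\mathcal E^s$. (*Regular data* are data whose evolution consists of the Cauchy data of a solution of $\Box_gu=0$ on $[0,\infty)$ that is smooth up to the horizons and boundary and satisfies the boundary conditions.) * **BH3.** $\mathcal E^{s+1}\to\mathcal E^s$ continuously, compatibly with the evolution; $\mathcal E^s$ embeds into $H^{s+1}_{\rm loc}(\Sigma)\times H^s_{\rm loc}(\Sigma)$; $e^{t\mathcal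 G}$ is a strongly continuous semigroup; pairs of sources are regular data; regular data are dense in the graph norm of $\mathcal G$; for smooth $u$ with boundary conditions and Cauchy data $U(t)\in\mathcal E^s$, $\Box_gu=F$ on $[0,T]$ is equivalent to $\partial_tU=\mathcal GU+\mathcal F$ in integrated form, with $\mathcal F=(0,F/g(d\tau,d\tau))$ continuous into $\mathcal E^s$. * **BH4.** The local-energy norm controls $H^{s+1}\times H^s$ near each horizon and $\chi U$ in $H^s\times H^{s-1}$ for every cutoff $\chi$ supported away from the imposed boundary; $LE^{s,*}$ is a seminorm that is finite on smooth compactly supported interior sources and dual to it, $|\int_0^T\!\int F\,\overline{\partial_\tau u}\,\rho^2\,dr\,dx\,d\tau|\le C\|F\|_{LE^{s,*}}\|U\|_{LE^s}$ for such $F$; the support of $\chi_c$ avoids the horizons; and for all $T>0$ and all solutions of $\Box_gu=F$ on $[0,T]$ with data in $\mathcal E^s$, $$\sup_{[0,T]}\|U\|_{\mathcal E^s}^2+\|U\|_{LE^s([0,T])}^2\le C_s\bigl(\|U(0)\|_{\mathcal E^s}^2+\|F\|_{LE^{s,*}([0,T])}^2+\|\chi_cU\|^2_{L^2([0,T];H^s\times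 H^{s-1})}\bigr).$$ * **BH5.** $P(\sigma)w=0$ has no nonzero outgoing solution for $\operatorname{Im}\sigma>0$ or $\sigma\in\mathbb R\setminus\{0\}$; for compact $I\subset\mathbb R\setminus\{0\}$ and each cutoff $\chi$, $\chi P(\sigma+i\epsilon)^{-1}\chi$ is bounded from $H^s$ to $H^{s+1}$ (on sources) uniformly in $\sigma\in I$, $0<\epsilon\le1$, and converges as $\epsilon\downarrow0$ to the outgoing resolvent. * **BH6.** $\|\chi P(\sigma+i0)^{-1}\chi f\|_{H^{s+1}}\le C\langle\sigma\rangle^{n}\|f\|_{H^s}$ for real $|\sigma|\ge\sigma_0$ and sources $f$. * **BH7.** $\|\chi_ce^{t\mathcal G}(I-\Pi)U_0\|_{L^2([0,\infty);H^s\times H^{s-1})}\le C_s\|(I-\Pi)U_0\|_{\mathcal E^s}$; for each compact $K\subset\Sigma$ disjoint from the imposed boundary there are bounded operators $B_K(\sigma):\mathcal E^s\to H^1(K)\times L^2(K)$ with $e^{t\mathcal G}(I-\Pi)U_0|_K=\int_{\mathbb R}e^{-it\sigma}B_K(\sigma)(I-\Pi)U_0\,d\sigma$ for $t\ge0$ and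 $\|B_K(\cdot)(I-\Pi)U_0\|_{L^1(\mathbb R;H^1(K)\times L^2(K))}\le C_{K,s}\|(I-\Pi)U_0\|_{\mathcal E^s}$. * **BH8.** For $0<|\sigma|<\delta$, $\operatorname{Im}\sigma\ge0$, $\chi P(\sigma)^{-1}\chi=\sum_{j=1}^{\nu}\sigma^{-j}A_j+R_0(\sigma)$ on sources, with $A_j$ of finite rank and bounded and $R_0$ uniformly bounded from $H^s$ to $H^{s+1}$; $\Pi U=\sum_{\alpha=1}^d\ell_\alpha(U)V_\alpha$ with $\ell_\alpha\in(\mathcal E^s)'$, $V_\alpha\in\mathcal E^s$; $\Pi^2=\Pi$, $\operatorname{Ran}\Pi=\mathcal T_0:=\bigcup_{n\ge1}\operatorname{Ker}\mathcal G^n$, $e^{t\mathcal G}\Pi=\Pi e^{t\mathcal G}$; $\mathcal G|_{\mathcal T_0}$ is nilpotent of finite length. * **BH9.** Multiplication by a smooth $\chi$ whose gradient is supported in a compact subset of $\Sigma$ away from the imposed boundary is bounded on $\mathcal E^s$, preserves $\operatorname{Dom}\mathcal G$ and has a bounded commutator with $\mathcal G$. **Theorem.** Under BH1–BH9, for every $s\ge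 s_0$ there is a bounded finite-rank projection $\Pi_0$ of $\mathcal E^s$ onto $\mathcal T_0$, commuting with $e^{t\mathcal G}$, $t\ge0$, such that: 1. $t\mapsto e^{t\mathcal G}U_0$ is a finite-energy solution with initial datum $U_0$, and every axisymmetric finite-energy solution $U$ of $\Box_gu=0$ with initial datum $U_0\in\mathcal E^s$ (an integrated solution of $\partial_tU=\mathcal GU$, or the Cauchy data in $\mathcal E^s$ of a smooth solution on $[0,\infty)$ satisfying the boundary conditions) is $U(t)=e^{t\mathcal G}\Pi_0U_0+e^{t\mathcal G}(I-\Pi_0)U_0$. 2. $\mathcal G$ is nilpotent on $\mathcal T_0$, and if $\mathcal G^q=0$ on $\mathcal T_0$, then $e^{t\mathcal G}\Pi_0U_0=\sum_{j<q}\frac{t^j}{j!}\mathcal G^j\Pi_0U_0$ for $t\ge 0$. This threshold term is stationary for all $U_0$ if and only if $\mathcal G=0$ on $\mathcal T_0$ (semisimple threshold). 3. $\sup_{t\ge0}\|e^{t\mathcal G}(I-\Pi_0)U_0\|_{\mathcal E^s}+\|e^{t\mathcal G}(I-\Pi_0)U_0\|_{LE^s([0,\infty))}\le C_s\|(I-\Pi_0)U_0\|_{\mathcal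 E^s}$ with $C_s$ independent of $U_0$. 4. For every compact $K\subset\Sigma$ disjoint from the imposed boundary, the dispersive part $(u_{\rm disp},\partial_\tau u_{\rm disp})(t)=e^{t\mathcal G}(I-\Pi_0)U_0$ satisfies $\|u_{\rm disp}(t)\|_{H^1(K)}+\|\partial_\tau u_{\rm disp}(t)\|_{L^2(K)}\to0$ as $t\to\infty$. Moreover, there is no nonzero outgoing mode $e^{-i\sigma\tau}w$ of $\Box_gu=0$ with $\operatorname{Im}\sigma>0$. Let in addition $g$ be a subextremal Kerr–Newman metric: $\Delta_r=r^2-2Mr+a^2+Q^2$, $\Delta_x=1-x^2$, $M>0$, $a^2+Q^2<M^2$, $r_h=M+\sqrt{M^2-a^2-Q^2}$, $[x_l,x_u]=[-1,1]$, and let $s\ge s_0$. If the outer end is a Neumann wall and $(1,0)\in\mathcal E^s$, then $\mathcal T_0=\operatorname{span}\{(1,0)\}$ and $\mathcal G=0$ on $\mathcal T_0$. If the outer end is $r=\infty$ and $\mathcal E^s$ is a space of decaying data, in the sense that the Hardy term $\int|u|^2\,dr\,dx$ is finite for all $(u,v)\in\mathcal E^s$, then $\mathcal T_0=\{0\}$.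 -/

import Mathlib

open MeasureTheory Filter Topology Set
open scoped ENNReal NNReal ContDiff

noncomputable section

namespace CarterBH

/-! ### The Carter-type family and its scalar wave operator -/

/-- Parameters of the Carter-type family of constant scalar curvature `k`. -/
structure CarterParams where
  M : ℝ
  a : ℝ
  Lam : ℝ
  k : ℝ
  C₁ : ℝ
  C₂ : ℝ
  C₃ : ℝ
  C₄ : ℝ
  C₅ : ℝ

namespace CarterParams

variable (c : CarterParams)

/-- The radial coefficient function. -/
def deltaR (r : ℝ) : ℝ :=
  -(c.k / 12) * r ^ 4 + (1 - c.Lam * c.a ^ 2 / 3 + c.C₁ / 2) * r ^ 2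
    + (c.C₂ - 2 * c.M) * r + (c.a ^ 2 + c.C₃)

/-- The angular coefficient function, in the variable `x = cos θ`. -/
def deltaX (x : ℝ) : ℝ :=
  -(c.k * c.a ^ 2 / 12) * x ^ 4 + (c.Lam * c.a ^ 2 / 3 - 1 - c.C₁ / 2) * x ^ 2
    - c.C₄ * x + (1 + c.C₅)

/-- `ρ² = r² + a² x²`. -/
def rhoSq (r x : ℝ) : ℝ := r ^ 2 + c.a ^ 2 * x ^ 2

/-- The covector `dt - a (1 - x²) dφ` in the coordinates `(t, φ, r, x)`. -/
def formT (x : ℝ) : Fin 4 → ℝ := ![1, -(c.a * (1 - x ^ 2)), 0, 0]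

/-- The covector `(r² + a²) dφ - a dt` in the coordinates `(t, φ, r, x)`. -/
def formPhi (r : ℝ) : Fin 4 → ℝ := ![-c.a, r ^ 2 + c.a ^ 2, 0, 0]

/-- The Carter-type metric at the point `p = (t, φ, r, x)`. -/
def metric (p : Fin 4 → ℝ) : Matrix (Fin 4) (Fin 4) ℝ :=
  (-(c.deltaR (p 2) / c.rhoSq (p 2) (p 3))) • Matrix.vecMulVec (c.formT (p 3)) (c.formT (p 3))
    + (c.deltaX (p 3) / c.rhoSq (p 2) (p 3)) •
        Matrix.vecMulVec (c.formPhi (p 2)) (c.formPhi (p 2))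
    + Matrix.diagonal ![0, 0, c.rhoSq (p 2) (p 3) / c.deltaR (p 2),
        c.rhoSq (p 2) (p 3) / c.deltaX (p 3)]

/-- The `μ`-th coordinate derivative. -/
def pderiv (μ : Fin 4) (f : (Fin 4 → ℝ) → ℂ) (p : Fin 4 → ℝ) : ℂ :=
  deriv (fun y : ℝ => f (Function.update p μ y)) (p μ)

/-- The scalar wave operator `□_g u = |g|^{-1/2} ∂_μ (|g|^{1/2} g^{μν} ∂_ν u)`. -/
def box (u : (Fin 4 → ℝ) → ℂ) (p : Fin 4 → ℝ) : ℂ :=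
  ((Real.sqrt |(c.metric p).det|)⁻¹ : ℝ) *
    ∑ μ : Fin 4, pderiv μ
      (fun q => ∑ ν : Fin 4,
        ((Real.sqrt |(c.metric q).det| * (c.metric q)⁻¹ μ ν : ℝ) : ℂ) * pderiv ν u q) p

end CarterParams

/-! ### Exterior regions -/

/-- Local boundary laws at a finite timelike wall.  With `n u = Δ_r ∂_r u` (the derivative taken
along the slices `t = const`), `robin γ κ` is `n u + γ ∂_t u + κ u = 0`.  It comes from the
boundary form `∫ κ |u|²` and has the absorbed flux `∫ γ |∂_t u|²`; `robin 0 0` is the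
Neumann wall. -/
inductive WallLaw
  | dirichlet
  | robin (γ κ : ℝ → ℝ)

/-- The outer radial end: a wall `r = R` with a boundary law, a further horizon `r = R`, or the
noncompact end `r → ∞`, which carries the outgoing radiation condition. -/
inductive OuterEnd
  | wall (R : ℝ) (law : WallLaw)
  | horizon (R : ℝ)
  | infinity

/-- The data describing an exterior region: the metric parameters, the inner horizon radius `rh`,
the outer end, the angular interval `[xl, xu]`, and a stationary axisymmetric time function
`τ = t + h(r)` with `H = Δ_r h'`, whose level sets are the exterior hypersurfaces.
`N` is `-ρ² g(dτ, dτ)`. -/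
structure Exterior extends CarterParams where
  rh : ℝ
  outer : OuterEnd
  xl : ℝ
  xu : ℝ
  h : ℝ → ℝ
  H : ℝ → ℝ
  N : ℝ × ℝ → ℝ

namespace Exterior

variable (X : Exterior)

/-- The radial interval, with its finite endpoints. -/
def radial : Set ℝ :=
  match X.outer with
  | .wall R _ => Icc X.rh R
  | .horizon R => Icc X.rh R
  | .infinity => Ici X.rh

/-- The open radial interval. -/
def radialInt : Set ℝ :=
  match X.outer with
  | .wall R _ => Ioo X.rh R
  | .horizon R => Ioo X.rh R
  | .infinity => Ioi X.rh

/-- The radii of the horizon components. -/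
def horizons : Set ℝ :=
  match X.outer with
  | .horizon R => {X.rh, R}
  | _ => {X.rh}

/-- The exterior hypersurface modulo rotations, in the variables `(r, x)`, horizons included. -/
def slice : Set (ℝ × ℝ) := X.radial ×ˢ Icc X.xl X.xu

/-- The interior of the exterior hypersurface. -/
def inner : Set (ℝ × ℝ) := X.radialInt ×ˢ Ioo X.xl X.xu

/-- Lebesgue measure `dr dx` on the interior. -/
def vol : Measure (ℝ × ℝ) := volume.restrict X.inner

/-- The imposed boundary: the wall, and those angular ends that are not regular axes. -/
def imposed : Set (ℝ × ℝ) :=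
  {p | p ∈ X.slice ∧
    ((match X.outer with
      | .wall R _ => p.1 = R
      | _ => False) ∨
      (p.2 = X.xl ∧ 0 < X.deltaX X.xl) ∨ (p.2 = X.xu ∧ 0 < X.deltaX X.xu))}

/-- Surface gravity of the horizon `r`. -/
def surfaceGravity (r : ℝ) : ℝ := |deriv X.deltaR r| / (2 * (r ^ 2 + X.a ^ 2))

/-- The coefficient `g(dτ, dτ)`. -/
def gTauTau (p : ℝ × ℝ) : ℝ := -(X.N p / X.rhoSq p.1 p.2)

/-- **BH1**: a stationary axisymmetric exterior region of a `k = 0` member, with nondegenerate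
horizons that the spacelike hypersurfaces `τ = const` cross regularly, and coefficients that
extend smoothly to the future horizons in the chart `(τ, r, x)`, in which
`ρ² □ u = ∂_r (Δ_r ∂_r u) + ∂_r (H ∂_τ u) + H ∂_r ∂_τ u - N ∂_τ² u + ∂_x (Δ_x ∂_x u)`. -/
structure BH1 : Prop where
  k_eq_zero : X.k = 0
  radial_nonempty : X.radialInt.Nonempty
  neg_one_le : -1 ≤ X.xl
  xl_lt_xu : X.xl < X.xu
  le_one : X.xu ≤ 1
  rho_pos : ∀ p ∈ X.slice, 0 < X.rhoSq p.1 p.2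
  deltaR_pos : ∀ r ∈ X.radialInt, 0 < X.deltaR r
  deltaX_pos : ∀ x ∈ Ioo X.xl X.xu, 0 < X.deltaX x
  /-- horizons are simple roots of `Δ_r` with positive surface gravity -/
  horizon : ∀ r ∈ X.horizons, X.deltaR r = 0 ∧ 0 < X.surfaceGravity r
  /-- a wall is timelike -/
  wall : ∀ R law, X.outer = .wall R law → 0 < X.deltaR R
  /-- each angular end is a regular rotation axis or a face of a regular patch -/
  angular : ∀ e ∈ ({X.xl, X.xu} : Set ℝ), 0 < X.deltaX e ∨
    (X.deltaX e = 0 ∧ deriv X.deltaX e ≠ 0 ∧ X.a * (1 - e ^ 2) = 0)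
  h_deriv : ∀ r ∈ X.radialInt, HasDerivAt X.h (X.H r / X.deltaR r) r
  H_smooth : ContDiffOn ℝ ∞ X.H X.radial
  /-- `τ` is regular at the future (rather than the past) horizons -/
  H_inner : X.H X.rh = X.rh ^ 2 + X.a ^ 2
  H_outer : ∀ R, X.outer = .horizon R → X.H R = -(R ^ 2 + X.a ^ 2)
  N_smooth : ContDiffOn ℝ ∞ X.N X.slice
  N_pos : ∀ p ∈ X.slice, 0 < X.N p
  N_eq : ∀ p ∈ X.inner, X.N p =
    (p.1 ^ 2 + X.a ^ 2) ^ 2 / X.deltaR p.1 - X.a ^ 2 * (1 - p.2 ^ 2) ^ 2 / X.deltaX p.2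
      - X.H p.1 ^ 2 / X.deltaR p.1

/-! ### Axisymmetric functions, boundary conditions, modes -/

/-- The axisymmetric function on the `(t, φ, r, x)` chart given by `u(τ, (r, x))`,
`τ = t + h(r)`. -/
def lift (u : ℝ → ℝ × ℝ → ℂ) (q : Fin 4 → ℝ) : ℂ := u (q 0 + X.h (q 2)) (q 2, q 3)

/-- `□_g u` at `τ` and `p = (r, x)`. -/
def waveOp (u : ℝ → ℝ × ℝ → ℂ) (τ : ℝ) (p : ℝ × ℝ) : ℂ :=
  X.box (X.lift u) ![τ - X.h p.1, 0, p.1, p.2]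

/-- The boundary conditions of `u` on the imposed boundary for times in `J`: the wall law (with
`Δ_r ∂_r|_t u = Δ_r ∂_r u + H ∂_τ u`) and vanishing conormal derivative `Δ_x ∂_x u` at the
angular ends (a vacuous condition at an axis). -/
def BoundaryCond (J : Set ℝ) (u : ℝ → ℝ × ℝ → ℂ) : Prop :=
  (∀ R law, X.outer = .wall R law → ∀ τ ∈ J, ∀ x ∈ Icc X.xl X.xu,
    match law with
    | .dirichlet => u τ (R, x) = 0
    | .robin γ κ =>
      (X.deltaR R : ℂ) * derivWithin (fun r => u τ (r, x)) X.radial R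
        + (X.H R : ℂ) * derivWithin (fun τ' => u τ' (R, x)) J τ
        + (γ x : ℂ) * derivWithin (fun τ' => u τ' (R, x)) J τ
        + (κ x : ℂ) * u τ (R, x) = 0) ∧
  (∀ e ∈ ({X.xl, X.xu} : Set ℝ), ∀ τ ∈ J, ∀ r ∈ X.radial,
    (X.deltaX e : ℂ) * derivWithin (fun x => u τ (r, x)) (Icc X.xl X.xu) e = 0)

/-- Smooth functions on `J × slice` (smooth up to the horizons, axes and imposed boundary) that
satisfy the boundary conditions. -/
def Admissible (J : Set ℝ) (u : ℝ → ℝ × ℝ → ℂ) : Prop :=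
  ContDiffOn ℝ ∞ (fun q : ℝ × (ℝ × ℝ) => u q.1 q.2) (J ×ˢ X.slice) ∧ X.BoundaryCond J u

/-- The function `e^{-iστ} w(r, x)`. -/
def mode (σ : ℂ) (w : ℝ × ℝ → ℂ) (τ : ℝ) (p : ℝ × ℝ) : ℂ :=
  Complex.exp (-(Complex.I * σ * τ)) * w p

/-- The stationary operator `P(σ)`, obtained from `□_g` by inserting `e^{-iστ} w`. -/
def statOp (σ : ℂ) (w : ℝ × ℝ → ℂ) (p : ℝ × ℝ) : ℂ := X.waveOp (mode σ w) 0 p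

/-- The outgoing (Sommerfeld) condition at `r → ∞`: in the chart of `t`, the function is
`e^{iσ r_*} r^{-1}` times a smooth function of `(1/r, x)` up to `1/r = 0`, where
`dr_*/dr = (r² + a²)/Δ_r`. -/
def Sommerfeld (σ : ℂ) (w : ℝ × ℝ → ℂ) : Prop :=
  ∃ (rs : ℝ → ℝ) (r₁ : ℝ) (B : ℝ × ℝ → ℂ), 0 < r₁ ∧ X.rh < r₁ ∧
    (∀ r, r₁ < r → HasDerivAt rs ((r ^ 2 + X.a ^ 2) / X.deltaR r) r) ∧
    ContDiffOn ℝ ∞ B (Icc 0 r₁⁻¹ ×ˢ Icc X.xl X.xu) ∧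
    ∀ r x, r₁ < r → x ∈ Icc X.xl X.xu →
      w (r, x) = Complex.exp (Complex.I * σ * ((X.h r + rs r : ℝ) : ℂ)) * (r : ℂ)⁻¹ * B (r⁻¹, x)

/-- Outgoing functions at frequency `σ`: regular at the future horizons, satisfying the boundary
conditions, and the radiation condition when the end is noncompact. -/
def Outgoing (σ : ℂ) (w : ℝ × ℝ → ℂ) : Prop :=
  X.Admissible univ (mode σ w) ∧ (X.outer = .infinity → X.Sommerfeld σ w)

/-- `w = P(σ)⁻¹ f`: `w` is an outgoing solution of `P(σ) w = f`. -/
def Resolvent (σ : ℂ) (f w : ℝ × ℝ → ℂ) : Prop :=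
  X.Outgoing σ w ∧ ∀ p ∈ X.inner, X.statOp σ w p = f p

/-! ### Axisymmetric Sobolev norms -/

/-- Test functions on the interior. -/
def IsTest (φ : ℝ × ℝ → ℂ) : Prop :=
  ContDiff ℝ ∞ φ ∧ HasCompactSupport φ ∧ tsupport φ ⊆ X.inner

/-- `g` is the weak derivative of `f` in the direction `e` on the interior. -/
def IsWeakDeriv (e : ℝ × ℝ) (f g : ℝ × ℝ → ℂ) : Prop :=
  ∀ φ, X.IsTest φ → ∫ p, f p * fderiv ℝ φ p e ∂X.vol = -∫ p, g p * φ p ∂X.vol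

/-- `d i j` are the weak derivatives `∂_r^i D_x^j f`, `i + j ≤ k`, where `D_x^j` alternates
`√Δ_x ∂_x` (odd steps) and `∂_x √Δ_x` (even steps).  These are the derivatives of an axisymmetric
function on the sphere, so that the norms below are the geometric Sobolev norms also at the
axes. -/
structure IsJet (k : ℕ) (f : ℝ × ℝ → ℂ) (d : ℕ → ℕ → ℝ × ℝ → ℂ) : Prop where
  zero : d 0 0 =ᵐ[X.vol] f
  locInt : ∀ i j, i + j ≤ k → LocallyIntegrableOn (d i j) X.inner
  radial : ∀ i j, i + 1 + j ≤ k → X.IsWeakDeriv (1, 0) (d i j) (d (i + 1) j)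
  odd : ∀ i j, i + j + 1 ≤ k → Even j →
    X.IsWeakDeriv (0, 1) (d i j) (fun p => d i (j + 1) p / (Real.sqrt (X.deltaX p.2) : ℂ))
  even : ∀ i j, i + j + 1 ≤ k → Odd j →
    X.IsWeakDeriv (0, 1) (fun p => (Real.sqrt (X.deltaX p.2) : ℂ) * d i j p) (d i (j + 1))

/-- The `H^k(K)` norm of the axisymmetric function `f` (infinite if `f` does not have the weak
derivatives). -/
def hNorm (k : ℕ) (K : Set (ℝ × ℝ)) (f : ℝ × ℝ → ℂ) : ℝ≥0∞ :=
  ⨅ (d : ℕ → ℕ → ℝ × ℝ → ℂ) (_ : X.IsJet k f d),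
    (∫⁻ p in K, ∑ i ∈ Finset.range (k + 1), ∑ j ∈ Finset.range (k + 1 - i),
      ‖d i j p‖ₑ ^ 2 ∂X.vol) ^ (1 / 2 : ℝ)

/-- The `H^{s-1}` norm on the whole slice; for `s = 0` the norm of `H^{-1}` as a dual space. -/
def hNormPred (s : ℕ) (f : ℝ × ℝ → ℂ) : ℝ≥0∞ :=
  match s with
  | 0 => ⨆ (φ : ℝ × ℝ → ℂ) (_ : X.IsTest φ) (_ : X.hNorm 1 univ φ ≤ 1), ‖∫ p, f p * φ p ∂X.vol‖ₑ
  | k + 1 => X.hNorm k univ f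

/-- The Hilbert space `L²(K; ℂ⁴)` of (not necessarily integrable) first jets
`(u, ∂_r u, √Δ_x ∂_x u, v)`. -/
abbrev JetSpace (K : Set (ℝ × ℝ)) : Type :=
  Lp (EuclideanSpace ℂ (Fin 4)) 2 (X.vol.restrict K)

/-- `H¹(K) × L²(K)`, as the closure of the smooth elements in the space of first jets. -/
def H1L2 (K : Set (ℝ × ℝ)) : Submodule ℂ (X.JetSpace K) :=
  (Submodule.span ℂ {J : X.JetSpace K | ∃ f v : ℝ × ℝ → ℂ, ContDiff ℝ ∞ f ∧ ContDiff ℝ ∞ v ∧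
    J =ᵐ[X.vol.restrict K] fun p => WithLp.toLp 2
      ![f p, fderiv ℝ f p (1, 0), (Real.sqrt (X.deltaX p.2) : ℂ) * fderiv ℝ f p (0, 1), v p]}
    ).topologicalClosure

/-- Smooth compactly supported spatial cutoffs. -/
def IsCutoff (χ : ℝ × ℝ → ℝ) : Prop := ContDiff ℝ ∞ χ ∧ HasCompactSupport χ

/-- Smooth functions of compact support away from the imposed boundary (the support may meet the
horizons and the axes). -/
def IsSource (f : ℝ × ℝ → ℂ) : Prop :=
  ContDiff ℝ ∞ f ∧ HasCompactSupport f ∧ Disjoint (tsupport f) X.imposed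

/-- Equivalence classes of functions on the slice modulo null sets. -/
abbrev Fn : Type := (ℝ × ℝ) →ₘ[X.vol] ℂ

/-- The Kerr-Newman exterior with charge `Q` (subextremal). -/
structure IsKerrNewman (Q : ℝ) : Prop where
  mass_pos : 0 < X.M
  subextremal : X.a ^ 2 + Q ^ 2 < X.M ^ 2
  deltaR_eq : ∀ r, X.deltaR r = r ^ 2 - 2 * X.M * r + X.a ^ 2 + Q ^ 2
  deltaX_eq : ∀ x, X.deltaX x = 1 - x ^ 2
  rh_eq : X.rh = X.M + Real.sqrt (X.M ^ 2 - X.a ^ 2 - Q ^ 2)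
  xl_eq : X.xl = -1
  xu_eq : X.xu = 1

end Exterior

/-! ### Energy scale and evolution -/

universe u

/-- The functional-analytic data of an exterior problem: Hilbert spaces `E s` of (classes of)
Cauchy data `(u, ∂_τ u)`, the evolution `S s t = e^{tG}`, the spatial seminorms `le s i` that
make up the local-energy norm, the norm `leDual s T` of sources on `[0, T]`, the cutoff `chi s`
to the interaction region, and the threshold projection `proj s`. -/
structure Realization (X : Exterior) where
  E : ℕ → Type u
  [normed : ∀ s, NormedAddCommGroup (E s)]
  [inner : ∀ s, InnerProductSpace ℂ (E s)]
  [complete : ∀ s, CompleteSpace (E s)]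
  data : ∀ s, E s →ₗ[ℂ] X.Fn × X.Fn
  S : ∀ s, ℝ → E s →L[ℂ] E s
  le : ∀ s, ℕ → E s → ℝ≥0∞
  leDual : ℕ → ℝ → (ℝ → ℝ × ℝ → ℂ) → ℝ≥0∞
  chi : ℕ → ℝ × ℝ → ℝ
  proj : ∀ s, E s →L[ℂ] E s

attribute [instance] Realization.normed Realization.inner Realization.complete

namespace Realization

variable {X : Exterior} (W : Realization.{u} X) (s : ℕ)

/-- The Cauchy data of `U` are `(f, g)`. -/
def HasData (U : W.E s) (f g : ℝ × ℝ → ℂ) : Prop :=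
  (W.data s U).1 =ᵐ[X.vol] f ∧ (W.data s U).2 =ᵐ[X.vol] g

/-- The graph of the infinitesimal generator `G` of the evolution: `U ∈ Dom G` and `G U = V`. -/
def Gen (U V : W.E s) : Prop :=
  Tendsto (fun t : ℝ => ((t⁻¹ : ℝ) : ℂ) • (W.S s t U - U)) (𝓝[>] 0) (𝓝 V)

/-- `Ker G^n`. -/
def kerPow : ℕ → Set (W.E s)
  | 0 => {0}
  | n + 1 => {U | ∃ V ∈ kerPow n, W.Gen s U V}

/-- The zero-frequency threshold space `⋃_{n ≥ 1} Ker G^n`. -/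
def threshold : Set (W.E s) := ⋃ n ≥ 1, W.kerPow s n

/-- `U` solves `∂_t U = G U + 𝓕` on `[0, T]` in the integrated (mild) sense. -/
def IsMild (T : ℝ) (𝓕 U : ℝ → W.E s) : Prop :=
  ContinuousOn U (Icc 0 T) ∧ ∀ t ∈ Icc 0 T,
    W.Gen s (∫ t' in (0 : ℝ)..t, U t') (U t - U 0 - ∫ t' in (0 : ℝ)..t, 𝓕 t')

/-- Finite-energy solutions of the homogeneous equation on `[0, ∞)` with initial datum `U₀`. -/
def IsSolution (U₀ : W.E s) (U : ℝ → W.E s) : Prop :=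
  U 0 = U₀ ∧ ∀ T > 0, W.IsMild s T 0 U

/-- The curve `U` consists, for times in `J`, of the Cauchy data of `u`. -/
def Traces (J : Set ℝ) (u : ℝ → ℝ × ℝ → ℂ) (U : ℝ → W.E s) : Prop :=
  ∀ t ∈ J, W.HasData s (U t) (u t) (fun p => derivWithin (fun t' => u t' p) J t)

/-- `U₀` is a regular datum: its evolution consists of the Cauchy data of a solution of
`□_g u = 0` that is smooth up to the future horizons and satisfies the boundary conditions. -/
def Regular (U₀ : W.E s) : Prop :=
  ∃ u, X.Admissible (Ici 0) u ∧ (∀ τ > 0, ∀ p ∈ X.inner, X.waveOp u τ p = 0) ∧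
    W.Traces s (Ici 0) u (fun t => W.S s t U₀)

/-- The local-energy norm over the times `J`. -/
def leNorm (J : Set ℝ) (U : ℝ → W.E s) : ℝ≥0∞ :=
  (⨆ i, ∫⁻ t in J, W.le s i (U t) ^ 2) ^ (1 / 2 : ℝ)

/-- The norm of `χ U` in `H^s × H^{s-1}`. -/
def cutNorm (χ : ℝ × ℝ → ℝ) (U : W.E s) : ℝ≥0∞ :=
  X.hNorm s univ (fun p => (χ p : ℂ) * (W.data s U).1 p)
    + X.hNormPred s (fun p => (χ p : ℂ) * (W.data s U).2 p)

/-- `J` is the first jet over `K` of the data of `U`, an element of `H¹(K) × L²(K)`. -/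
def HasLocalJet (K : Set (ℝ × ℝ)) (U : W.E s) (J : X.JetSpace K) : Prop :=
  ∃ d, X.IsJet 1 (W.data s U).1 d ∧ J =ᵐ[X.vol.restrict K] fun p =>
    WithLp.toLp 2 ![d 0 0 p, d 1 0 p, d 0 1 p, (W.data s U).2 p]

/-- **BH2**: the outer boundary condition.  A wall law is energy compatible.  At a noncompact end
the stationary condition is the one in `Exterior.Outgoing`, and the energy space is the closure
of regular data of bounded support. -/
structure BH2 : Prop where
  wall : ∀ R γ κ, X.outer = .wall R (.robin γ κ) →
    ContDiffOn ℝ ∞ γ (Icc X.xl X.xu) ∧ ContDiffOn ℝ ∞ κ (Icc X.xl X.xu) ∧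
      ∀ x ∈ Icc X.xl X.xu, 0 ≤ γ x ∧ 0 ≤ κ x
  radiation : X.outer = .infinity → ∀ U : W.E s, ∀ ε > 0, ∃ V : W.E s, ‖U - V‖ < ε ∧
    W.Regular s V ∧ ∃ r₁ : ℝ, ∀ᵐ p ∂X.vol, r₁ < p.1 → (W.data s V).1 p = 0 ∧ (W.data s V).2 p = 0

/-- **BH3**: Hilbert scale, strongly continuous evolution, density of regular data in the graph
norm, and equivalence of `□_g u = F` with the first-order system. -/
structure BH3 : Prop where
  data_injective : Function.Injective (W.data s)
  scale : ∃ ι : W.E (s + 1) →L[ℂ] W.E s, (∀ U, W.data s (ι U) = W.data (s + 1) U) ∧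
    ∀ t ≥ 0, ∀ U, ι (W.S (s + 1) t U) = W.S s t (ι U)
  /-- finite-energy data lie locally in `H^{s+1} × H^s` -/
  localize : ∀ χ, Exterior.IsCutoff χ → ∃ C : ℝ≥0, ∀ U : W.E s,
    X.hNorm (s + 1) univ (fun p => (χ p : ℂ) * (W.data s U).1 p)
      + X.hNorm s univ (fun p => (χ p : ℂ) * (W.data s U).2 p) ≤ C * ‖U‖ₑ
  S_zero : W.S s 0 = ContinuousLinearMap.id ℂ (W.E s)
  S_add : ∀ t ≥ 0, ∀ t' ≥ 0, W.S s (t + t') = (W.S s t).comp (W.S s t')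
  S_cont : ∀ U, ContinuousOn (fun t => W.S s t U) (Ici 0)
  /-- smooth data of compact support away from the imposed boundary belong to the space -/
  compact_data : ∀ f g, X.IsSource f → X.IsSource g →
    ∃ U : W.E s, W.HasData s U f g ∧ W.Regular s U
  dense : ∀ U V : W.E s, W.Gen s U V → ∀ ε > 0, ∃ U' V', W.Gen s U' V' ∧ W.Regular s U' ∧
    ‖U - U'‖ < ε ∧ ‖V - V'‖ < ε
  /-- the source vector of `□_g u = F` is `(0, F)`, up to the normalizing factor `g(dτ, dτ)` -/
  first_order : ∀ T > 0, ∀ (u F : ℝ → ℝ × ℝ → ℂ) (U 𝓕 : ℝ → W.E s),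
    X.Admissible (Icc 0 T) u →
    ContDiffOn ℝ ∞ (fun q : ℝ × (ℝ × ℝ) => F q.1 q.2) (Icc 0 T ×ˢ X.slice) →
    W.Traces s (Icc 0 T) u U → ContinuousOn 𝓕 (Icc 0 T) →
    (∀ t ∈ Icc 0 T, W.HasData s (𝓕 t) 0 (fun p => F t p / (X.gTauTau p : ℂ))) →
    ((∀ τ ∈ Ioo 0 T, ∀ p ∈ X.inner, X.waveOp u τ p = F τ p) ↔ W.IsMild s T 𝓕 U)

/-- The local-energy norms: they are built from lower semicontinuous seminorms on data, contain
the nondegenerate energy near each horizon and a norm on the interaction region, and are paired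
with the norms of sources. -/
structure LocalEnergy : Prop where
  lsc : ∀ i, LowerSemicontinuous (W.le s i)
  smul : ∀ i (z : ℂ) U, W.le s i (z • U) = ‖z‖ₑ * W.le s i U
  add_le : ∀ i U V, W.le s i (U + V) ≤ W.le s i U + W.le s i V
  redshift : ∀ r ∈ X.horizons, ∃ δ > 0, ∃ (i : ℕ) (C : ℝ≥0), ∀ U : W.E s,
    X.hNorm (s + 1) {p | |p.1 - r| < δ} (W.data s U).1
      + X.hNorm s {p | |p.1 - r| < δ} (W.data s U).2 ≤ C * W.le s i U
  interaction : ∀ χ, Exterior.IsCutoff χ → Disjoint (tsupport χ) X.imposed →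
    ∃ (i : ℕ) (C : ℝ≥0), ∀ U : W.E s, W.cutNorm s χ U ≤ C * W.le s i U
  dual_zero : ∀ T > 0, W.leDual s T 0 = 0
  dual_smul : ∀ T > 0, ∀ (z : ℂ) F, W.leDual s T (z • F) = ‖z‖ₑ * W.leDual s T F
  dual_add_le : ∀ T > 0, ∀ F F', W.leDual s T (F + F') ≤ W.leDual s T F + W.leDual s T F'
  pairing : ∃ C : ℝ≥0, ∀ T > 0, ∀ (F : ℝ → ℝ × ℝ → ℂ) (U : ℝ → W.E s),
    ContDiff ℝ ∞ (fun q : ℝ × (ℝ × ℝ) => F q.1 q.2) →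
    HasCompactSupport (fun q : ℝ × (ℝ × ℝ) => F q.1 q.2) →
    tsupport (fun q : ℝ × (ℝ × ℝ) => F q.1 q.2) ⊆ Ioo 0 T ×ˢ X.inner →
    ContinuousOn U (Icc 0 T) →
    W.leDual s T F < ⊤ ∧
    ‖∫ t in (0 : ℝ)..T, ∫ p, F t p * starRingEnd ℂ ((W.data s (U t)).2 p)
        * (X.rhoSq p.1 p.2 : ℂ) ∂X.vol‖ₑ
      ≤ C * W.leDual s T F * W.leNorm s (Icc 0 T) U

/-- **BH4**: finite-time red-shift and local-energy estimate with compact error, with a constant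
independent of `T`. -/
structure BH4 : Prop where
  localEnergy : W.LocalEnergy s
  cutoff : Exterior.IsCutoff (W.chi s)
  cutoff_horizon : ∀ p ∈ tsupport (W.chi s), p.1 ∉ X.horizons
  estimate : ∃ C : ℝ≥0, ∀ T > 0, ∀ (u F : ℝ → ℝ × ℝ → ℂ) (U : ℝ → W.E s),
    X.Admissible (Icc 0 T) u →
    ContDiffOn ℝ ∞ (fun q : ℝ × (ℝ × ℝ) => F q.1 q.2) (Icc 0 T ×ˢ X.slice) →
    (∀ τ ∈ Ioo 0 T, ∀ p ∈ X.inner, X.waveOp u τ p = F τ p) →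
    W.Traces s (Icc 0 T) u U →
    (⨆ t ∈ Icc (0 : ℝ) T, ‖U t‖ₑ ^ 2) + W.leNorm s (Icc 0 T) U ^ 2
      ≤ C * (‖U 0‖ₑ ^ 2 + W.leDual s T F ^ 2
          + ∫⁻ t in Icc 0 T, W.cutNorm s (W.chi s) (U t) ^ 2)

end Realization

namespace Exterior

variable (X : Exterior) (s : ℕ)

/-- **BH5**: mode stability in the upper half-plane, and existence and boundedness of the limiting
resolvent on compact sets of nonzero real frequencies, where there are no outgoing resonances. -/
structure BH5 : Prop where
  upper : ∀ σ : ℂ, 0 < σ.im → ∀ w, X.Resolvent σ 0 w → ∀ p ∈ X.slice, w p = 0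
  real : ∀ σ : ℝ, σ ≠ 0 → ∀ w, X.Resolvent σ 0 w → ∀ p ∈ X.slice, w p = 0
  limiting : ∀ I : Set ℝ, IsCompact I → (0 : ℝ) ∉ I → ∀ χ, IsCutoff χ → ∃ C : ℝ≥0,
    ∀ σ ∈ I, ∀ f, X.IsSource f → ∃ w : ℝ → ℝ × ℝ → ℂ,
      (∀ ε ∈ Icc (0 : ℝ) 1,
        X.Resolvent ((σ : ℂ) + Complex.I * (ε : ℂ)) (fun p => (χ p : ℂ) * f p) (w ε)) ∧
      (∀ ε ∈ Ioc (0 : ℝ) 1,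
        X.hNorm (s + 1) univ (fun p => (χ p : ℂ) * w ε p) ≤ C * X.hNorm s univ f) ∧
      Tendsto (fun ε : ℝ => X.hNorm (s + 1) univ (fun p => (χ p : ℂ) * (w ε p - w 0 p)))
        (𝓝[>] 0) (𝓝 0)

/-- **BH6**: polynomial high-frequency bound for the outgoing resolvent on the real axis. -/
def BH6 : Prop :=
  ∃ (σ₀ : ℝ) (n : ℕ), 0 < σ₀ ∧ ∀ χ, IsCutoff χ → ∃ C : ℝ≥0,
    ∀ σ : ℝ, σ₀ ≤ |σ| → ∀ f, X.IsSource f →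
      ∃ w, X.Resolvent σ (fun p => (χ p : ℂ) * f p) w ∧
        X.hNorm (s + 1) univ (fun p => (χ p : ℂ) * w p)
          ≤ C * ENNReal.ofReal (Real.sqrt (1 + σ ^ 2)) ^ n * X.hNorm s univ f

/-- The resolvent part of **BH8**: finite-rank Laurent expansion of the cutoff outgoing resolvent
at zero frequency, with a remainder that is bounded between the local spaces. -/
def LaurentAtZero : Prop :=
  ∀ χ, IsCutoff χ → ∃ (ν : ℕ) (A : Fin ν → ((ℝ × ℝ → ℂ) →ₗ[ℂ] (ℝ × ℝ → ℂ))) (δ : ℝ) (C : ℝ≥0),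
    0 < δ ∧ (∀ j, FiniteDimensional ℂ (LinearMap.range (A j))) ∧
    (∀ j f, X.IsSource f → X.hNorm (s + 1) univ (A j f) ≤ C * X.hNorm s univ f) ∧
    ∀ σ : ℂ, σ ≠ 0 → ‖σ‖ < δ → 0 ≤ σ.im → ∀ f, X.IsSource f →
      ∃ w, X.Resolvent σ (fun p => (χ p : ℂ) * f p) w ∧
        X.hNorm (s + 1) univ
            (fun p => (χ p : ℂ) * w p - ∑ j : Fin ν, σ⁻¹ ^ ((j : ℕ) + 1) * A j f p)
          ≤ C * X.hNorm s univ f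

end Exterior

namespace Realization

variable {X : Exterior} (W : Realization.{u} X) (s : ℕ)

/-- **BH7**: compact smoothing for the projected evolution, and its local representation by a
frequency density that is integrable with values in `H¹(K) × L²(K)`. -/
structure BH7 : Prop where
  smoothing : ∃ C : ℝ≥0, ∀ U₀ : W.E s,
    (∫⁻ t in Ici 0, W.cutNorm s (W.chi s) (W.S s t (U₀ - W.proj s U₀)) ^ 2) ^ (1 / 2 : ℝ)
      ≤ C * ‖U₀ - W.proj s U₀‖ₑ
  density : ∀ K, IsCompact K → K ⊆ X.slice → Disjoint K X.imposed →
    ∃ (B : ℝ → W.E s →L[ℂ] X.JetSpace K) (C : ℝ≥0),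
      (∀ σ V, B σ V ∈ X.H1L2 K) ∧
      ∀ U₀ : W.E s,
        Integrable (fun σ => B σ (U₀ - W.proj s U₀)) ∧
        ∫ σ, ‖B σ (U₀ - W.proj s U₀)‖ ≤ C * ‖U₀ - W.proj s U₀‖ ∧
        ∀ t ≥ 0, W.HasLocalJet s K (W.S s t (U₀ - W.proj s U₀))
          (∫ σ : ℝ, Complex.exp (-(Complex.I * t * σ)) • B σ (U₀ - W.proj s U₀))

/-- **BH8**: zero-frequency threshold control. -/
structure BH8 : Prop where
  laurent : X.LaurentAtZero s
  finite_rank : ∃ (d : ℕ) (ℓ : Fin d → W.E s →L[ℂ] ℂ) (V : Fin d → W.E s),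
    ∀ U, W.proj s U = ∑ α, ℓ α U • V α
  idem : (W.proj s).comp (W.proj s) = W.proj s
  range_eq : Set.range (W.proj s) = W.threshold s
  commute : ∀ t ≥ 0, (W.S s t).comp (W.proj s) = (W.proj s).comp (W.S s t)
  nilpotent : ∃ q, ∀ V ∈ W.threshold s, V ∈ W.kerPow s q

/-- **BH9**: cutoffs that are locally constant near the imposed boundary and near the noncompact
end act boundedly on the energy space, preserve the domain of the generator, and have bounded
commutators with it. -/
def BH9 : Prop :=
  ∀ χ : ℝ × ℝ → ℝ, ContDiff ℝ ∞ χ → IsCompact (tsupport (fderiv ℝ χ) ∩ X.slice) →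
    Disjoint (tsupport (fderiv ℝ χ)) X.imposed →
    ∃ (m : W.E s →L[ℂ] W.E s) (C : ℝ),
      (∀ U, W.HasData s (m U) (fun p => (χ p : ℂ) * (W.data s U).1 p)
        (fun p => (χ p : ℂ) * (W.data s U).2 p)) ∧
      ∀ U V, W.Gen s U V → ∃ V', W.Gen s (m U) V' ∧ ‖V' - m V‖ ≤ C * ‖U‖

/-- The axisymmetric black-hole exterior package, for all `s ≥ s₀`. -/
def Package (s₀ : ℕ) : Prop :=
  X.BH1 ∧ ∀ s, s₀ ≤ s → W.BH2 s ∧ W.BH3 s ∧ W.BH4 s ∧ X.BH5 s ∧ X.BH6 s ∧ W.BH7 s ∧ W.BH8 s ∧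
    W.BH9 s

end Realization

end CarterBH

end

/-! Under the package, the general items are functional analysis. The evolution is a strongly
continuous semigroup, so integrated solutions are unique (`IsC0.mild_unique`); smooth solutions are
integrated solutions by BH3, and with the projection `W.proj s` the decomposition is linearity.
Along a Jordan chain of the generator the identity S(t)U - U = ∫₀ᵗ S(s)GU ds can be iterated, which
gives the polynomial threshold term (`IsC0.apply_chain`). The estimate BH4 concerns smooth
solutions; density of regular data and lower semicontinuity of the seminorms extend it to all data
(`Package.estimate`), and on the range of I - Π the compact error is absorbed by BH7. Local decay is
the Riemann–Lebesgue lemma for the frequency density of BH7. Absence of growing modes is part of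
BH5.

The Kerr–Newman statements need the equation itself. On a slice of a smooth solution with Cauchy
data (f, w) and y = ∂_τ w, the formula for ρ²□ (`BH1.rho_mul_waveOp`) reads ∂_r(Δ_r f_r) + ∂_x(Δ_x
f_x) = N y - H' w - 2H w_r. By density in the graph norm, every pair (V, GV) is a limit of pairs
((f, w), (w, y)) of this kind (`BH3.exists_timeSlice_near`).

If GV = 0, then w, w_r and y tend to zero in L² on bounded boxes. Testing against (α + βr)² f bounds
a weighted Dirichlet energy of f by these small terms and 4β² ∫ Δ_r |f|² (`BH1.energy_bound`); a
Poincaré inequality turns it into oscillation (`BH3.oscillation_le`). At a Neumann wall the weight 1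
is allowed, so β = 0 and V is constant. At infinity the weight is 1 - r/R; since Δ_r ≤ r², the last
term is bounded by a multiple of ∫ min(1, (r/R)²)|u|², which tends to zero as R → ∞ when the Hardy
term is finite. A nonzero constant has infinite Hardy term, so the kernel is trivial.

If GV = (z, 0) at a Neumann wall, testing against 1 leaves in the limit only the horizon flux (r_h²
+ a²)(x_u - x_l) z, so z = 0 (`BH3.eq_zero_of_gen_const`): there is no Jordan block over the
constants. -/

noncomputable section

namespace CarterBH

universe u

/-! ### Strongly continuous semigroups -/

/-- A strongly continuous semigroup of bounded operators. -/
structure IsC0 {E : Type*} [NormedAddCommGroup E] [NormedSpace ℂ E] (S : ℝ → E →L[ℂ] E) :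
    Prop where
  zero : S 0 = ContinuousLinearMap.id ℂ E
  add : ∀ t ≥ 0, ∀ t' ≥ 0, S (t + t') = (S t).comp (S t')
  cont : ∀ U, ContinuousOn (fun t => S t U) (Ici 0)

/-- The graph of the generator. -/
def GenOf {E : Type*} [NormedAddCommGroup E] [NormedSpace ℂ E] (S : ℝ → E →L[ℂ] E) (U V : E) :
    Prop :=
  Tendsto (fun t : ℝ => ((t⁻¹ : ℝ) : ℂ) • (S t U - U)) (𝓝[>] 0) (𝓝 V)

section Semigroup

variable {E : Type*} [NormedAddCommGroup E] [NormedSpace ℂ E] {S : ℝ → E →L[ℂ] E}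

theorem GenOf.unique {U V V' : E} (h : GenOf S U V) (h' : GenOf S U V') : V = V' :=
  tendsto_nhds_unique h h'

theorem GenOf.zero : GenOf S (0 : E) 0 := by
  simp [GenOf]

theorem GenOf.add {U V U' V' : E} (h : GenOf S U V) (h' : GenOf S U' V') :
    GenOf S (U + U') (V + V') := by
  unfold GenOf at *
  refine (Tendsto.add h h').congr fun t => ?_
  rw [map_add, ← smul_add]
  congr 1
  abel

theorem GenOf.smul {U V : E} (h : GenOf S U V) (z : ℂ) : GenOf S (z • U) (z • V) := by
  unfold GenOf at *
  refine (Tendsto.const_smul h z).congr fun t => ?_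
  rw [map_smul, ← smul_sub, smul_comm]

theorem GenOf.sub {U V U' V' : E} (h : GenOf S U V) (h' : GenOf S U' V') :
    GenOf S (U - U') (V - V') := by
  have := h.add (h'.smul (-1))
  simpa [sub_eq_add_neg] using this

theorem GenOf.map {U V : E} (hS : IsC0 S) (h : GenOf S U V) {t : ℝ} (ht : 0 ≤ t) :
    GenOf S (S t U) (S t V) := by
  unfold GenOf at *
  refine (((S t).continuous.tendsto V).comp h).congr' ?_
  filter_upwards [self_mem_nhdsWithin] with r (hr : 0 < r)
  simp only [Function.comp, map_smul, map_sub]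
  rw [← ContinuousLinearMap.comp_apply, ← hS.add t ht r hr.le, add_comm t r,
    hS.add r hr.le t ht, ContinuousLinearMap.comp_apply]

theorem IsC0.apply_add (hS : IsC0 S) {t t' : ℝ} (ht : 0 ≤ t) (ht' : 0 ≤ t') (U : E) :
    S (t + t') U = S t (S t' U) := by
  rw [hS.add t ht t' ht']; rfl

theorem IsC0.apply_zero (hS : IsC0 S) (U : E) : S 0 U = U := by rw [hS.zero]; rfl

theorem tendsto_Ioi_zero_of_add {F' : Type*} {F : ℝ → F'} {t : ℝ} {l : Filter F'}
    (h : Tendsto (fun r => F (t + r)) (𝓝[>] 0) l) : Tendsto F (𝓝[>] t) l := by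
  have : Tendsto (fun r : ℝ => r - t) (𝓝[>] t) (𝓝[>] 0) := by
    refine tendsto_nhdsWithin_iff.2 ⟨?_, ?_⟩
    · have : Tendsto (fun r : ℝ => r - t) (𝓝 t) (𝓝 (t - t)) := by
        exact (continuous_id.sub continuous_const).tendsto t
      rw [sub_self] at this
      exact this.mono_left nhdsWithin_le_nhds
    · filter_upwards [self_mem_nhdsWithin] with r hr
      simpa using hr
  refine (h.comp this).congr fun r => ?_
  simp

theorem hasDerivWithinAt_Ici_of_add {F : ℝ → E} {t : ℝ} {V : E}
    (h : Tendsto (fun r : ℝ => ((r⁻¹ : ℝ) : ℂ) • (F (t + r) - F t)) (𝓝[>] 0) (𝓝 V)) :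
    HasDerivWithinAt F V (Ici t) t := by
  rw [← hasDerivWithinAt_Ioi_iff_Ici, hasDerivWithinAt_iff_tendsto_slope']
  · refine tendsto_Ioi_zero_of_add (h.congr fun r => ?_)
    rw [slope_def_module, add_sub_cancel_left]
    exact Complex.coe_smul _ _
  · simp

theorem IsC0.hasDeriv_right (hS : IsC0 S) {U V : E} (h : GenOf S U V) {t : ℝ} (ht : 0 ≤ t) :
    HasDerivWithinAt (fun t => S t U) (S t V) (Ici t) t := by
  refine hasDerivWithinAt_Ici_of_add ((h.map hS ht).congr' ?_)
  filter_upwards [self_mem_nhdsWithin] with r (hr : 0 < r)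
  rw [add_comm t r, hS.apply_add hr.le ht]

theorem IsC0.intervalIntegrable (hS : IsC0 S) (U : E) {a b : ℝ} (ha : 0 ≤ a) (hb : 0 ≤ b) :
    IntervalIntegrable (fun t => S t U) volume a b := by
  refine ContinuousOn.intervalIntegrable ((hS.cont U).mono ?_)
  intro x hx
  exact (le_min ha hb).trans hx.1

variable [CompleteSpace E]

/-- Orbits are continuous, hence bounded on the compact interval; the uniform boundedness principle
does the rest. -/
theorem IsC0.bounded (hS : IsC0 S) (T : ℝ) : ∃ M : ℝ, 0 ≤ M ∧ ∀ t ∈ Icc 0 T, ‖S t‖ ≤ M := by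
  have := banach_steinhaus (g := fun t : Icc (0 : ℝ) T => S t) (fun U => by
    obtain ⟨C, hC⟩ := (isCompact_Icc (a := (0 : ℝ)) (b := T)).exists_bound_of_continuousOn
      ((hS.cont U).mono Icc_subset_Ici_self)
    exact ⟨C, fun t => hC t t.2⟩)
  obtain ⟨C, hC⟩ := this
  exact ⟨max C 0, le_max_right _ _, fun t ht => (hC ⟨t, ht⟩).trans (le_max_left _ _)⟩

/-- Joint continuity in time and datum: the varying datum is handled by the operator bound on [0,
T], the varying time by strong continuity at the fixed limit datum. -/
theorem IsC0.tendsto_apply (hS : IsC0 S) {ι : Type*} {l : Filter ι} {τ : ι → ℝ} {t T : ℝ}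
    {V : ι → E} {U : E} (hτ : Tendsto τ l (𝓝 t)) (hτ0 : ∀ᶠ i in l, τ i ∈ Icc 0 T) (ht : 0 ≤ t)
    (hV : Tendsto V l (𝓝 U)) : Tendsto (fun i => S (τ i) (V i)) l (𝓝 (S t U)) := by
  obtain ⟨M, hM0, hM⟩ := hS.bounded T
  have h1 : Tendsto (fun i => S (τ i) U) l (𝓝 (S t U)) := by
    refine (hS.cont U t ht).tendsto.comp (tendsto_nhdsWithin_iff.2 ⟨hτ, ?_⟩)
    filter_upwards [hτ0] with i hi using hi.1
  have h2 : Tendsto (fun i => S (τ i) (V i - U)) l (𝓝 0) := by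
    have h3 : Tendsto (fun i => M * ‖V i - U‖) l (𝓝 0) := by
      have : Tendsto (fun i => ‖V i - U‖) l (𝓝 0) := tendsto_iff_norm_sub_tendsto_zero.1 hV
      simpa using this.const_mul M
    refine squeeze_zero_norm' ?_ h3
    filter_upwards [hτ0] with i hi
    exact ((S (τ i)).le_opNorm _).trans (by gcongr; exact hM _ hi)
  have := h1.add h2
  simpa using this

theorem IsC0.continuousOn_apply (hS : IsC0 S) {t : ℝ} {V : ℝ → E} (hV : ContinuousOn V (Icc 0 t)) :
    ContinuousOn (fun s => S (t - s) (V s)) (Icc 0 t) := by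
  intro s hs
  refine hS.tendsto_apply (T := t) ?_ ?_ (sub_nonneg.2 hs.2) (hV s hs)
  · exact ((continuous_const.sub continuous_id).tendsto s).mono_left nhdsWithin_le_nhds
  · filter_upwards [self_mem_nhdsWithin] with r hr
    exact ⟨sub_nonneg.2 hr.2, by linarith [hr.1]⟩

/-- The generator is a limit from the right, so orbits come with right derivatives only; for a
continuous function with integrable right derivative this suffices for the fundamental theorem of
calculus. -/
theorem IsC0.sub_eq_integral (hS : IsC0 S) {U V : E} (h : GenOf S U V) {t : ℝ} (ht : 0 ≤ t) :
    S t U - U = ∫ s in (0 : ℝ)..t, S s V := by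
  have := intervalIntegral.integral_eq_sub_of_hasDeriv_right_of_le ht
    ((hS.cont U).mono Icc_subset_Ici_self) (f' := fun s => S s V)
    (fun s hs => (hS.hasDeriv_right h hs.1.le).mono Ioi_subset_Ici_self)
    (hS.intervalIntegrable V le_rfl ht)
  rw [this, hS.apply_zero]

theorem tendsto_average_right {F : ℝ → E} {t : ℝ} (ht : 0 ≤ t) (hF : ContinuousOn F (Ici 0)) :
    Tendsto (fun r : ℝ => ((r⁻¹ : ℝ) : ℂ) • ∫ s in t..(t + r), F s) (𝓝[>] 0) (𝓝 (F t)) := by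
  have hi : IntervalIntegrable F volume t (t + 1) :=
    ContinuousOn.intervalIntegrable (hF.mono fun x hx => by
      rw [uIcc_of_le (by linarith)] at hx; exact ht.trans hx.1)
  have hd : HasDerivWithinAt (fun u => ∫ s in t..u, F s) (F t) (Ici t) t := by
    refine intervalIntegral.integral_hasDerivWithinAt_right (t := Ioi t) (by simp) ?_
      ((hF t ht).mono fun x (hx : t < x) => ht.trans hx.le)
    refine ⟨Ioi t, self_mem_nhdsWithin, ?_⟩
    exact (hF.mono fun x (hx : t < x) => ht.trans hx.le).aestronglyMeasurable measurableSet_Ioi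
  rw [← hasDerivWithinAt_Ioi_iff_Ici, hasDerivWithinAt_iff_tendsto_slope' (by simp)] at hd
  have h0 : Tendsto (fun r : ℝ => t + r) (𝓝[>] 0) (𝓝[>] t) := by
    refine tendsto_nhdsWithin_iff.2 ⟨?_, ?_⟩
    · have : Tendsto (fun r : ℝ => t + r) (𝓝 0) (𝓝 (t + 0)) :=
        (continuous_const.add continuous_id).tendsto 0
      rw [add_zero] at this
      exact this.mono_left nhdsWithin_le_nhds
    · filter_upwards [self_mem_nhdsWithin] with r hr
      simpa using hr
  refine (hd.comp h0).congr fun r => ?_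
  simp only [Function.comp, slope_def_module, add_sub_cancel_left, intervalIntegral.integral_same,
    sub_zero]
  exact (Complex.coe_smul _ _).symm

/-- Applying S r shifts the window of integration, so the difference quotient telescopes to the
average of the orbit over [t, t + r] minus its average over [0, r]. -/
theorem IsC0.gen_integral (hS : IsC0 S) (U : E) {t : ℝ} (ht : 0 ≤ t) :
    GenOf S (∫ s in (0 : ℝ)..t, S s U) (S t U - U) := by
  have h1 := tendsto_average_right ht (hS.cont U)
  have h2 := tendsto_average_right le_rfl (hS.cont U)
  rw [hS.apply_zero] at h2
  refine (h1.sub h2).congr' ?_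
  filter_upwards [self_mem_nhdsWithin] with r (hr : 0 < r)
  rw [← smul_sub]
  congr 1
  have h3 : S r (∫ s in (0 : ℝ)..t, S s U) = ∫ s in r..(t + r), S s U := by
    rw [← ContinuousLinearMap.intervalIntegral_comp_comm _ (hS.intervalIntegrable U le_rfl ht)]
    have : ∫ s in (0 : ℝ)..t, S r (S s U) = ∫ s in (0 : ℝ)..t, S (s + r) U := by
      refine intervalIntegral.integral_congr fun s hs => ?_
      rw [uIcc_of_le ht] at hs
      rw [add_comm, hS.apply_add hr.le hs.1]
    rw [this, intervalIntegral.integral_comp_add_right (fun s => S s U), zero_add]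
  rw [h3, zero_add]
  have i1 := hS.intervalIntegrable U (a := 0) (b := t) le_rfl ht
  have i2 := hS.intervalIntegrable U (a := t) (b := t + r) ht (by positivity)
  have i3 := hS.intervalIntegrable U (a := 0) (b := r) le_rfl hr.le
  have i4 := hS.intervalIntegrable U (a := r) (b := t + r) hr.le (by positivity)
  have e1 := intervalIntegral.integral_add_adjacent_intervals i1 i2
  have e2 := intervalIntegral.integral_add_adjacent_intervals i3 i4
  rw [sub_eq_sub_iff_add_eq_add, add_comm (∫ s in t..(t + r), S s U), e1, ← e2]
  abel

/-- Density of the domain: short-time averages of an orbit lie in the domain and converge to the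
initial datum. -/
theorem IsC0.exists_gen_near (hS : IsC0 S) (U : E) {ε : ℝ} (hε : 0 < ε) :
    ∃ A B, GenOf S A B ∧ ‖U - A‖ < ε := by
  have h2 := tendsto_average_right le_rfl (hS.cont U)
  rw [hS.apply_zero] at h2
  have h3 := (Metric.tendsto_nhds.1 h2 ε hε).and
    (self_mem_nhdsWithin : ∀ᶠ r : ℝ in 𝓝[>] 0, r ∈ Ioi (0 : ℝ))
  obtain ⟨r, hr, hr0⟩ := h3.exists
  have hg := (hS.gen_integral U (le_of_lt hr0)).smul ((r⁻¹ : ℝ) : ℂ)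
  refine ⟨_, _, hg, ?_⟩
  rw [dist_eq_norm, zero_add] at hr
  rwa [norm_sub_rev]

/-- Duhamel argument: s ↦ S(t - s) Z(s) has right derivative S(t - s)(Z' - GZ) = 0, so its values at
s = 0 and s = t agree, and these are 0 and Z(t). -/
theorem IsC0.eq_zero_of_hasDeriv (hS : IsC0 S) {T : ℝ} {Z Z' : ℝ → E}
    (hZc : ContinuousOn Z (Icc 0 T)) (hZ0 : Z 0 = 0)
    (hZ : ∀ s ∈ Ioo 0 T, HasDerivWithinAt Z (Z' s) (Ioi s) s)
    (hG : ∀ s ∈ Ioo 0 T, GenOf S (Z s) (Z' s)) {t : ℝ} (ht : t ∈ Icc 0 T) : Z t = 0 := by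
  have hc := hS.continuousOn_apply (hZc.mono (Icc_subset_Icc_right ht.2))
  have hd : ∀ s ∈ Ioo 0 t, HasDerivWithinAt (fun s => S (t - s) (Z s)) 0 (Ioi s) s := by
    intro s hs
    have hsT : s ∈ Ioo 0 T := ⟨hs.1, hs.2.trans_le ht.2⟩
    rw [hasDerivWithinAt_Ioi_iff_Ici]
    refine hasDerivWithinAt_Ici_of_add ?_
    have h0 : Tendsto (fun r : ℝ => s + r) (𝓝[>] 0) (𝓝[>] s) := by
      refine tendsto_nhdsWithin_iff.2 ⟨?_, ?_⟩
      · have : Tendsto (fun r : ℝ => s + r) (𝓝 0) (𝓝 (s + 0)) :=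
          (continuous_const.add continuous_id).tendsto 0
        rw [add_zero] at this
        exact this.mono_left nhdsWithin_le_nhds
      · filter_upwards [self_mem_nhdsWithin] with r hr
        simpa using hr
    have h1 : Tendsto (fun r : ℝ => ((r⁻¹ : ℝ) : ℂ) • (Z (s + r) - Z s)) (𝓝[>] 0)
        (𝓝 (Z' s)) := by
      have := hZ s hsT
      rw [hasDerivWithinAt_iff_tendsto_slope' (by simp)] at this
      refine (this.comp h0).congr fun r => ?_
      simp only [Function.comp, slope_def_module, add_sub_cancel_left]
      exact (Complex.coe_smul _ _).symm
    have h2 := h1.sub (hG s hsT)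
    rw [sub_self] at h2
    have hlt : ∀ᶠ r : ℝ in 𝓝[>] 0, r ∈ Ioo 0 (t - s) :=
      Ioo_mem_nhdsGT (sub_pos.2 hs.2)
    have h3 : Tendsto (fun r : ℝ => t - s - r) (𝓝[>] 0) (𝓝 (t - s)) := by
      have : Tendsto (fun r : ℝ => t - s - r) (𝓝 0) (𝓝 (t - s - 0)) :=
        (continuous_const.sub continuous_id).tendsto 0
      rw [sub_zero] at this
      exact this.mono_left nhdsWithin_le_nhds
    have h4 := hS.tendsto_apply (T := t) h3 (by
      filter_upwards [hlt] with r hr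
      exact ⟨by linarith [hr.2], by linarith [hr.1, hs.1]⟩) (sub_nonneg.2 hs.2.le) h2
    rw [map_zero] at h4
    refine h4.congr' ?_
    filter_upwards [hlt] with r hr
    -- Pulling out S(t - s - r) turns the quotient of the product into the difference of the
    -- quotients of Z and of the orbit of Z(s), so the generator is never applied inside S(t - s).
    have e : S (t - s) (Z s) = S (t - s - r) (S r (Z s)) := by
      rw [← hS.apply_add (by linarith [hr.2]) hr.1.le, sub_add_cancel]
    rw [e, ← sub_sub t s r]
    rw [← smul_sub, map_smul, ← map_sub]
    congr 2
    abel
  have := intervalIntegral.integral_eq_sub_of_hasDeriv_right_of_le ht.1 hc hd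
    (by simp)
  simp only [intervalIntegral.integral_zero, sub_self, hS.apply_zero, hZ0, map_zero,
    sub_zero] at this
  exact this.symm

/-- A mild solution need not be differentiable, but its primitive is. The primitives of U and of the
orbit of U(0) differ by a solution of Z' = GZ with Z(0) = 0; once they coincide, so do their images
under the generator, U(t) - U(0) and S(t)U(0) - U(0). -/
theorem IsC0.mild_unique (hS : IsC0 S) {T : ℝ} {U : ℝ → E} (hU : ContinuousOn U (Icc 0 T))
    (hG : ∀ t ∈ Icc 0 T, GenOf S (∫ s in (0 : ℝ)..t, U s) (U t - U 0)) {t : ℝ}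
    (ht : t ∈ Icc 0 T) : U t = S t (U 0) := by
  have hT : 0 ≤ T := ht.1.trans ht.2
  have hSc : ContinuousOn (fun s => S s (U 0)) (Icc 0 T) :=
    (hS.cont _).mono Icc_subset_Ici_self
  have key : ∀ {F : ℝ → E}, ContinuousOn F (Icc 0 T) →
      ContinuousOn (fun t => ∫ s in (0 : ℝ)..t, F s) (Icc 0 T) ∧ ∀ s ∈ Ioo 0 T,
        HasDerivWithinAt (fun t => ∫ s in (0 : ℝ)..t, F s) (F s) (Ioi s) s := by
    intro F hF
    have hFi : IntervalIntegrable F volume 0 T := by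
      refine ContinuousOn.intervalIntegrable ?_
      rwa [uIcc_of_le hT]
    constructor
    · have := intervalIntegral.continuousOn_primitive_interval' hFi left_mem_uIcc
      rwa [uIcc_of_le hT] at this
    · intro s hs
      have hc : ContinuousAt F s := hF.continuousAt (Icc_mem_nhds hs.1 hs.2)
      refine (intervalIntegral.integral_hasDerivAt_right ?_ ?_ hc).hasDerivWithinAt
      · refine hFi.mono_set ?_
        rw [uIcc_of_le hT, uIcc_of_le hs.1.le]
        exact Icc_subset_Icc_right hs.2.le
      · exact ContinuousOn.stronglyMeasurableAtFilter isOpen_Ioo (hF.mono Ioo_subset_Icc_self)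
          s hs
  obtain ⟨c1, d1⟩ := key hU
  obtain ⟨c2, d2⟩ := key hSc
  have hz : ∀ t ∈ Icc 0 T, (∫ s in (0 : ℝ)..t, U s) - (∫ s in (0 : ℝ)..t, S s (U 0)) = 0 := by
    intro t ht
    refine hS.eq_zero_of_hasDeriv (T := T)
      (Z := fun t => (∫ s in (0 : ℝ)..t, U s) - (∫ s in (0 : ℝ)..t, S s (U 0)))
      (Z' := fun s => U s - S s (U 0)) (c1.sub c2) (by simp)
      (fun s hs => (d1 s hs).sub (d2 s hs)) (fun s hs => ?_) ht
    have := (hG s (Ioo_subset_Icc_self hs)).sub (hS.gen_integral (U 0) hs.1.le)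
    simpa using this
  have h1 := hG t ht
  rw [sub_eq_zero.1 (hz t ht)] at h1
  have := h1.unique (hS.gen_integral (U 0) ht.1)
  exact sub_left_injective this

/-- Downward recursion along the chain: c j evolves to itself plus the time integral of the
evolution of c (j + 1), and integrating s^i / i! produces the next Taylor coefficient. -/
theorem IsC0.apply_chain (hS : IsC0 S) {c : ℕ → E} (hc : ∀ j, GenOf S (c j) (c (j + 1))) {q : ℕ}
    (hq : ∀ j, q ≤ j → c j = 0) (j : ℕ) {t : ℝ} (ht : 0 ≤ t) :
    S t (c j) = ∑ i ∈ Finset.range q, (((t : ℝ) ^ i / (i.factorial : ℝ) : ℝ) : ℂ) • c (j + i) := by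
  by_cases hj : q ≤ j
  · rw [hq j hj, map_zero, Finset.sum_eq_zero]
    intro i _
    rw [hq (j + i) (by omega), smul_zero]
  · have h1 := hS.sub_eq_integral (hc j) ht
    have h2 : ∫ s in (0 : ℝ)..t, S s (c (j + 1)) = ∑ i ∈ Finset.range q,
        (((t : ℝ) ^ (i + 1) / ((i + 1).factorial : ℝ) : ℝ) : ℂ) • c (j + (i + 1)) := by
      have : ∫ s in (0 : ℝ)..t, S s (c (j + 1)) = ∫ s in (0 : ℝ)..t, ∑ i ∈ Finset.range q,
          (((s : ℝ) ^ i / (i.factorial : ℝ) : ℝ)) • c (j + 1 + i) := by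
        refine intervalIntegral.integral_congr fun s hs => ?_
        rw [uIcc_of_le ht] at hs
        rw [IsC0.apply_chain hS hc hq (j + 1) hs.1]
        rfl
      rw [this, intervalIntegral.integral_finsetSum]
      · refine Finset.sum_congr rfl fun i _ => ?_
        rw [intervalIntegral.integral_smul_const, intervalIntegral.integral_div, integral_pow]
        rw [show j + (i + 1) = j + 1 + i by ring, Complex.coe_smul]
        congr 1
        rw [Nat.factorial_succ]
        push_cast
        field_simp
        simp
      · intro i _
        refine Continuous.intervalIntegrable ?_ _ _
        fun_prop
    rw [h2] at h1
    rw [← sub_add_cancel (S t (c j)) (c j), h1]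
    -- The sum over q + 1 indices is split off at its first and at its last term; the last one
    -- contains c (j + q) = 0, so the index shift costs nothing.
    have h3 := Finset.sum_range_succ' (fun i =>
      (((t : ℝ) ^ i / (i.factorial : ℝ) : ℝ) : ℂ) • c (j + i)) q
    have h4 := Finset.sum_range_succ (fun i =>
      (((t : ℝ) ^ i / (i.factorial : ℝ) : ℝ) : ℂ) • c (j + i)) q
    rw [h3] at h4
    simp only [pow_zero, Nat.factorial_zero, Nat.cast_one, div_one, Complex.ofReal_one, one_smul,
      add_zero, hq (j + q) (by omega), smul_zero] at h4
    exact h4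
termination_by q - j

end Semigroup

namespace Realization

/-! ### The evolution semigroup and the threshold term -/

variable {X : Exterior} {W : Realization.{u} X} {s : ℕ}

theorem BH3.isC0 (h : W.BH3 s) : IsC0 (W.S s) := ⟨h.S_zero, h.S_add, h.S_cont⟩

theorem gen_iff {U V : W.E s} : W.Gen s U V ↔ GenOf (W.S s) U V := Iff.rfl

theorem BH3.isMild_unique (h : W.BH3 s) {T : ℝ} {U : ℝ → W.E s} (hU : W.IsMild s T 0 U) {t : ℝ}
    (ht : t ∈ Icc 0 T) : U t = W.S s t (U 0) := by
  refine h.isC0.mild_unique hU.1 (fun t ht => ?_) ht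
  have : GenOf (W.S s) _ _ := hU.2 t ht
  simpa using this

theorem BH3.isSolution_unique (h : W.BH3 s) {U₀ : W.E s} {U : ℝ → W.E s}
    (hU : W.IsSolution s U₀ U) {t : ℝ} (ht : 0 ≤ t) : U t = W.S s t U₀ := by
  rw [← hU.1]
  exact h.isMild_unique (hU.2 (t + 1) (by positivity)) ⟨ht, by linarith⟩

theorem BH3.isSolution (h : W.BH3 s) (U₀ : W.E s) :
    W.IsSolution s U₀ (fun t => W.S s t U₀) := by
  refine ⟨h.isC0.apply_zero U₀, fun T hT => ⟨(h.S_cont U₀).mono Icc_subset_Ici_self, ?_⟩⟩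
  intro t ht
  have := h.isC0.gen_integral U₀ ht.1
  rw [gen_iff]
  simpa [h.isC0.apply_zero] using this

theorem BH3.apply_of_gen_zero (h : W.BH3 s) {V : W.E s} (hV : W.Gen s V 0) {t : ℝ} (ht : 0 ≤ t) :
    W.S s t V = V := by
  have := h.isC0.sub_eq_integral hV ht
  simpa [sub_eq_zero] using this

theorem zero_mem_kerPow (n : ℕ) : (0 : W.E s) ∈ W.kerPow s n := by
  induction n with
  | zero => rfl
  | succ n ih => exact ⟨0, ih, GenOf.zero⟩

theorem kerPow_subset_succ (n : ℕ) : W.kerPow s n ⊆ W.kerPow s (n + 1) := by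
  induction n with
  | zero =>
    rintro U rfl
    exact zero_mem_kerPow 1
  | succ n ih =>
    rintro U ⟨V, hV, hG⟩
    exact ⟨V, ih hV, hG⟩

/-- The union starts at n = 1, so the exponent is raised by one to include n = 0. -/
theorem kerPow_subset_threshold (n : ℕ) : W.kerPow s n ⊆ W.threshold s := fun _ hU =>
  mem_iUnion₂.2 ⟨n + 1, by omega, kerPow_subset_succ n hU⟩

theorem zero_mem_threshold : (0 : W.E s) ∈ W.threshold s :=
  kerPow_subset_threshold 0 (zero_mem_kerPow 0)

/-- Unrolls the nested existentials in `kerPow` into one sequence, continued by zeros, in the form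
required by `IsC0.apply_chain`. -/
theorem exists_chain (n : ℕ) : ∀ U ∈ W.kerPow s n, ∃ c : ℕ → W.E s, c 0 = U ∧
    (∀ j, c j ∈ W.threshold s ∧ W.Gen s (c j) (c (j + 1))) ∧ ∀ j, n ≤ j → c j = 0 := by
  induction n with
  | zero =>
    rintro U rfl
    exact ⟨fun _ => 0, rfl, fun _ => ⟨zero_mem_threshold, GenOf.zero⟩, fun _ _ => rfl⟩
  | succ n ih =>
    intro U hU
    obtain ⟨V, hV, hG⟩ := id hU
    obtain ⟨c, hc0, hc, hn⟩ := ih V hV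
    refine ⟨fun j => Nat.casesOn j U c, rfl, ?_, ?_⟩
    · rintro (_ | j)
      · exact ⟨kerPow_subset_threshold _ hU, by simpa [hc0] using hG⟩
      · exact hc j
    · rintro (_ | j) hj
      · omega
      · exact hn j (by omega)

theorem BH3.threshold_expansion (h : W.BH3 s) {q : ℕ} {U : W.E s} (hU : U ∈ W.kerPow s q) :
    ∃ c : ℕ → W.E s, c 0 = U ∧ (∀ j, c j ∈ W.threshold s ∧ W.Gen s (c j) (c (j + 1))) ∧
      (∀ j, q ≤ j → c j = 0) ∧ ∀ t ≥ 0, W.S s t U =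
        ∑ j ∈ Finset.range q, (((t : ℝ) ^ j / (j.factorial : ℝ) : ℝ) : ℂ) • c j := by
  obtain ⟨c, hc0, hc, hq⟩ := exists_chain q U hU
  refine ⟨c, hc0, hc, hq, fun t ht => ?_⟩
  have := h.isC0.apply_chain (fun j => (hc j).2) hq 0 ht
  simpa [hc0] using this

theorem gen_zero_of_stationary {V : W.E s} (hV : ∀ t ≥ 0, W.S s t V = V) : W.Gen s V 0 := by
  refine tendsto_const_nhds.congr' ?_
  filter_upwards [self_mem_nhdsWithin] with t (ht : 0 < t)
  rw [hV t ht.le, sub_self, smul_zero]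

theorem finiteDimensional_range_of_sum {E : Type*} [NormedAddCommGroup E] [NormedSpace ℂ E]
    (P : E →L[ℂ] E) {d : ℕ} (ℓ : Fin d → E →L[ℂ] ℂ) (V : Fin d → E)
    (h : ∀ U, P U = ∑ α, ℓ α U • V α) :
    FiniteDimensional ℂ (LinearMap.range (P : E →ₗ[ℂ] E)) := by
  have hle : LinearMap.range (P : E →ₗ[ℂ] E) ≤ Submodule.span ℂ (Set.range V) := by
    rintro _ ⟨U, rfl⟩
    change P U ∈ _
    rw [h]
    exact Submodule.sum_mem _ fun α _ => Submodule.smul_mem _ _ (Submodule.subset_span ⟨α, rfl⟩)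
  have : FiniteDimensional ℂ (Submodule.span ℂ (Set.range V)) :=
    FiniteDimensional.span_of_finite ℂ (Set.finite_range V)
  exact Submodule.finiteDimensional_of_le hle

/-- The density in BH3 is relative to the graph norm and so concerns the domain only; the domain is
itself dense by time averages. -/
theorem BH3.dense_regular (h : W.BH3 s) (U : W.E s) {ε : ℝ} (hε : 0 < ε) :
    ∃ V, W.Regular s V ∧ ‖U - V‖ < ε := by
  obtain ⟨A, B, hAB, hA⟩ := h.isC0.exists_gen_near U (half_pos hε)
  obtain ⟨A', B', _, hreg, hA', _⟩ := h.dense A B hAB (ε / 2) (half_pos hε)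
  refine ⟨A', hreg, ?_⟩
  calc ‖U - A'‖ = ‖(U - A) + (A - A')‖ := by rw [sub_add_sub_cancel]
    _ ≤ ‖U - A‖ + ‖A - A'‖ := norm_add_le _ _
    _ < ε := by linarith

end Realization

/-! ### Restriction of classical solutions in time -/

namespace Exterior

variable {X : Exterior}

theorem differentiableWithinAt_time {J : Set ℝ} {u : ℝ → ℝ × ℝ → ℂ}
    (hu : ContDiffOn ℝ ∞ (fun q : ℝ × (ℝ × ℝ) => u q.1 q.2) (J ×ˢ X.slice)) {τ : ℝ} (hτ : τ ∈ J)
    {p : ℝ × ℝ} (hp : p ∈ X.slice) : DifferentiableWithinAt ℝ (fun τ' => u τ' p) J τ := by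
  have h1 := (hu.differentiableOn (by simp)) (τ, p) ⟨hτ, hp⟩
  exact h1.comp (f := fun τ' : ℝ => (τ', p)) τ (by fun_prop) fun x hx => ⟨hx, hp⟩

/-- Traces and wall laws use derivatives within the time set, so restriction from [0, ∞) to [0, T]
could change them at the end points; smoothness up to the boundary rules this out. -/
theorem derivWithin_time_mono {J J' : Set ℝ} (hJ : J' ⊆ J) {u : ℝ → ℝ × ℝ → ℂ}
    (hu : ContDiffOn ℝ ∞ (fun q : ℝ × (ℝ × ℝ) => u q.1 q.2) (J ×ˢ X.slice)) {τ : ℝ} (hτ : τ ∈ J')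
    (hJ' : UniqueDiffWithinAt ℝ J' τ) {p : ℝ × ℝ} (hp : p ∈ X.slice) :
    derivWithin (fun τ' => u τ' p) J' τ = derivWithin (fun τ' => u τ' p) J τ :=
  derivWithin_subset hJ hJ' (differentiableWithinAt_time hu (hJ hτ) hp)

theorem wall_mem_radial (h : X.radialInt.Nonempty) {R : ℝ} {law : WallLaw}
    (ho : X.outer = .wall R law) : R ∈ X.radial := by
  obtain ⟨r, hr⟩ := h
  simp only [radialInt, ho] at hr
  simp only [radial, ho]
  exact ⟨(hr.1.trans hr.2).le, le_rfl⟩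

theorem Admissible.mono (h : X.radialInt.Nonempty) {J J' : Set ℝ} (hJ : J' ⊆ J)
    (hJ' : UniqueDiffOn ℝ J') {u : ℝ → ℝ × ℝ → ℂ} (hu : X.Admissible J u) :
    X.Admissible J' u := by
  refine ⟨hu.1.mono (prod_mono hJ subset_rfl), ?_, ?_⟩
  · intro R law ho τ hτ x hx
    have h1 := hu.2.1 R law ho τ (hJ hτ) x hx
    have hp : (R, x) ∈ X.slice := ⟨wall_mem_radial h ho, hx⟩
    cases law with
    | dirichlet => exact h1
    | robin γ κ =>
      simp only at h1 ⊢
      rw [derivWithin_time_mono hJ hu.1 hτ (hJ' τ hτ) hp]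
      exact h1
  · intro e he τ hτ r hr
    exact hu.2.2 e he τ (hJ hτ) r hr

theorem ae_mem_inner : ∀ᵐ p ∂X.vol, p ∈ X.inner := by
  refine ae_restrict_mem ?_
  unfold inner radialInt
  cases X.outer <;> exact MeasurableSet.prod (by measurability) measurableSet_Ioo

theorem inner_subset_slice : X.inner ⊆ X.slice := by
  refine prod_mono ?_ Ioo_subset_Icc_self
  unfold radialInt radial
  cases X.outer
  · exact Ioo_subset_Icc_self
  · exact Ioo_subset_Icc_self
  · exact Ioi_subset_Ici_self

theorem ae_mem_slice : ∀ᵐ p ∂X.vol, p ∈ X.slice := by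
  filter_upwards [ae_mem_inner] with p hp using inner_subset_slice hp

end Exterior

namespace Realization

variable {X : Exterior} {W : Realization.{u} X} {s : ℕ}

theorem Traces.mono {J J' : Set ℝ} (hJ : J' ⊆ J) (hJ' : UniqueDiffOn ℝ J')
    {u : ℝ → ℝ × ℝ → ℂ}
    (hu : ContDiffOn ℝ ∞ (fun q : ℝ × (ℝ × ℝ) => u q.1 q.2) (J ×ˢ X.slice)) {U : ℝ → W.E s}
    (h : W.Traces s J u U) : W.Traces s J' u U := by
  intro t ht
  obtain ⟨h1, h2⟩ := h t (hJ ht)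
  refine ⟨h1, h2.trans ?_⟩
  filter_upwards [Exterior.ae_mem_slice] with p hp
  exact (Exterior.derivWithin_time_mono hJ hu ht (hJ' t ht) hp).symm

theorem BH3.classical_isMild (h : W.BH3 s) (hX : X.BH1) {u : ℝ → ℝ × ℝ → ℂ} {U : ℝ → W.E s}
    (hu : X.Admissible (Ici 0) u) (he : ∀ τ > 0, ∀ p ∈ X.inner, X.waveOp u τ p = 0)
    (hU : W.Traces s (Ici 0) u U) {T : ℝ} (hT : 0 < T) : W.IsMild s T 0 U := by
  refine (h.first_order T hT u 0 U 0 ?_ ?_ ?_ ?_ ?_).1 ?_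
  · exact hu.mono hX.radial_nonempty Icc_subset_Ici_self (uniqueDiffOn_Icc hT)
  · exact contDiffOn_const
  · exact hU.mono Icc_subset_Ici_self (uniqueDiffOn_Icc hT) hu.1
  · exact continuousOn_const
  · intro t _
    have h0 : (W.data s 0).1 = 0 ∧ (W.data s 0).2 = 0 := by simp
    constructor
    · simp only [Pi.zero_apply, h0]
      exact AEEqFun.coeFn_zero
    · simp only [Pi.zero_apply, h0, zero_div]
      exact AEEqFun.coeFn_zero
  · intro τ hτ p hp
    exact he τ hτ.1 p hp

theorem BH3.classical_eq (h : W.BH3 s) (hX : X.BH1) {u : ℝ → ℝ × ℝ → ℂ} {U : ℝ → W.E s}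
    (hu : X.Admissible (Ici 0) u) (he : ∀ τ > 0, ∀ p ∈ X.inner, X.waveOp u τ p = 0)
    (hU : W.Traces s (Ici 0) u U) {t : ℝ} (ht : 0 ≤ t) : U t = W.S s t (U 0) :=
  h.isMild_unique (h.classical_isMild hX hu he hU (T := t + 1) (by positivity))
    ⟨ht, by linarith⟩

end Realization

/-! ### Sobolev norms -/

theorem ennreal_add_sq_le (a b : ℝ≥0∞) : (a + b) ^ 2 ≤ 2 * (a ^ 2 + b ^ 2) := by
  have := ENNReal.rpow_add_le_mul_rpow_add_rpow a b (p := 2) (by norm_num)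
  norm_num at this
  exact_mod_cast this

namespace Exterior

variable {X : Exterior}

theorem isOpen_inner : IsOpen X.inner := by
  refine IsOpen.prod ?_ isOpen_Ioo
  unfold radialInt
  cases X.outer
  · exact isOpen_Ioo
  · exact isOpen_Ioo
  · exact isOpen_Ioi

/-- The integral over `K` of the squares of the jet components of order at most `k`. -/
def jetMass (X : Exterior) (k : ℕ) (K : Set (ℝ × ℝ)) (d : ℕ → ℕ → ℝ × ℝ → ℂ) : ℝ≥0∞ :=
  ∫⁻ p in K, ∑ i ∈ Finset.range (k + 1), ∑ j ∈ Finset.range (k + 1 - i),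
    ‖d i j p‖ₑ ^ 2 ∂X.vol

/-- Squaring is an order isomorphism of [0, ∞] and commutes with the infimum over jets. Later
comparisons are made jet by jet on the level of squares. -/
theorem hNorm_sq (k : ℕ) (K : Set (ℝ × ℝ)) (f : ℝ × ℝ → ℂ) :
    X.hNorm k K f ^ 2 = ⨅ d : {d // X.IsJet k f d}, X.jetMass k K d := by
  unfold hNorm
  rw [iInf_subtype']
  have h := (ENNReal.orderIsoRpow 2 (by norm_num)).map_iInf
    (fun d : {d // X.IsJet k f d} => X.jetMass k K d ^ (1 / 2 : ℝ))
  simp only [ENNReal.orderIsoRpow_apply] at h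
  rw [← ENNReal.rpow_natCast]
  refine h.trans (iInf_congr fun d => ?_)
  rw [← ENNReal.rpow_mul]
  norm_num

theorem hNorm_sq_le {k : ℕ} {K : Set (ℝ × ℝ)} {f : ℝ × ℝ → ℂ} {d : ℕ → ℕ → ℝ × ℝ → ℂ}
    (hd : X.IsJet k f d) : X.hNorm k K f ^ 2 ≤ X.jetMass k K d := by
  rw [hNorm_sq]
  exact iInf_le (fun d : {d // X.IsJet k f d} => X.jetMass k K d) ⟨d, hd⟩

theorem le_hNorm_sq {k : ℕ} {K : Set (ℝ × ℝ)} {f : ℝ × ℝ → ℂ} {a : ℝ≥0∞}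
    (h : ∀ d, X.IsJet k f d → a ≤ X.jetMass k K d) : a ≤ X.hNorm k K f ^ 2 := by
  rw [hNorm_sq]
  exact le_iInf fun d => h d d.2

theorem IsJet.congr {k : ℕ} {f g : ℝ × ℝ → ℂ} {d : ℕ → ℕ → ℝ × ℝ → ℂ} (h : X.IsJet k f d)
    (hfg : f =ᵐ[X.vol] g) : X.IsJet k g d :=
  ⟨h.zero.trans hfg, h.locInt, h.radial, h.odd, h.even⟩

theorem hNorm_congr {k : ℕ} {K : Set (ℝ × ℝ)} {f g : ℝ × ℝ → ℂ} (hfg : f =ᵐ[X.vol] g) :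
    X.hNorm k K f = X.hNorm k K g := by
  unfold hNorm
  refine iInf_congr fun d => ?_
  exact iInf_congr_Prop ⟨fun h => h.congr hfg, fun h => h.congr hfg.symm⟩ fun _ => rfl

theorem IsJet.aestronglyMeasurable {k : ℕ} {f : ℝ × ℝ → ℂ} {d : ℕ → ℕ → ℝ × ℝ → ℂ}
    (h : X.IsJet k f d) {i j : ℕ} (hij : i + j ≤ k) : AEStronglyMeasurable (d i j) X.vol :=
  (h.locInt i j hij).aestronglyMeasurable

theorem IsTest.continuous_fderiv {φ : ℝ × ℝ → ℂ} (h : X.IsTest φ) (e : ℝ × ℝ) :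
    Continuous fun p => fderiv ℝ φ p e :=
  (h.1.continuous_fderiv (by simp)).clm_apply continuous_const

theorem IsTest.integrable_mul {φ ψ : ℝ × ℝ → ℂ} (h : X.IsTest φ) (hψ : Continuous ψ)
    (hs : tsupport ψ ⊆ tsupport φ) {f : ℝ × ℝ → ℂ} (hf : LocallyIntegrableOn f X.inner) :
    Integrable (fun p => f p * ψ p) X.vol := by
  have hK : IsCompact (tsupport φ) := h.2.1
  have h1 : IntegrableOn f (tsupport φ) volume := hf.integrableOn_compact_subset h.2.2 hK
  have h2 : IntegrableOn (fun p => f p * ψ p) (tsupport φ) volume :=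
    h1.mul_continuousOn hψ.continuousOn hK
  have h3 : IntegrableOn (fun p => f p * ψ p) univ volume := by
    refine (integrableOn_iff_integrable_of_support_subset ?_).1 h2 |>.integrableOn
    intro p hp
    refine hs (subset_tsupport _ ?_)
    intro h0
    exact hp (by simp [h0])
  exact h3.mono_set (subset_univ _)

theorem tsupport_fderiv_apply_subset (φ : ℝ × ℝ → ℂ) (e : ℝ × ℝ) :
    tsupport (fun p => fderiv ℝ φ p e) ⊆ tsupport φ := by
  refine (closure_mono ?_).trans (tsupport_fderiv_subset ℝ (f := φ))
  intro p hp h0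
  exact hp (by simp [h0])

theorem IsWeakDeriv.add {e : ℝ × ℝ} {f g f' g' : ℝ × ℝ → ℂ} (h : X.IsWeakDeriv e f g)
    (h' : X.IsWeakDeriv e f' g') (hf : LocallyIntegrableOn f X.inner)
    (hf' : LocallyIntegrableOn f' X.inner) (hg : LocallyIntegrableOn g X.inner)
    (hg' : LocallyIntegrableOn g' X.inner) : X.IsWeakDeriv e (f + f') (g + g') := by
  intro φ hφ
  have i1 : ∀ F, LocallyIntegrableOn F X.inner →
      Integrable (fun p => F p * fderiv ℝ φ p e) X.vol := fun F hF =>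
    hφ.integrable_mul (hφ.continuous_fderiv e) (tsupport_fderiv_apply_subset φ e) hF
  have i2 : ∀ F, LocallyIntegrableOn F X.inner → Integrable (fun p => F p * φ p) X.vol :=
    fun F hF => hφ.integrable_mul hφ.1.continuous subset_rfl hF
  have e1 : ∫ p, (f + f') p * fderiv ℝ φ p e ∂X.vol
      = (∫ p, f p * fderiv ℝ φ p e ∂X.vol) + ∫ p, f' p * fderiv ℝ φ p e ∂X.vol := by
    rw [← integral_add (i1 f hf) (i1 f' hf')]
    simp only [Pi.add_apply, add_mul]
  have e2 : ∫ p, (g + g') p * φ p ∂X.vol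
      = (∫ p, g p * φ p ∂X.vol) + ∫ p, g' p * φ p ∂X.vol := by
    rw [← integral_add (i2 g hg) (i2 g' hg')]
    simp only [Pi.add_apply, add_mul]
  rw [e1, e2, h φ hφ, h' φ hφ, neg_add]

theorem continuousOn_sqrt_deltaX (s : Set (ℝ × ℝ)) :
    ContinuousOn (fun p : ℝ × ℝ => (Real.sqrt (X.deltaX p.2) : ℂ)) s := by
  refine Continuous.continuousOn ?_
  unfold CarterParams.deltaX
  fun_prop

theorem continuousOn_inv_sqrt_deltaX (hX : X.BH1) :
    ContinuousOn (fun p : ℝ × ℝ => ((Real.sqrt (X.deltaX p.2) : ℂ))⁻¹) X.inner := by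
  refine (continuousOn_sqrt_deltaX _).inv₀ fun p hp => ?_
  exact_mod_cast (Real.sqrt_pos.2 (hX.deltaX_pos p.2 hp.2)).ne'

theorem locallyIntegrableOn_mul {f g : ℝ × ℝ → ℂ} (hf : LocallyIntegrableOn f X.inner)
    (hg : ContinuousOn g X.inner) : LocallyIntegrableOn (fun p => f p * g p) X.inner := by
  rw [locallyIntegrableOn_iff isOpen_inner.isLocallyClosed] at hf ⊢
  exact fun K hK hc => (hf K hK hc).mul_continuousOn (hg.mono hK) hc

/-- Adding weak derivatives requires integrability of every pairing with a test function. In the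
angular steps this includes components multiplied or divided by √Δ_x, which is continuous and
nonzero in the interior. -/
theorem IsJet.add (hX : X.BH1) {k : ℕ} {f g : ℝ × ℝ → ℂ} {d e : ℕ → ℕ → ℝ × ℝ → ℂ}
    (hd : X.IsJet k f d) (he : X.IsJet k g e) :
    X.IsJet k (f + g) (fun i j => d i j + e i j) := by
  refine ⟨hd.zero.add he.zero, fun i j h => (hd.locInt i j h).add (he.locInt i j h), ?_, ?_, ?_⟩
  · intro i j h
    exact (hd.radial i j h).add (he.radial i j h) (hd.locInt _ _ (by omega))
      (he.locInt _ _ (by omega)) (hd.locInt _ _ (by omega)) (he.locInt _ _ (by omega))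
  · intro i j h hj
    have c := continuousOn_inv_sqrt_deltaX hX
    have := (hd.odd i j h hj).add (he.odd i j h hj) (hd.locInt _ _ (by omega))
      (he.locInt _ _ (by omega)) (locallyIntegrableOn_mul (hd.locInt i (j + 1) (by omega)) c)
      (locallyIntegrableOn_mul (he.locInt i (j + 1) (by omega)) c)
    convert this using 1
    ext p
    simp [add_div]
  · intro i j h hj
    have c := continuousOn_sqrt_deltaX (X := X) X.inner
    have m := fun {f : ℝ × ℝ → ℂ} (hf : LocallyIntegrableOn f X.inner) => by
      have := locallyIntegrableOn_mul hf c
      simp only [mul_comm (f _)] at this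
      exact this
    have := (hd.even i j h hj).add (he.even i j h hj) (m (hd.locInt _ _ (by omega)))
      (m (he.locInt _ _ (by omega))) (hd.locInt _ _ (by omega)) (he.locInt _ _ (by omega))
    convert this using 1
    ext p
    simp [mul_add]

theorem jetMass_add_le {k : ℕ} {K : Set (ℝ × ℝ)} {f : ℝ × ℝ → ℂ}
    {d e : ℕ → ℕ → ℝ × ℝ → ℂ} (hd : X.IsJet k f d) :
    X.jetMass k K (fun i j => d i j + e i j) ≤ 2 * X.jetMass k K d + 2 * X.jetMass k K e := by
  unfold jetMass
  rw [← mul_add, ← lintegral_add_left', ← lintegral_const_mul' _ _ (by norm_num)]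
  · refine lintegral_mono fun p => ?_
    simp only [← Finset.sum_add_distrib, Finset.mul_sum]
    refine Finset.sum_le_sum fun i _ => Finset.sum_le_sum fun j _ => ?_
    refine le_trans ?_ (ennreal_add_sq_le _ _)
    gcongr
    exact enorm_add_le _ _
  · refine AEMeasurable.restrict ?_
    refine Finset.aemeasurable_fun_sum _ fun i hi => Finset.aemeasurable_fun_sum _ fun j hj => ?_
    refine AEMeasurable.pow_const ?_ _
    refine (hd.aestronglyMeasurable ?_).enorm
    simp only [Finset.mem_range] at hi hj
    omega

/-- A quasi-triangle inequality for squares: any two jets can be added, and (a + b)² ≤ 2(a² + b²)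
componentwise. The factor 2 is harmless in all later limits. -/
theorem hNorm_add_sq_le (hX : X.BH1) (k : ℕ) (K : Set (ℝ × ℝ)) (f g : ℝ × ℝ → ℂ) :
    X.hNorm k K (f + g) ^ 2 ≤ 2 * X.hNorm k K f ^ 2 + 2 * X.hNorm k K g ^ 2 := by
  rw [hNorm_sq k K f, hNorm_sq k K g, ENNReal.mul_iInf_of_ne (by norm_num) (by norm_num),
    ENNReal.mul_iInf_of_ne (by norm_num) (by norm_num)]
  refine ENNReal.le_iInf_add_iInf fun d e => ?_
  exact (hNorm_sq_le (d.2.add hX e.2)).trans (jetMass_add_le d.2)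

theorem IsJet.of_succ {k : ℕ} {f : ℝ × ℝ → ℂ} {d : ℕ → ℕ → ℝ × ℝ → ℂ}
    (h : X.IsJet (k + 1) f d) : X.IsJet k f d :=
  ⟨h.zero, fun i j hij => h.locInt i j (by omega), fun i j hij => h.radial i j (by omega),
    fun i j hij => h.odd i j (by omega), fun i j hij => h.even i j (by omega)⟩

theorem hNorm_le_succ (k : ℕ) (K : Set (ℝ × ℝ)) (f : ℝ × ℝ → ℂ) :
    X.hNorm k K f ≤ X.hNorm (k + 1) K f := by
  rw [← ENNReal.pow_le_pow_left_iff two_ne_zero]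
  refine le_hNorm_sq fun d hd => (hNorm_sq_le hd.of_succ).trans ?_
  refine lintegral_mono fun p => ?_
  refine (Finset.sum_le_sum fun i _ => Finset.sum_le_sum_of_subset ?_).trans
    (Finset.sum_le_sum_of_subset (Finset.range_subset_range.2 (by omega)))
  exact Finset.range_subset_range.2 (by omega)

theorem component_le_jetMass {k : ℕ} {K : Set (ℝ × ℝ)} {d : ℕ → ℕ → ℝ × ℝ → ℂ} {i j : ℕ}
    (hij : i + j ≤ k) : ∫⁻ p in K, ‖d i j p‖ₑ ^ 2 ∂X.vol ≤ X.jetMass k K d := by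
  refine lintegral_mono fun p => ?_
  have h1 : ‖d i j p‖ₑ ^ 2 ≤ ∑ j ∈ Finset.range (k + 1 - i), ‖d i j p‖ₑ ^ 2 :=
    Finset.single_le_sum (f := fun j => ‖d i j p‖ₑ ^ 2) (fun _ _ => zero_le)
      (Finset.mem_range.2 (by omega))
  exact h1.trans (Finset.single_le_sum
    (f := fun i => ∑ j ∈ Finset.range (k + 1 - i), ‖d i j p‖ₑ ^ 2) (fun _ _ => zero_le)
      (Finset.mem_range.2 (by omega)))

theorem lintegral_sq_le_hNorm (k : ℕ) (K : Set (ℝ × ℝ)) (f : ℝ × ℝ → ℂ) :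
    ∫⁻ p in K, ‖f p‖ₑ ^ 2 ∂X.vol ≤ X.hNorm k K f ^ 2 := by
  refine le_hNorm_sq fun d hd => ?_
  refine le_trans (le_of_eq ?_) (component_le_jetMass (i := 0) (j := 0) (Nat.zero_le k))
  refine lintegral_congr_ae (ae_restrict_of_ae ?_)
  filter_upwards [hd.zero] with p hp
  rw [hp]

theorem IsTest.memLp {φ : ℝ × ℝ → ℂ} (h : X.IsTest φ) : MemLp φ 2 X.vol :=
  (h.1.continuous.memLp_of_hasCompactSupport h.2.1).restrict _

theorem enorm_integral_mul_le {μ : Measure (ℝ × ℝ)} {f g : ℝ × ℝ → ℂ}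
    (hf : AEStronglyMeasurable f μ) (hg : AEStronglyMeasurable g μ) :
    ‖∫ p, f p * g p ∂μ‖ₑ ≤ (∫⁻ p, ‖f p‖ₑ ^ 2 ∂μ) ^ (1 / 2 : ℝ)
      * (∫⁻ p, ‖g p‖ₑ ^ 2 ∂μ) ^ (1 / 2 : ℝ) := by
  refine (enorm_integral_le_lintegral_enorm _).trans ?_
  simp only [enorm_mul]
  have := ENNReal.lintegral_mul_le_Lp_mul_Lq μ Real.HolderConjugate.two_two hf.enorm hg.enorm
  simpa using this

theorem sq_rpow_half (a : ℝ≥0∞) : (a ^ 2) ^ (1 / 2 : ℝ) = a := by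
  rw [← ENNReal.rpow_natCast, ← ENNReal.rpow_mul]
  norm_num

/-- For s = 0 the norm on the left is dual: Cauchy–Schwarz applies, since the test functions are
bounded in H¹ and hence in L². -/
theorem hNormPred_le (s : ℕ) {f : ℝ × ℝ → ℂ} (hf : AEStronglyMeasurable f X.vol) :
    X.hNormPred s f ≤ X.hNorm s univ f := by
  cases s with
  | succ k => exact hNorm_le_succ k univ f
  | zero =>
    refine iSup₂_le fun φ hφ => iSup_le fun hφ1 => ?_
    refine (enorm_integral_mul_le hf hφ.1.continuous.aestronglyMeasurable).trans ?_
    have h1 := lintegral_sq_le_hNorm (X := X) 0 univ f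
    have h2 := lintegral_sq_le_hNorm (X := X) 1 univ φ
    rw [Measure.restrict_univ] at h1 h2
    calc _ ≤ (X.hNorm 0 univ f ^ 2) ^ (1 / 2 : ℝ) * (X.hNorm 1 univ φ ^ 2) ^ (1 / 2 : ℝ) := by
          gcongr
      _ ≤ X.hNorm 0 univ f * 1 := by
          rw [sq_rpow_half, sq_rpow_half]
          gcongr
      _ = _ := mul_one _

theorem hNormPred_congr {s : ℕ} {f g : ℝ × ℝ → ℂ} (hfg : f =ᵐ[X.vol] g) :
    X.hNormPred s f = X.hNormPred s g := by
  cases s with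
  | succ k => exact hNorm_congr hfg
  | zero =>
    unfold hNormPred
    refine iSup_congr fun φ => ?_
    have : ∫ p, f p * φ p ∂X.vol = ∫ p, g p * φ p ∂X.vol := by
      refine integral_congr_ae ?_
      filter_upwards [hfg] with p hp
      rw [hp]
    rw [this]

/-- In the dual case s = 0 the pairing with a test function is additive because both factors are
square integrable. -/
theorem hNormPred_add_sq_le (hX : X.BH1) (s : ℕ) {f g : ℝ × ℝ → ℂ} (hf : MemLp f 2 X.vol)
    (hg : MemLp g 2 X.vol) :
    X.hNormPred s (f + g) ^ 2 ≤ 2 * X.hNormPred s f ^ 2 + 2 * X.hNormPred s g ^ 2 := by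
  cases s with
  | succ k => exact hNorm_add_sq_le hX k univ f g
  | zero =>
    rw [← mul_add]
    refine le_trans ?_ (ennreal_add_sq_le _ _)
    gcongr
    refine iSup₂_le fun φ hφ => iSup_le fun hφ1 => ?_
    have e : ∫ p, (f + g) p * φ p ∂X.vol = (∫ p, f p * φ p ∂X.vol) + ∫ p, g p * φ p ∂X.vol := by
      have i1 : Integrable (fun p => f p * φ p) X.vol := hf.integrable_mul hφ.memLp
      have i2 : Integrable (fun p => g p * φ p) X.vol := hg.integrable_mul hφ.memLp
      rw [← integral_add i1 i2]
      simp only [Pi.add_apply, add_mul]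
    rw [e]
    refine (enorm_add_le _ _).trans ?_
    have key : ∀ f : ℝ × ℝ → ℂ, ‖∫ p, f p * φ p ∂X.vol‖ₑ ≤ X.hNormPred 0 f := fun f =>
      le_iSup_of_le φ (le_iSup_of_le hφ (le_iSup_of_le hφ1 le_rfl))
    exact add_le_add (key f) (key g)

end Exterior

namespace Realization

variable {X : Exterior} {W : Realization.{u} X} {s : ℕ}

theorem data_add (U V : W.E s) :
    (W.data s (U + V)).1 =ᵐ[X.vol] (W.data s U).1 + (W.data s V).1 ∧
      (W.data s (U + V)).2 =ᵐ[X.vol] (W.data s U).2 + (W.data s V).2 := by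
  rw [map_add]
  exact ⟨AEEqFun.coeFn_add _ _, AEEqFun.coeFn_add _ _⟩

theorem data_smul (z : ℂ) (U : W.E s) :
    (W.data s (z • U)).1 =ᵐ[X.vol] z • (W.data s U).1 ∧
      (W.data s (z • U)).2 =ᵐ[X.vol] z • (W.data s U).2 := by
  rw [map_smul]
  exact ⟨AEEqFun.coeFn_smul _ _, AEEqFun.coeFn_smul _ _⟩

theorem HasData.add {U V : W.E s} {f g f' g' : ℝ × ℝ → ℂ} (h : W.HasData s U f g)
    (h' : W.HasData s V f' g') : W.HasData s (U + V) (f + f') (g + g') :=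
  ⟨(data_add U V).1.trans (h.1.add h'.1), (data_add U V).2.trans (h.2.add h'.2)⟩

theorem HasData.smul {U : W.E s} {f g : ℝ × ℝ → ℂ} (h : W.HasData s U f g) (z : ℂ) :
    W.HasData s (z • U) (z • f) (z • g) :=
  ⟨(data_smul z U).1.trans (h.1.const_smul z), (data_smul z U).2.trans (h.2.const_smul z)⟩

theorem HasData.sub {U V : W.E s} {f g f' g' : ℝ × ℝ → ℂ} (h : W.HasData s U f g)
    (h' : W.HasData s V f' g') : W.HasData s (U - V) (f - f') (g - g') := by
  have := h.add (h'.smul (-1))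
  simpa [sub_eq_add_neg] using this

theorem hasData_self (U : W.E s) : W.HasData s U (W.data s U).1 (W.data s U).2 :=
  ⟨ae_eq_rfl, ae_eq_rfl⟩

theorem HasData.congr {U : W.E s} {f g f' g' : ℝ × ℝ → ℂ} (h : W.HasData s U f g)
    (hf : f =ᵐ[X.vol] f') (hg : g =ᵐ[X.vol] g') : W.HasData s U f' g' :=
  ⟨h.1.trans hf, h.2.trans hg⟩

theorem aestronglyMeasurable_cut {χ : ℝ × ℝ → ℝ} (hχ : Exterior.IsCutoff χ) (f : X.Fn) :
    AEStronglyMeasurable (fun p => (χ p : ℂ) * f p) X.vol := by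
  refine AEStronglyMeasurable.mul ?_ f.aestronglyMeasurable
  exact (Complex.continuous_ofReal.comp hχ.1.continuous).aestronglyMeasurable

theorem BH3.cutNorm_le (h : W.BH3 s) {χ : ℝ × ℝ → ℝ} (hχ : Exterior.IsCutoff χ) :
    ∃ C : ℝ≥0, ∀ U : W.E s, W.cutNorm s χ U ≤ C * ‖U‖ₑ := by
  obtain ⟨C, hC⟩ := h.localize χ hχ
  refine ⟨C, fun U => le_trans ?_ (hC U)⟩
  exact add_le_add (Exterior.hNorm_le_succ s univ _)
    (Exterior.hNormPred_le s (aestronglyMeasurable_cut hχ _))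

theorem BH3.memLp_cut (h : W.BH3 s) {χ : ℝ × ℝ → ℝ} (hχ : Exterior.IsCutoff χ) (U : W.E s) :
    MemLp (fun p => (χ p : ℂ) * (W.data s U).2 p) 2 X.vol := by
  refine ⟨aestronglyMeasurable_cut hχ _, ?_⟩
  obtain ⟨C, hC⟩ := h.localize χ hχ
  have h1 : X.hNorm s univ (fun p => (χ p : ℂ) * (W.data s U).2 p) < ⊤ := by
    refine (le_add_self.trans (hC U)).trans_lt ?_
    exact ENNReal.mul_lt_top ENNReal.coe_lt_top enorm_lt_top
  have h2 := Exterior.lintegral_sq_le_hNorm (X := X) s univ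
    (fun p => (χ p : ℂ) * (W.data s U).2 p)
  rw [Measure.restrict_univ] at h2
  rw [eLpNorm_lt_top_iff_lintegral_rpow_enorm_lt_top (by norm_num) (by norm_num)]
  simp only [ENNReal.toReal_ofNat, ENNReal.rpow_ofNat]
  exact h2.trans_lt (ENNReal.pow_lt_top h1)

theorem BH3.cutNorm_add_sq_le (h : W.BH3 s) (hX : X.BH1) {χ : ℝ × ℝ → ℝ}
    (hχ : Exterior.IsCutoff χ) (U V : W.E s) :
    W.cutNorm s χ (U + V) ^ 2 ≤ 4 * (W.cutNorm s χ U ^ 2 + W.cutNorm s χ V ^ 2) := by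
  obtain ⟨e1, e2⟩ := data_add U V
  have e1' : (fun p => (χ p : ℂ) * (W.data s (U + V)).1 p) =ᵐ[X.vol]
      (fun p => (χ p : ℂ) * (W.data s U).1 p) + fun p => (χ p : ℂ) * (W.data s V).1 p := by
    filter_upwards [e1] with p hp
    rw [hp]
    exact mul_add _ _ _
  have e2' : (fun p => (χ p : ℂ) * (W.data s (U + V)).2 p) =ᵐ[X.vol]
      (fun p => (χ p : ℂ) * (W.data s U).2 p) + fun p => (χ p : ℂ) * (W.data s V).2 p := by
    filter_upwards [e2] with p hp
    rw [hp]
    exact mul_add _ _ _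
  unfold cutNorm
  rw [Exterior.hNorm_congr e1', Exterior.hNormPred_congr e2']
  have b1 := Exterior.hNorm_add_sq_le hX s univ (fun p => (χ p : ℂ) * (W.data s U).1 p)
    (fun p => (χ p : ℂ) * (W.data s V).1 p)
  have b2 := Exterior.hNormPred_add_sq_le hX s (h.memLp_cut hχ U) (h.memLp_cut hχ V)
  have b3 : ∀ a b : ℝ≥0∞, a ^ 2 + b ^ 2 ≤ (a + b) ^ 2 := fun a b => by
    rw [add_sq]
    gcongr
    exact le_self_add
  refine (ennreal_add_sq_le _ _).trans ?_
  refine (mul_le_mul_right (add_le_add b1 b2) 2).trans ?_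
  refine le_trans (le_of_eq ?_) (mul_le_mul_right (add_le_add (b3 _ _) (b3 _ _)) 4)
  ring

end Realization

namespace Realization

variable {X : Exterior} {W : Realization.{u} X} {s : ℕ}

/-! ### The local-energy bound for the dispersive part -/

theorem leNorm_sq (J : Set ℝ) (U : ℝ → W.E s) :
    W.leNorm s J U ^ 2 = ⨆ i, ∫⁻ t in J, W.le s i (U t) ^ 2 := by
  unfold leNorm
  rw [← ENNReal.rpow_natCast, ← ENNReal.rpow_mul]
  norm_num

theorem Package.regular_estimate (hX : X.BH1) (h3 : W.BH3 s) (h4 : W.BH4 s) : ∃ C : ℝ≥0,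
    ∀ T > 0, ∀ V : W.E s, W.Regular s V →
      (⨆ t ∈ Icc (0 : ℝ) T, ‖W.S s t V‖ₑ ^ 2) + W.leNorm s (Icc 0 T) (fun t => W.S s t V) ^ 2
        ≤ C * (‖V‖ₑ ^ 2 + ∫⁻ t in Icc 0 T, W.cutNorm s (W.chi s) (W.S s t V) ^ 2) := by
  obtain ⟨C, hC⟩ := h4.estimate
  refine ⟨C, fun T hT V hV => ?_⟩
  obtain ⟨u, hu, he, htr⟩ := hV
  have := hC T hT u 0 (fun t => W.S s t V)
    (hu.mono hX.radial_nonempty Icc_subset_Ici_self (uniqueDiffOn_Icc hT)) contDiffOn_const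
    (fun τ hτ p hp => he τ hτ.1 p hp)
    (htr.mono Icc_subset_Ici_self (uniqueDiffOn_Icc hT) hu.1)
  rw [h4.localEnergy.dual_zero T hT, h3.isC0.apply_zero] at this
  simpa using this

/-- The evolution estimate with compact error extends from regular data to all data. -/
theorem Package.estimate (hX : X.BH1) (h3 : W.BH3 s) (h4 : W.BH4 s) : ∃ C : ℝ≥0,
    ∀ T > 0, ∀ V : W.E s,
      (∀ t ∈ Icc (0 : ℝ) T, ‖W.S s t V‖ₑ ^ 2
        ≤ C * (‖V‖ₑ ^ 2 + 4 * ∫⁻ t in Icc 0 T, W.cutNorm s (W.chi s) (W.S s t V) ^ 2)) ∧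
      ∀ i, ∫⁻ t in Icc 0 T, W.le s i (W.S s t V) ^ 2
        ≤ C * (‖V‖ₑ ^ 2 + 4 * ∫⁻ t in Icc 0 T, W.cutNorm s (W.chi s) (W.S s t V) ^ 2) := by
  obtain ⟨C, hC⟩ := Package.regular_estimate hX h3 h4
  refine ⟨C, fun T hT V => ?_⟩
  obtain ⟨C', hC'⟩ := h3.cutNorm_le h4.cutoff
  obtain ⟨M, hM0, hM⟩ := h3.isC0.bounded T
  choose Vn hreg hVn using fun n : ℕ => h3.dense_regular V (Nat.one_div_pos_of_nat (α := ℝ) (n := n))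
  have hlim : Tendsto Vn atTop (𝓝 V) := by
    rw [tendsto_iff_norm_sub_tendsto_zero]
    refine squeeze_zero (fun _ => norm_nonneg _) (fun n => ?_)
      (tendsto_one_div_add_atTop_nhds_zero_nat (𝕜 := ℝ))
    rw [norm_sub_rev]
    exact (hVn n).le
  set I := ∫⁻ t in Icc 0 T, W.cutNorm s (W.chi s) (W.S s t V) ^ 2 with hI
  set b : ℕ → ℝ≥0∞ := fun n => C * (‖Vn n‖ₑ ^ 2 +
    4 * (I + (C' * (ENNReal.ofReal M * ‖Vn n - V‖ₑ)) ^ 2 * ENNReal.ofReal T)) with hb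
  have hcut : ∀ n, ∫⁻ t in Icc 0 T, W.cutNorm s (W.chi s) (W.S s t (Vn n)) ^ 2 ≤
      4 * (I + (C' * (ENNReal.ofReal M * ‖Vn n - V‖ₑ)) ^ 2 * ENNReal.ofReal T) := by
    intro n
    have e : (C' * (ENNReal.ofReal M * ‖Vn n - V‖ₑ)) ^ 2 * ENNReal.ofReal T =
        ∫⁻ _ in Icc 0 T, (C' * (ENNReal.ofReal M * ‖Vn n - V‖ₑ)) ^ 2 := by
      rw [setLIntegral_const, Real.volume_Icc, sub_zero]
    -- The error is first replaced by a constant in t: the integral then splits by measurability of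
    -- the constant alone, and nothing has to be known about t ↦ `cutNorm`.
    rw [e, hI, ← lintegral_add_right _ measurable_const, ← lintegral_const_mul' _ _ (by norm_num)]
    refine setLIntegral_mono' measurableSet_Icc fun t ht => ?_
    have e2 : W.S s t (Vn n) = W.S s t V + W.S s t (Vn n - V) := by
      rw [← map_add, add_sub_cancel]
    rw [e2]
    refine (h3.cutNorm_add_sq_le hX h4.cutoff _ _).trans ?_
    gcongr
    refine (hC' _).trans ?_
    gcongr
    refine (ContinuousLinearMap.le_opENorm _ _).trans ?_
    gcongr
    rw [← ofReal_norm]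
    exact ENNReal.ofReal_le_ofReal (hM t ht)
  have hbound : ∀ n, (⨆ t ∈ Icc (0 : ℝ) T, ‖W.S s t (Vn n)‖ₑ ^ 2) +
      W.leNorm s (Icc 0 T) (fun t => W.S s t (Vn n)) ^ 2 ≤ b n := fun n =>
    (hC T hT _ (hreg n)).trans (by dsimp only [b]; gcongr; exact hcut n)
  have hblim : Tendsto b atTop (𝓝 (C * (‖V‖ₑ ^ 2 + 4 * I))) := by
    have h1 : Tendsto (fun n => ‖Vn n‖ₑ ^ 2) atTop (𝓝 (‖V‖ₑ ^ 2)) :=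
      ((ENNReal.continuous_pow 2).tendsto _).comp (continuous_enorm.tendsto V |>.comp hlim)
    have h2 : Tendsto (fun n => ‖Vn n - V‖ₑ) atTop (𝓝 0) := by
      have : Tendsto (fun n => Vn n - V) atTop (𝓝 0) := by
        simpa using hlim.sub_const V
      simpa [Function.comp_def] using (continuous_enorm.tendsto _).comp this
    have h3 : Tendsto (fun n => C' * (ENNReal.ofReal M * ‖Vn n - V‖ₑ)) atTop (𝓝 0) := by
      have := ENNReal.Tendsto.const_mul (a := (C' : ℝ≥0∞))
        (ENNReal.Tendsto.const_mul (a := ENNReal.ofReal M) h2 (Or.inr ENNReal.ofReal_ne_top))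
        (Or.inr ENNReal.coe_ne_top)
      simpa using this
    have h4 : Tendsto (fun n => (C' * (ENNReal.ofReal M * ‖Vn n - V‖ₑ)) ^ 2 * ENNReal.ofReal T)
        atTop (𝓝 0) := by
      have := ENNReal.Tendsto.mul_const (b := ENNReal.ofReal T)
        (((ENNReal.continuous_pow 2).tendsto _).comp h3) (Or.inr ENNReal.ofReal_ne_top)
      simpa using this
    have h5 := ENNReal.Tendsto.const_mul (a := (4 : ℝ≥0∞))
      ((tendsto_const_nhds (x := I)).add h4) (Or.inr (by norm_num))
    have := ENNReal.Tendsto.const_mul (a := (C : ℝ≥0∞)) (h1.add h5) (Or.inr ENNReal.coe_ne_top)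
    simpa using this
  refine ⟨fun t ht => ?_, fun i => ?_⟩
  · have h1 : Tendsto (fun n => ‖W.S s t (Vn n)‖ₑ ^ 2) atTop (𝓝 (‖W.S s t V‖ₑ ^ 2)) :=
      ((ENNReal.continuous_pow 2).tendsto _).comp
        ((continuous_enorm.tendsto _).comp (((W.S s t).continuous.tendsto V).comp hlim))
    refine le_of_tendsto_of_tendsto' h1 hblim fun n => ?_
    refine le_trans ?_ (le_self_add.trans (hbound n))
    exact le_iSup₂_of_le (f := fun t (_ : t ∈ Icc (0 : ℝ) T) => ‖W.S s t (Vn n)‖ₑ ^ 2) t ht le_rfl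
  · let F : W.E s → ℝ≥0∞ := fun U => W.le s i U ^ 2
    have hF : LowerSemicontinuous F :=
      (ENNReal.continuous_pow 2).comp_lowerSemicontinuous (h4.localEnergy.lsc i)
        (fun a b hab => by dsimp only; gcongr)
    -- With the Borel σ-algebra a lower semicontinuous seminorm is measurable, hence so is its
    -- composition with a continuous orbit; Fatou's lemma needs this.
    let mE : MeasurableSpace (W.E s) := borel _
    have : BorelSpace (W.E s) := ⟨rfl⟩
    have hmeas : ∀ n, AEMeasurable (fun t => F (W.S s t (Vn n))) (volume.restrict (Icc 0 T)) :=
      fun n => hF.measurable.comp_aemeasurable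
        (((h3.S_cont (Vn n)).mono Icc_subset_Ici_self).aemeasurable measurableSet_Icc)
    calc ∫⁻ t in Icc 0 T, F (W.S s t V)
        ≤ ∫⁻ t in Icc 0 T, liminf (fun n => F (W.S s t (Vn n))) atTop := by
          refine lintegral_mono fun t => ?_
          refine (lowerSemicontinuousAt_iff_le_liminf.1 (hF _)).trans ?_
          have h1 : Tendsto (fun n => W.S s t (Vn n)) atTop (𝓝 (W.S s t V)) :=
            ((W.S s t).continuous.tendsto V).comp hlim
          exact liminf_le_liminf_of_le h1
      _ ≤ liminf (fun n => ∫⁻ t in Icc 0 T, F (W.S s t (Vn n))) atTop :=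
          lintegral_liminf_le' hmeas
      _ ≤ liminf b atTop := by
          refine liminf_le_liminf (Eventually.of_forall fun n => ?_)
          refine le_trans ?_ (le_add_self.trans (hbound n))
          rw [leNorm_sq]
          exact le_iSup (fun i => ∫⁻ t in Icc 0 T, W.le s i (W.S s t (Vn n)) ^ 2) i
      _ = _ := hblim.liminf_eq

/-- On the range of I - Π, BH7 bounds the compact error over [0, ∞) by the energy of the datum, so
the right side of `Package.estimate` is bounded uniformly in T. -/
theorem Package.dispersive_bound (hX : X.BH1) (h3 : W.BH3 s) (h4 : W.BH4 s) (h7 : W.BH7 s) :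
    ∃ C : ℝ≥0, ∀ U₀ : W.E s,
      (⨆ t ∈ Ici (0 : ℝ), ‖W.S s t (U₀ - W.proj s U₀)‖ₑ)
          + W.leNorm s (Ici 0) (fun t => W.S s t (U₀ - W.proj s U₀))
        ≤ C * ‖U₀ - W.proj s U₀‖ₑ := by
  obtain ⟨C, hC⟩ := Package.estimate hX h3 h4
  obtain ⟨C', hC'⟩ := h7.smoothing
  -- The summand 1 forces D ≤ D², so D also dominates the square root of the constant for the
  -- squared norms.
  let D : ℝ≥0 := C * (1 + 4 * C' ^ 2) + 1
  refine ⟨2 * D, fun U₀ => ?_⟩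
  set V := U₀ - W.proj s U₀ with hV
  have hsm : ∫⁻ t in Ici 0, W.cutNorm s (W.chi s) (W.S s t V) ^ 2 ≤ (C' * ‖V‖ₑ) ^ 2 := by
    have := hC' U₀
    rw [← hV] at this
    have h2 := pow_le_pow_left₀ zero_le this 2
    rw [← ENNReal.rpow_natCast, ← ENNReal.rpow_mul] at h2
    norm_num at h2
    simpa using h2
  have hrhs : ∀ T, (C : ℝ≥0∞) * (‖V‖ₑ ^ 2 +
      4 * ∫⁻ t in Icc 0 T, W.cutNorm s (W.chi s) (W.S s t V) ^ 2) ≤ (D * ‖V‖ₑ) ^ 2 := by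
    intro T
    have h1 : ∫⁻ t in Icc 0 T, W.cutNorm s (W.chi s) (W.S s t V) ^ 2 ≤ (C' * ‖V‖ₑ) ^ 2 :=
      (lintegral_mono_set Icc_subset_Ici_self).trans hsm
    have h2 : (C * (1 + 4 * C' ^ 2) : ℝ≥0) ≤ D ^ 2 := by
      have h3 : (1 : ℝ≥0) ≤ D := le_add_self
      calc (C * (1 + 4 * C' ^ 2) : ℝ≥0) ≤ D := le_self_add
        _ ≤ D ^ 2 := le_self_pow₀ h3 two_ne_zero
    calc _ ≤ (C : ℝ≥0∞) * (‖V‖ₑ ^ 2 + 4 * (C' * ‖V‖ₑ) ^ 2) := by gcongr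
      _ = ((C * (1 + 4 * C' ^ 2) : ℝ≥0) : ℝ≥0∞) * ‖V‖ₑ ^ 2 := by push_cast; ring
      _ ≤ ((D ^ 2 : ℝ≥0) : ℝ≥0∞) * ‖V‖ₑ ^ 2 := by gcongr
      _ = _ := by push_cast; ring
  have hA : (⨆ t ∈ Ici (0 : ℝ), ‖W.S s t V‖ₑ) ≤ D * ‖V‖ₑ := by
    refine iSup₂_le fun t ht => ?_
    rw [← ENNReal.pow_le_pow_left_iff two_ne_zero]
    have ht : (0 : ℝ) ≤ t := ht
    exact ((hC (t + 1) (by positivity) V).1 t ⟨ht, by linarith⟩).trans (hrhs _)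
  have hB : W.leNorm s (Ici 0) (fun t => W.S s t V) ≤ D * ‖V‖ₑ := by
    rw [← ENNReal.pow_le_pow_left_iff two_ne_zero, leNorm_sq]
    refine iSup_le fun i => ?_
    have hu : Ici (0 : ℝ) = ⋃ n : ℕ, Icc 0 ((n : ℝ) + 1) := by
      ext t
      simp only [mem_Ici, mem_iUnion, mem_Icc]
      refine ⟨fun h => ?_, fun ⟨n, h, _⟩ => h⟩
      obtain ⟨n, hn⟩ := exists_nat_ge t
      exact ⟨n, h, by linarith⟩
    -- The integral over [0, ∞) is the supremum of those over the intervals [0, n + 1], for each of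
    -- which the same bound holds.
    rw [hu, setLIntegral_iUnion_of_directed]
    · exact iSup_le fun n => ((hC _ (by positivity) V).2 i).trans (hrhs _)
    · refine directed_of_isDirected_le fun m n hmn => Icc_subset_Icc_right ?_
      have : (m : ℝ) ≤ n := by exact_mod_cast hmn
      linarith
  calc _ ≤ (D : ℝ≥0∞) * ‖V‖ₑ + D * ‖V‖ₑ := add_le_add hA hB
    _ = _ := by push_cast; ring

end Realization

/-! ### Local decay of the dispersive part -/

theorem exists_cutoff (R : ℝ) : ∃ χ, Exterior.IsCutoff χ ∧ ∀ p : ℝ × ℝ, ‖p‖ ≤ R → χ p = 1 := by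
  let b : ContDiffBump (0 : ℝ × ℝ) := ⟨|R| + 1, |R| + 2, by positivity, by linarith⟩
  refine ⟨b, ⟨b.contDiff, b.hasCompactSupport⟩, fun p hp => b.one_of_mem_closedBall ?_⟩
  rw [mem_closedBall_zero_iff]
  exact hp.trans ((le_abs_self R).trans (by change |R| ≤ |R| + 1; linarith))

theorem euclidean_enorm_sq {n : ℕ} (x : EuclideanSpace ℂ (Fin n)) :
    ‖x‖ₑ ^ 2 = ∑ i, ‖x i‖ₑ ^ 2 := by
  have h := EuclideanSpace.norm_sq_eq x
  have h2 : ∀ (F : Type) [NormedAddCommGroup F] (y : F), ‖y‖ₑ ^ 2 = ENNReal.ofReal (‖y‖ ^ 2) := by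
    intro F _ y
    rw [ENNReal.ofReal_pow (norm_nonneg _), ofReal_norm]
  rw [h2, h, ENNReal.ofReal_sum_of_nonneg fun i _ => by positivity]
  exact Finset.sum_congr rfl fun i _ => (h2 _ _).symm

/-- Riemann–Lebesgue after rescaling the frequency by 2π. Without integrability the integral is zero
by convention, so no assumption on f is made. -/
theorem tendsto_integral_exp_mul_atTop {F : Type*} [NormedAddCommGroup F] [NormedSpace ℂ F]
    (f : ℝ → F) :
    Tendsto (fun t : ℝ => ∫ σ : ℝ, Complex.exp (-(Complex.I * t * σ)) • f σ) atTop (𝓝 0) := by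
  have h1 := Real.tendsto_integral_exp_smul_cocompact f
  have h2 : Tendsto (fun t : ℝ => t * (2 * Real.pi)⁻¹) atTop (cocompact ℝ) :=
    (tendsto_id.atTop_mul_const (by positivity)).mono_right atTop_le_cocompact
  refine (h1.comp h2).congr fun t => ?_
  simp only [Function.comp]
  refine integral_congr_ae (Eventually.of_forall fun σ => ?_)
  simp only [Circle.smul_def, Real.fourierChar_apply]
  congr 2
  have : (Real.pi : ℂ) ≠ 0 := by exact_mod_cast Real.pi_ne_zero
  push_cast
  field_simp

namespace Realization

variable {X : Exterior} {W : Realization.{u} X} {s : ℕ}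

theorem BH3.data_locallyIntegrableOn (h : W.BH3 s) (U : W.E s) :
    LocallyIntegrableOn (W.data s U).2 X.inner := by
  rw [locallyIntegrableOn_iff Exterior.isOpen_inner.isLocallyClosed]
  intro K hK hc
  obtain ⟨R, hR⟩ := hc.isBounded.exists_norm_le
  obtain ⟨χ, hχ, h1⟩ := exists_cutoff R
  have h2 := (h.memLp_cut hχ U).restrict K
  have e : X.vol.restrict K = volume.restrict K := by
    unfold Exterior.vol
    rw [Measure.restrict_restrict_of_subset hK]
  rw [e] at h2
  have : IsFiniteMeasure (volume.restrict K : Measure (ℝ × ℝ)) :=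
    ⟨by rw [Measure.restrict_apply_univ]; exact hc.measure_lt_top⟩
  refine IntegrableOn.congr_fun_ae (h2.integrable (by norm_num)) ?_
  filter_upwards [ae_restrict_mem hc.measurableSet] with p hp
  rw [h1 p (hR p hp)]
  simp

/-- The derivatives listed in J form a competitor in the infimum that defines the H¹ norm; the
second component is its own jet of order zero. -/
theorem BH3.hNorm_le_of_hasLocalJet (h : W.BH3 s) {K : Set (ℝ × ℝ)} {U : W.E s}
    {J : X.JetSpace K} (hJ : W.HasLocalJet s K U J) :
    X.hNorm 1 K (W.data s U).1 + X.hNorm 0 K (W.data s U).2 ≤ 2 * ‖J‖ₑ := by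
  obtain ⟨d, hd, hJd⟩ := hJ
  have hJsq : ‖J‖ₑ ^ 2 = ∫⁻ p in K, (‖d 0 0 p‖ₑ ^ 2 + ‖d 1 0 p‖ₑ ^ 2 + ‖d 0 1 p‖ₑ ^ 2
      + ‖(W.data s U).2 p‖ₑ ^ 2) ∂X.vol := by
    rw [Lp.enorm_def, eLpNorm_eq_lintegral_rpow_enorm_toReal (by norm_num) (by norm_num),
      ← ENNReal.rpow_natCast, ← ENNReal.rpow_mul]
    norm_num
    refine lintegral_congr_ae ?_
    filter_upwards [hJd] with p hp
    rw [euclidean_enorm_sq, hp, Fin.sum_univ_four]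
    rfl
  have hA : X.hNorm 1 K (W.data s U).1 ≤ ‖J‖ₑ := by
    rw [← ENNReal.pow_le_pow_left_iff two_ne_zero, hJsq]
    refine (Exterior.hNorm_sq_le hd).trans ?_
    refine lintegral_mono fun p => ?_
    simp only [Finset.sum_range_succ, Finset.range_zero, Finset.sum_empty, zero_add,
      Nat.sub_zero, Nat.add_sub_cancel]
    refine le_trans (le_of_eq ?_) le_self_add
    ring
  have hB : X.hNorm 0 K (W.data s U).2 ≤ ‖J‖ₑ := by
    rw [← ENNReal.pow_le_pow_left_iff two_ne_zero, hJsq]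
    have hj : X.IsJet 0 (W.data s U).2 (fun _ _ => (W.data s U).2) :=
      ⟨ae_eq_rfl, fun _ _ _ => h.data_locallyIntegrableOn U, fun _ _ hij => by omega,
        fun _ _ hij => by omega, fun _ _ hij => by omega⟩
    refine (Exterior.hNorm_sq_le hj).trans ?_
    refine lintegral_mono fun p => ?_
    simp
  rw [two_mul]
  exact add_le_add hA hB

theorem BH7.local_decay (h3 : W.BH3 s) (h7 : W.BH7 s) (U₀ : W.E s) {K : Set (ℝ × ℝ)}
    (hK : IsCompact K) (hKs : K ⊆ X.slice) (hKi : Disjoint K X.imposed) :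
    Tendsto (fun t : ℝ => X.hNorm 1 K (W.data s (W.S s t (U₀ - W.proj s U₀))).1
      + X.hNorm 0 K (W.data s (W.S s t (U₀ - W.proj s U₀))).2) atTop (𝓝 0) := by
  obtain ⟨B, C, -, hB⟩ := h7.density K hK hKs hKi
  obtain ⟨-, -, hjet⟩ := hB U₀
  have h1 := tendsto_integral_exp_mul_atTop (fun σ => B σ (U₀ - W.proj s U₀))
  have h2 := ENNReal.Tendsto.const_mul (a := 2) ((continuous_enorm.tendsto _).comp h1)
    (Or.inr (by norm_num))
  rw [enorm_zero, mul_zero] at h2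
  refine tendsto_of_tendsto_of_tendsto_of_le_of_le' tendsto_const_nhds h2
    (Eventually.of_forall fun _ => zero_le) ?_
  filter_upwards [eventually_ge_atTop 0] with t ht
  exact h3.hNorm_le_of_hasLocalJet (hjet t ht)

end Realization

/-! ### The wave operator in the chart `(τ, r, x)` -/

namespace CarterParams

variable (c : CarterParams)

theorem metric_eq (p : Fin 4 → ℝ) : c.metric p =
    !![(-c.deltaR (p 2) + c.deltaX (p 3) * c.a ^ 2) / c.rhoSq (p 2) (p 3),
        (c.deltaR (p 2) * (c.a * (1 - p 3 ^ 2)) - c.deltaX (p 3) * c.a * (p 2 ^ 2 + c.a ^ 2))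
          / c.rhoSq (p 2) (p 3), 0, 0;
      (c.deltaR (p 2) * (c.a * (1 - p 3 ^ 2)) - c.deltaX (p 3) * c.a * (p 2 ^ 2 + c.a ^ 2))
          / c.rhoSq (p 2) (p 3),
        (-c.deltaR (p 2) * (c.a * (1 - p 3 ^ 2)) ^ 2 + c.deltaX (p 3) * (p 2 ^ 2 + c.a ^ 2) ^ 2)
          / c.rhoSq (p 2) (p 3), 0, 0;
      0, 0, c.rhoSq (p 2) (p 3) / c.deltaR (p 2), 0;
      0, 0, 0, c.rhoSq (p 2) (p 3) / c.deltaX (p 3)] := by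
  ext i j
  fin_cases i <;> fin_cases j <;>
    simp [metric, formT, formPhi] <;> ring

theorem det_blocks (a00 a01 a11 b d : ℝ) :
    (!![a00, a01, 0, 0; a01, a11, 0, 0; 0, 0, b, 0; 0, 0, 0, d] :
      Matrix (Fin 4) (Fin 4) ℝ).det = (a00 * a11 - a01 ^ 2) * b * d := by
  simp [Matrix.det_succ_row_zero, Fin.sum_univ_succ, Fin.succAbove]
  ring

/-- This is the determinant of the coframe dt - a(1 - x²)dφ, (r² + a²)dφ - a dt in (dt, dφ), which
is why powers of ρ cancel in the determinant and the inverse of the metric. -/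
theorem rhoSq_eq (r x : ℝ) :
    c.rhoSq r x = r ^ 2 + c.a ^ 2 - c.a * (c.a * (1 - x ^ 2)) := by
  unfold rhoSq; ring

theorem det_metric {p : Fin 4 → ℝ} (hP : c.rhoSq (p 2) (p 3) ≠ 0) (hD : c.deltaR (p 2) ≠ 0)
    (hX : c.deltaX (p 3) ≠ 0) : (c.metric p).det = -c.rhoSq (p 2) (p 3) ^ 2 := by
  rw [metric_eq, det_blocks]
  field_simp
  rw [rhoSq_eq]
  ring

theorem inv_metric {p : Fin 4 → ℝ} (hP : c.rhoSq (p 2) (p 3) ≠ 0) (hD : c.deltaR (p 2) ≠ 0)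
    (hX : c.deltaX (p 3) ≠ 0) : (c.metric p)⁻¹ =
    !![(-(p 2 ^ 2 + c.a ^ 2) ^ 2 / c.deltaR (p 2) + (c.a * (1 - p 3 ^ 2)) ^ 2 / c.deltaX (p 3))
          / c.rhoSq (p 2) (p 3),
        (-c.a * (p 2 ^ 2 + c.a ^ 2) / c.deltaR (p 2) + c.a * (1 - p 3 ^ 2) / c.deltaX (p 3))
          / c.rhoSq (p 2) (p 3), 0, 0;
      (-c.a * (p 2 ^ 2 + c.a ^ 2) / c.deltaR (p 2) + c.a * (1 - p 3 ^ 2) / c.deltaX (p 3))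
          / c.rhoSq (p 2) (p 3),
        (-c.a ^ 2 / c.deltaR (p 2) + 1 / c.deltaX (p 3)) / c.rhoSq (p 2) (p 3), 0, 0;
      0, 0, c.deltaR (p 2) / c.rhoSq (p 2) (p 3), 0;
      0, 0, 0, c.deltaX (p 3) / c.rhoSq (p 2) (p 3)] := by
  refine Matrix.inv_eq_right_inv ?_
  rw [metric_eq]
  have e := c.rhoSq_eq (p 2) (p 3)
  ext i j
  fin_cases i <;> fin_cases j <;>
    simp [Matrix.mul_apply, Fin.sum_univ_succ] <;> field_simp <;> (try rw [e]) <;> ring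

/-- The entries `√|g| g^{μν}` that act on axisymmetric functions. -/
theorem sqrt_det_mul_inv {p : Fin 4 → ℝ} (hP : 0 < c.rhoSq (p 2) (p 3)) (hD : c.deltaR (p 2) ≠ 0)
    (hX : c.deltaX (p 3) ≠ 0) (v : Fin 4 → ℂ) (hv : v 1 = 0) (μ : Fin 4) :
    ∑ ν, ((Real.sqrt |(c.metric p).det| * (c.metric p)⁻¹ μ ν : ℝ) : ℂ) * v ν =
      ![((-(p 2 ^ 2 + c.a ^ 2) ^ 2 / c.deltaR (p 2)
            + (c.a * (1 - p 3 ^ 2)) ^ 2 / c.deltaX (p 3) : ℝ) : ℂ) * v 0,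
        ((-c.a * (p 2 ^ 2 + c.a ^ 2) / c.deltaR (p 2)
            + c.a * (1 - p 3 ^ 2) / c.deltaX (p 3) : ℝ) : ℂ) * v 0,
        (c.deltaR (p 2) : ℂ) * v 2, (c.deltaX (p 3) : ℂ) * v 3] μ := by
  -- The determinant is -ρ⁴, so the density ρ² cancels the denominators of the inverse metric; the
  -- remaining entries are sums of a function of r and a function of x.
  rw [c.det_metric hP.ne' hD hX, abs_neg, abs_of_nonneg (by positivity), Real.sqrt_sq hP.le,
    c.inv_metric hP.ne' hD hX]
  have hm : ∀ y : ℝ, c.rhoSq (p 2) (p 3) * (y / c.rhoSq (p 2) (p 3)) = y := fun y =>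
    mul_div_cancel₀ _ hP.ne'
  fin_cases μ <;> simp [Fin.sum_univ_succ, hv, -Complex.ofReal_mul, -Complex.ofReal_div, hm]

end CarterParams

namespace Exterior

variable {X : Exterior}

/-- The point `(τ, r, x)` of the regular chart over the point `(t, φ, r, x)`. -/
def chart (X : Exterior) (q : Fin 4 → ℝ) : ℝ × (ℝ × ℝ) := (q 0 + X.h (q 2), (q 2, q 3))

theorem radialInt_mem_nhds {r : ℝ} (hr : r ∈ X.radialInt) : X.radialInt ∈ 𝓝 r := by
  refine IsOpen.mem_nhds ?_ hr
  unfold radialInt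
  cases X.outer
  · exact isOpen_Ioo
  · exact isOpen_Ioo
  · exact isOpen_Ioi

theorem radialInt_subset_radial : X.radialInt ⊆ X.radial := by
  unfold radialInt radial
  cases X.outer
  · exact Ioo_subset_Icc_self
  · exact Ioo_subset_Icc_self
  · exact Ioi_subset_Ici_self

theorem BH1.hasDerivAt_H (hX : X.BH1) {r : ℝ} (hr : r ∈ X.radialInt) :
    HasDerivAt X.H (deriv X.H r) r := by
  have h1 := (hX.H_smooth.differentiableOn (by simp)) r (radialInt_subset_radial hr)
  exact (h1.differentiableAt
    (mem_of_superset (radialInt_mem_nhds hr) radialInt_subset_radial)).hasDerivAt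

theorem hasDerivAt_chart_zero (q : Fin 4 → ℝ) (y : ℝ) :
    HasDerivAt (fun y => X.chart (Function.update q 0 y)) (1, (0, 0)) y := by
  simp only [chart, Function.update_self, ne_eq, Fin.reduceEq, not_false_eq_true,
    Function.update_of_ne]
  exact ((hasDerivAt_id y).add_const _).prodMk (hasDerivAt_const _ _)

/-- The radial derivative at fixed t is ∂_r + (H/Δ_r)∂_τ in the regular chart, because τ = t + h(r).
-/
theorem hasDerivAt_chart_two (hX : X.BH1) (q : Fin 4 → ℝ) {y : ℝ} (hy : y ∈ X.radialInt) :
    HasDerivAt (fun y => X.chart (Function.update q 2 y)) (X.H y / X.deltaR y, (1, 0)) y := by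
  simp only [chart, Function.update_self, ne_eq, Fin.reduceEq, not_false_eq_true,
    Function.update_of_ne]
  exact ((hX.h_deriv y hy).const_add _).prodMk ((hasDerivAt_id y).prodMk (hasDerivAt_const _ _))

theorem hasDerivAt_chart_three (q : Fin 4 → ℝ) (y : ℝ) :
    HasDerivAt (fun y => X.chart (Function.update q 3 y)) (0, (0, 1)) y := by
  simp only [chart, Function.update_self, ne_eq, Fin.reduceEq, not_false_eq_true,
    Function.update_of_ne]
  exact (hasDerivAt_const _ _).prodMk ((hasDerivAt_const _ _).prodMk (hasDerivAt_id y))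

theorem pderiv_lift (hX : X.BH1) {u : ℝ → ℝ × ℝ → ℂ} {q : Fin 4 → ℝ} (hq : q 2 ∈ X.radialInt)
    (hu : DifferentiableAt ℝ (fun z : ℝ × (ℝ × ℝ) => u z.1 z.2) (X.chart q)) (ν : Fin 4) :
    CarterParams.pderiv ν (X.lift u) q =
      ![fderiv ℝ (fun z : ℝ × (ℝ × ℝ) => u z.1 z.2) (X.chart q) (1, (0, 0)), 0,
        fderiv ℝ (fun z : ℝ × (ℝ × ℝ) => u z.1 z.2) (X.chart q) (X.H (q 2) / X.deltaR (q 2), (1, 0)),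
        fderiv ℝ (fun z : ℝ × (ℝ × ℝ) => u z.1 z.2) (X.chart q) (0, (0, 1))] ν := by
  have key : ∀ (ν : Fin 4) (v : ℝ × (ℝ × ℝ)),
      HasDerivAt (fun y => X.chart (Function.update q ν y)) v (q ν) →
      CarterParams.pderiv ν (X.lift u) q =
        fderiv ℝ (fun z : ℝ × (ℝ × ℝ) => u z.1 z.2) (X.chart q) v := by
    intro ν v hv
    have hu' : HasFDerivAt (fun z : ℝ × (ℝ × ℝ) => u z.1 z.2)
        (fderiv ℝ (fun z : ℝ × (ℝ × ℝ) => u z.1 z.2) (X.chart q))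
        (X.chart (Function.update q ν (q ν))) := by
      rw [Function.update_eq_self]
      exact hu.hasFDerivAt
    exact (hu'.comp_hasDerivAt (q ν) hv).deriv
  fin_cases ν
  · exact key 0 _ (hasDerivAt_chart_zero q _)
  · have : (fun y : ℝ => X.lift u (Function.update q 1 y)) = fun _ => X.lift u q := by
      ext y
      simp [lift]
    change deriv (fun y : ℝ => X.lift u (Function.update q 1 y)) _ = 0
    rw [this, deriv_const]
  · exact key 2 _ (hasDerivAt_chart_two hX q hq)
  · exact key 3 _ (hasDerivAt_chart_three q _)

/-- The derivative of `F` in the direction `e`. -/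
abbrev dd (e : ℝ × (ℝ × ℝ)) (F : ℝ × (ℝ × ℝ) → ℂ) (z : ℝ × (ℝ × ℝ)) : ℂ := fderiv ℝ F z e

/-- The flux components are computed in the chart (t, φ, r, x) and rewritten with ∂_r|_t = ∂_r +
(H/Δ_r)∂_τ. The singular factors 1/Δ_r cancel, so the result contains only coefficients regular at
the horizons. -/
theorem BH1.rho_mul_waveOp (hX : X.BH1) {u : ℝ → ℝ × ℝ → ℂ} {τ : ℝ} {p : ℝ × ℝ}
    (hp : p ∈ X.inner)
    (hu : ContDiffAt ℝ ∞ (fun z : ℝ × (ℝ × ℝ) => u z.1 z.2) (τ, p)) :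
    let F := fun z : ℝ × (ℝ × ℝ) => u z.1 z.2
    (X.rhoSq p.1 p.2 : ℂ) * X.waveOp u τ p =
      (X.deltaR p.1 : ℂ) * dd (0, (1, 0)) (dd (0, (1, 0)) F) (τ, p)
        + ((deriv X.deltaR p.1 : ℝ) : ℂ) * dd (0, (1, 0)) F (τ, p)
        + ((deriv X.H p.1 : ℝ) : ℂ) * dd (1, (0, 0)) F (τ, p)
        + (X.H p.1 : ℂ) * dd (0, (1, 0)) (dd (1, (0, 0)) F) (τ, p)
        + (X.H p.1 : ℂ) * dd (1, (0, 0)) (dd (0, (1, 0)) F) (τ, p)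
        - (X.N p : ℂ) * dd (1, (0, 0)) (dd (1, (0, 0)) F) (τ, p)
        + (X.deltaX p.2 : ℂ) * dd (0, (0, 1)) (dd (0, (0, 1)) F) (τ, p)
        + ((deriv X.deltaX p.2 : ℝ) : ℂ) * dd (0, (0, 1)) F (τ, p) := by
  intro F
  set q : Fin 4 → ℝ := ![τ - X.h p.1, 0, p.1, p.2] with hq
  have q2 : q 2 = p.1 := rfl
  have q3 : q 3 = p.2 := rfl
  have hcq : X.chart q = (τ, p) := by simp [chart, hq]
  have hr := hp.1
  have hx := hp.2
  have hP : 0 < X.rhoSq p.1 p.2 := hX.rho_pos p (inner_subset_slice hp)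
  have hD := hX.deltaR_pos p.1 hr
  have hXx := hX.deltaX_pos p.2 hx
  have hdiff : ∀ᶠ z in 𝓝 (τ, p), z.2 ∈ X.inner ∧ DifferentiableAt ℝ F z := by
    have h1 : ∀ᶠ z : ℝ × (ℝ × ℝ) in 𝓝 (τ, p), z.2 ∈ X.inner :=
      continuous_snd.continuousAt.eventually (isOpen_inner.mem_nhds hp)
    have h2 : ∀ᶠ z in 𝓝 (τ, p), ContDiffAt ℝ 1 F z :=
      (hu.of_le (by exact_mod_cast le_top)).eventually (by simp)
    filter_upwards [h1, h2] with z hz1 hz2 using ⟨hz1, hz2.differentiableAt (by simp)⟩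
  have hddF : ∀ e, DifferentiableAt ℝ (dd e F) (τ, p) := by
    intro e
    have h1 : ContDiffAt ℝ ∞ (fderiv ℝ F) (τ, p) :=
      hu.fderiv_right (by simp)
    exact (h1.differentiableAt (by simp)).clm_apply (differentiableAt_const e)
  set Φ : Fin 4 → (Fin 4 → ℝ) → ℂ := fun μ z => ∑ ν : Fin 4,
    ((Real.sqrt |(X.metric z).det| * (X.metric z)⁻¹ μ ν : ℝ) : ℂ)
      * CarterParams.pderiv ν (X.lift u) z with hΦ
  have hΦeq : ∀ (μ : Fin 4) (z : Fin 4 → ℝ), (X.chart z).2 ∈ X.inner →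
      DifferentiableAt ℝ F (X.chart z) → Φ μ z =
      ![((-(z 2 ^ 2 + X.a ^ 2) ^ 2 / X.deltaR (z 2)
            + (X.a * (1 - z 3 ^ 2)) ^ 2 / X.deltaX (z 3) : ℝ) : ℂ) * dd (1, (0, 0)) F (X.chart z),
        ((-X.a * (z 2 ^ 2 + X.a ^ 2) / X.deltaR (z 2)
            + X.a * (1 - z 3 ^ 2) / X.deltaX (z 3) : ℝ) : ℂ) * dd (1, (0, 0)) F (X.chart z),
        (X.deltaR (z 2) : ℂ) * dd (0, (1, 0)) F (X.chart z)
          + (X.H (z 2) : ℂ) * dd (1, (0, 0)) F (X.chart z),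
        (X.deltaX (z 3) : ℂ) * dd (0, (0, 1)) F (X.chart z)] μ := by
    intro μ z hz hdz
    have hPz := hX.rho_pos _ (inner_subset_slice hz)
    have hDz : X.deltaR (z 2) ≠ 0 := (hX.deltaR_pos _ hz.1).ne'
    have hXz : X.deltaX (z 3) ≠ 0 := (hX.deltaX_pos _ hz.2).ne'
    have h1 := X.sqrt_det_mul_inv hPz hDz hXz
      (fun ν => CarterParams.pderiv ν (X.lift u) z) (pderiv_lift hX hz.1 hdz 1) μ
    refine h1.trans ?_
    have e0 := pderiv_lift hX hz.1 hdz 0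
    have e2 := pderiv_lift hX hz.1 hdz 2
    have e3 := pderiv_lift hX hz.1 hdz 3
    simp only [e0, e2, e3]
    have hsplit : ((X.H (z 2) / X.deltaR (z 2), (1, 0)) : ℝ × (ℝ × ℝ)) =
        (0, (1, 0)) + (X.H (z 2) / X.deltaR (z 2)) • (1, (0, 0)) := by simp
    have h2 : (X.deltaR (z 2) : ℂ) * fderiv ℝ F (X.chart z) (X.H (z 2) / X.deltaR (z 2), (1, 0)) =
        (X.deltaR (z 2) : ℂ) * dd (0, (1, 0)) F (X.chart z)
          + (X.H (z 2) : ℂ) * dd (1, (0, 0)) F (X.chart z) := by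
      rw [hsplit, map_add, map_smul, Complex.real_smul]
      have : (X.deltaR (z 2) : ℂ) ≠ 0 := by exact_mod_cast hDz
      push_cast
      field_simp
    fin_cases μ
    · rfl
    · rfl
    · exact h2
    · rfl
  -- The flux formula is needed along a whole piece of each coordinate line through the base point,
  -- since it is about to be differentiated.
  have hev : ∀ (μ : Fin 4) (v : ℝ × (ℝ × ℝ)),
      HasDerivAt (fun y => X.chart (Function.update q μ y)) v (q μ) →
      ∀ᶠ y in 𝓝 (q μ), (X.chart (Function.update q μ y)).2 ∈ X.inner ∧
        DifferentiableAt ℝ F (X.chart (Function.update q μ y)) := by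
    intro μ v hv
    have hc := hv.continuousAt
    simp only [ContinuousAt, Function.update_eq_self, hcq] at hc
    exact hc.eventually hdiff
  have hcomp : ∀ (μ : Fin 4) (v e : ℝ × (ℝ × ℝ)),
      HasDerivAt (fun y => X.chart (Function.update q μ y)) v (q μ) →
      HasDerivAt (fun y => dd e F (X.chart (Function.update q μ y)))
        (fderiv ℝ (dd e F) (τ, p) v) (q μ) := by
    intro μ v e hv
    have h1 : HasFDerivAt (dd e F) (fderiv ℝ (dd e F) (τ, p))
        (X.chart (Function.update q μ (q μ))) := by
      rw [Function.update_eq_self, hcq]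
      exact (hddF e).hasFDerivAt
    exact h1.comp_hasDerivAt (q μ) hv
  have hd0 := hasDerivAt_chart_zero (X := X) q (q 0)
  have hd2 := hasDerivAt_chart_two hX q (y := q 2) hr
  have hd3 := hasDerivAt_chart_three (X := X) q (q 3)
  -- The coefficient of ∂_τ² coming from the time flux is -N - H²/Δ_r; the radial flux contributes
  -- +H²/Δ_r, which leaves -N.
  have hcoef : ((-(p.1 ^ 2 + X.a ^ 2) ^ 2 / X.deltaR p.1
            + (X.a * (1 - p.2 ^ 2)) ^ 2 / X.deltaX p.2 : ℝ) : ℂ)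
      = -(X.N p : ℂ) - (X.H p.1 : ℂ) ^ 2 / (X.deltaR p.1 : ℂ) := by
    rw [hX.N_eq p hp]
    push_cast
    ring
  have p0 : CarterParams.pderiv 0 (Φ 0) q =
      (-(X.N p : ℂ) - (X.H p.1 : ℂ) ^ 2 / (X.deltaR p.1 : ℂ)) *
        dd (1, (0, 0)) (dd (1, (0, 0)) F) (τ, p) := by
    rw [← hcoef]
    refine HasDerivAt.deriv ?_
    refine ((hcomp 0 _ (1, (0, 0)) hd0).const_mul _).congr_of_eventuallyEq ?_
    filter_upwards [hev 0 _ hd0] with y hy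
    rw [hΦeq 0 _ hy.1 hy.2]
    rfl
  have p1 : CarterParams.pderiv 1 (Φ 1) q = 0 := by
    have hch : ∀ y, X.chart (Function.update q 1 y) = (τ, p) := by
      intro y
      rw [← hcq]
      simp [chart]
    have : (fun y => Φ 1 (Function.update q 1 y)) = fun _ =>
        ((-X.a * (p.1 ^ 2 + X.a ^ 2) / X.deltaR p.1
            + X.a * (1 - p.2 ^ 2) / X.deltaX p.2 : ℝ) : ℂ) * dd (1, (0, 0)) F (τ, p) := by
      ext y
      rw [hΦeq 1 _ (by rw [hch]; exact hp) (by rw [hch]; exact hdiff.self_of_nhds.2), hch]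
      rfl
    change deriv (fun y => Φ 1 (Function.update q 1 y)) _ = 0
    rw [this, deriv_const]
  have p2 : CarterParams.pderiv 2 (Φ 2) q =
      ((deriv X.deltaR p.1 : ℝ) : ℂ) * dd (0, (1, 0)) F (τ, p) + (X.deltaR p.1 : ℂ) *
        fderiv ℝ (dd (0, (1, 0)) F) (τ, p) (X.H p.1 / X.deltaR p.1, (1, 0)) +
      (((deriv X.H p.1 : ℝ) : ℂ) * dd (1, (0, 0)) F (τ, p) + (X.H p.1 : ℂ) *
        fderiv ℝ (dd (1, (0, 0)) F) (τ, p) (X.H p.1 / X.deltaR p.1, (1, 0))) := by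
    refine HasDerivAt.deriv ?_
    have hDd : HasDerivAt (fun y => (X.deltaR y : ℂ)) ((deriv X.deltaR p.1 : ℝ) : ℂ) (q 2) := by
      refine HasDerivAt.ofReal_comp (DifferentiableAt.hasDerivAt ?_)
      unfold CarterParams.deltaR
      fun_prop
    have hHd : HasDerivAt (fun y => (X.H y : ℂ)) ((deriv X.H p.1 : ℝ) : ℂ) (q 2) :=
      (hX.hasDerivAt_H hr).ofReal_comp
    have h1 := (hDd.mul (hcomp 2 _ (0, (1, 0)) hd2)).add (hHd.mul (hcomp 2 _ (1, (0, 0)) hd2))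
    simp only [Function.update_eq_self, hcq] at h1
    refine h1.congr_of_eventuallyEq ?_
    filter_upwards [hev 2 _ hd2] with y hy
    rw [hΦeq 2 _ hy.1 hy.2]
    simp
  have p3 : CarterParams.pderiv 3 (Φ 3) q =
      ((deriv X.deltaX p.2 : ℝ) : ℂ) * dd (0, (0, 1)) F (τ, p) + (X.deltaX p.2 : ℂ) *
        dd (0, (0, 1)) (dd (0, (0, 1)) F) (τ, p) := by
    refine HasDerivAt.deriv ?_
    have hDd : HasDerivAt (fun y => (X.deltaX y : ℂ)) ((deriv X.deltaX p.2 : ℝ) : ℂ) (q 3) := by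
      refine HasDerivAt.ofReal_comp (DifferentiableAt.hasDerivAt ?_)
      unfold CarterParams.deltaX
      fun_prop
    have h1 := hDd.mul (hcomp 3 _ (0, (0, 1)) hd3)
    simp only [Function.update_eq_self, hcq] at h1
    refine h1.congr_of_eventuallyEq ?_
    filter_upwards [hev 3 _ hd3] with y hy
    rw [hΦeq 3 _ hy.1 hy.2]
    simp
  have hsplit : ((X.H p.1 / X.deltaR p.1, (1, 0)) : ℝ × (ℝ × ℝ)) =
      (0, (1, 0)) + (X.H p.1 / X.deltaR p.1) • (1, (0, 0)) := by simp
  have hbox : X.waveOp u τ p = ((X.rhoSq p.1 p.2 : ℝ) : ℂ)⁻¹ *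
      ∑ μ, CarterParams.pderiv μ (Φ μ) q := by
    unfold waveOp CarterParams.box
    rw [X.det_metric (p := q) hP.ne' hD.ne' hXx.ne', abs_neg, abs_of_nonneg (by positivity),
      q2, q3, Real.sqrt_sq hP.le]
    rw [Complex.ofReal_inv]
  rw [hbox, Fin.sum_univ_four, p0, p1, p2, p3, mul_inv_cancel_left₀ (by exact_mod_cast hP.ne'),
    hsplit, map_add, map_smul, map_add, map_smul, Complex.real_smul, Complex.real_smul]
  have hDc : (X.deltaR p.1 : ℂ) ≠ 0 := by exact_mod_cast hD.ne'
  push_cast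
  simp only [dd]
  field_simp
  ring

end Exterior

namespace Exterior

variable {X : Exterior}

/-! ### Classical and weak derivatives -/

theorem integral_vol_eq {f : ℝ × ℝ → ℂ} (h : Function.support f ⊆ X.inner) :
    ∫ p, f p ∂X.vol = ∫ p, f p := by
  unfold vol
  exact setIntegral_eq_integral_of_forall_compl_eq_zero fun p hp => by
    by_contra h0
    exact hp (h h0)

/-- The function g is smooth only in the interior, but gφ extends by zero to a smooth compactly
supported function on the plane, whose directional derivative has integral zero. -/
theorem isWeakDeriv_of_contDiffOn {g : ℝ × ℝ → ℂ} (hg : ContDiffOn ℝ ∞ g X.inner) (e : ℝ × ℝ) :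
    X.IsWeakDeriv e g (fun p => fderiv ℝ g p e) := by
  intro φ hφ
  have hga : ∀ p ∈ X.inner, ContDiffAt ℝ ∞ g p := fun p hp =>
    hg.contDiffAt (isOpen_inner.mem_nhds hp)
  have hG : ContDiff ℝ ∞ fun p => g p * φ p := by
    rw [contDiff_iff_contDiffAt]
    intro p
    by_cases hp : p ∈ tsupport φ
    · exact (hga p (hφ.2.2 hp)).mul hφ.1.contDiffAt
    · have h0 : (fun p => g p * φ p) =ᶠ[𝓝 p] fun _ => 0 := by
        filter_upwards [(isClosed_tsupport φ).isOpen_compl.mem_nhds hp] with q hq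
        rw [image_eq_zero_of_notMem_tsupport hq, mul_zero]
      exact contDiffAt_const.congr_of_eventuallyEq h0
  have hGs : HasCompactSupport fun p => g p * φ p := hφ.2.1.mul_left
  have hG' : Continuous fun p => fderiv ℝ (fun p => g p * φ p) p e :=
    (hG.continuous_fderiv (by simp)).clm_apply continuous_const
  have hG's : HasCompactSupport fun p => fderiv ℝ (fun p => g p * φ p) p e :=
    hGs.fderiv_apply (𝕜 := ℝ) e
  have hzero : ∫ p, fderiv ℝ (fun p => g p * φ p) p e = 0 := by
    have := integral_mul_fderiv_eq_neg_fderiv_mul_of_integrable (μ := volume) (v := e)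
      (f := fun p => g p * φ p) (g := fun _ : ℝ × ℝ => (1 : ℂ))
      (by simpa using hG'.integrable_of_hasCompactSupport hG's) (by simp)
      (by simpa using hG.continuous.integrable_of_hasCompactSupport hGs)
      (fun x _ => (hG.differentiable (by simp)) x) (fun x _ => differentiableAt_const _)
    simpa using this.symm
  have hexp : ∀ p, fderiv ℝ (fun p => g p * φ p) p e
      = g p * fderiv ℝ φ p e + fderiv ℝ g p e * φ p := by
    intro p
    by_cases hp : p ∈ tsupport φ
    · have h1 := (hga p (hφ.2.2 hp)).differentiableAt (by simp)
      have h2 := (hφ.1.differentiable (by simp)) p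
      rw [fderiv_fun_mul h1 h2]
      simp [mul_comm]
    · have h1 : φ p = 0 := image_eq_zero_of_notMem_tsupport hp
      have h2 : fderiv ℝ φ p = 0 := by
        by_contra h
        exact hp (tsupport_fderiv_subset ℝ (subset_tsupport _ h))
      have h3 : fderiv ℝ (fun p => g p * φ p) p = 0 := by
        by_contra h
        have h4 := tsupport_fderiv_subset ℝ (subset_tsupport _ h)
        exact hp (tsupport_mul_subset_right h4)
      simp [h1, h2, h3]
  have hgl : LocallyIntegrableOn g X.inner :=
    hg.continuousOn.locallyIntegrableOn isOpen_inner.measurableSet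
  have hgl' : LocallyIntegrableOn (fun p => fderiv ℝ g p e) X.inner := by
    refine ContinuousOn.locallyIntegrableOn ?_ isOpen_inner.measurableSet
    exact (hg.continuousOn_fderiv_of_isOpen isOpen_inner (by simp)).clm_apply continuousOn_const
  have i1 := hφ.integrable_mul (hφ.continuous_fderiv e) (tsupport_fderiv_apply_subset φ e) hgl
  have i2 := hφ.integrable_mul hφ.1.continuous subset_rfl hgl'
  rw [eq_neg_iff_add_eq_zero, ← integral_add i1 i2, integral_vol_eq]
  · simp_rw [← hexp]
    exact hzero
  · intro p hp
    by_contra hpi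
    have hpt : p ∉ tsupport φ := fun h => hpi (hφ.2.2 h)
    have h1 : φ p = 0 := image_eq_zero_of_notMem_tsupport hpt
    have h2 : fderiv ℝ φ p e = 0 := by
      by_contra h
      exact hpt (tsupport_fderiv_apply_subset φ e (subset_tsupport _ h))
    exact hp (by simp [h1, h2])

/-- The fundamental lemma of the calculus of variations, applied to g - g' with real test functions.
-/
theorem IsWeakDeriv.unique {e : ℝ × ℝ} {f f' g g' : ℝ × ℝ → ℂ} (h : X.IsWeakDeriv e f g)
    (h' : X.IsWeakDeriv e f' g') (hff : f =ᵐ[X.vol] f') (hg : LocallyIntegrableOn g X.inner)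
    (hg' : LocallyIntegrableOn g' X.inner) : g =ᵐ[X.vol] g' := by
  have key := isOpen_inner.ae_eq_zero_of_integral_contDiff_smul_eq_zero (hg.sub hg')
    (fun ψ hψ hc hs => by
      have hφ : X.IsTest fun p => (ψ p : ℂ) := by
        have hsub : tsupport (fun p => (ψ p : ℂ)) ⊆ tsupport ψ := by
          refine closure_mono fun p hp h0 => hp ?_
          simp only [h0, Complex.ofReal_zero]
        exact ⟨Complex.ofRealCLM.contDiff.comp hψ, hc.mono' (fun p hp =>
          hsub (subset_tsupport _ hp)), hsub.trans hs⟩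
      have e1 := h _ hφ
      have e2 := h' _ hφ
      have e3 : ∫ p, f p * fderiv ℝ (fun p => (ψ p : ℂ)) p e ∂X.vol
          = ∫ p, f' p * fderiv ℝ (fun p => (ψ p : ℂ)) p e ∂X.vol :=
        integral_congr_ae (hff.mono fun p hp => by simp only [hp])
      have i1 := hφ.integrable_mul hφ.1.continuous subset_rfl hg
      have i2 := hφ.integrable_mul hφ.1.continuous subset_rfl hg'
      have e4 : ∫ p, ψ p • (g - g') p = ∫ p, (g p * (ψ p : ℂ) - g' p * (ψ p : ℂ)) ∂X.vol := by
        rw [integral_vol_eq]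
        · refine integral_congr_ae (Eventually.of_forall fun p => ?_)
          simp only [Pi.sub_apply, Complex.real_smul]
          ring
        · intro p hp
          refine hs (subset_tsupport _ fun h0 => hp ?_)
          simp [h0]
      rw [e4, integral_sub i1 i2, sub_eq_zero]
      rw [e3, e2] at e1
      exact (neg_injective e1).symm)
  unfold vol
  rw [Filter.EventuallyEq, ae_restrict_iff' isOpen_inner.measurableSet]
  filter_upwards [key] with p hp hpi
  exact sub_eq_zero.1 (hp hpi)

end Exterior

namespace Realization

variable {X : Exterior} {W : Realization.{u} X} {s : ℕ}

/-! ### Local control of the data by the energy norm -/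

/-- The energy norm controls L² norms of both components on balls and, as the first lies in H^{s+1}
with s + 1 ≥ 1, also its radial derivative. For a smooth representative, uniqueness of weak
derivatives makes the latter classical. -/
theorem BH3.ball_bound (h : W.BH3 s) (R : ℝ) : ∃ C : ℝ≥0, ∀ U : W.E s,
    ∫⁻ p in Metric.closedBall 0 R, ‖(W.data s U).1 p‖ₑ ^ 2 ∂X.vol ≤ (C * ‖U‖ₑ) ^ 2 ∧
    ∫⁻ p in Metric.closedBall 0 R, ‖(W.data s U).2 p‖ₑ ^ 2 ∂X.vol ≤ (C * ‖U‖ₑ) ^ 2 ∧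
    ∀ f : ℝ × ℝ → ℂ, ContDiffOn ℝ ∞ f X.inner → (W.data s U).1 =ᵐ[X.vol] f →
      ∫⁻ p in Metric.closedBall 0 R, ‖fderiv ℝ f p (1, 0)‖ₑ ^ 2 ∂X.vol ≤ (C * ‖U‖ₑ) ^ 2 := by
  -- The margin makes χ equal to 1 on a neighbourhood of every point of the ball, so that χf and f
  -- have the same derivatives there.
  obtain ⟨χ, hχ, h1⟩ := exists_cutoff (R + 1)
  obtain ⟨C, hC⟩ := h.localize χ hχ
  refine ⟨C, fun U => ?_⟩
  have a1 : X.hNorm (s + 1) univ (fun p => (χ p : ℂ) * (W.data s U).1 p) ≤ C * ‖U‖ₑ :=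
    le_self_add.trans (hC U)
  have a2 : X.hNorm s univ (fun p => (χ p : ℂ) * (W.data s U).2 p) ≤ C * ‖U‖ₑ :=
    le_add_self.trans (hC U)
  have hB : MeasurableSet (Metric.closedBall (0 : ℝ × ℝ) R) :=
    Metric.isClosed_closedBall.measurableSet
  have hone : ∀ p ∈ Metric.closedBall (0 : ℝ × ℝ) R, χ p = 1 := fun p hp => h1 p (by
    rw [mem_closedBall_zero_iff] at hp; linarith)
  have key : ∀ (k : ℕ) (v : ℝ × ℝ → ℂ),
      X.hNorm k univ (fun p => (χ p : ℂ) * v p) ≤ C * ‖U‖ₑ →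
      ∫⁻ p in Metric.closedBall 0 R, ‖v p‖ₑ ^ 2 ∂X.vol ≤ (C * ‖U‖ₑ) ^ 2 := by
    intro k v hv
    calc ∫⁻ p in Metric.closedBall 0 R, ‖v p‖ₑ ^ 2 ∂X.vol
        = ∫⁻ p in Metric.closedBall 0 R, ‖(χ p : ℂ) * v p‖ₑ ^ 2 ∂X.vol :=
          setLIntegral_congr_fun hB fun p hp => by simp [hone p hp]
      _ ≤ ∫⁻ p in univ, ‖(χ p : ℂ) * v p‖ₑ ^ 2 ∂X.vol := lintegral_mono_set (subset_univ _)
      _ ≤ _ := Exterior.lintegral_sq_le_hNorm k univ _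
      _ ≤ _ := by gcongr
  refine ⟨key _ _ a1, key _ _ a2, fun f hf hU => ?_⟩
  have a3 : X.hNorm (s + 1) univ (fun p => (χ p : ℂ) * (W.data s U).1 p) ^ 2
      ≤ (C * ‖U‖ₑ) ^ 2 := by gcongr
  refine le_trans (Exterior.le_hNorm_sq fun d hd => ?_) a3
  refine le_trans ?_ (Exterior.component_le_jetMass (i := 1) (j := 0) (by omega))
  have hg : ContDiffOn ℝ ∞ (fun p => (χ p : ℂ) * f p) X.inner :=
    (Complex.ofRealCLM.contDiff.comp hχ.1).contDiffOn.mul hf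
  have hd10 : d 1 0 =ᵐ[X.vol] fun p => fderiv ℝ (fun p => (χ p : ℂ) * f p) p (1, 0) := by
    refine (hd.radial 0 0 (by omega)).unique (Exterior.isWeakDeriv_of_contDiffOn hg (1, 0)) ?_
      (hd.locInt _ _ (by omega)) ?_
    · refine hd.zero.trans ?_
      filter_upwards [hU] with p hp
      rw [hp]
    · refine ContinuousOn.locallyIntegrableOn ?_ Exterior.isOpen_inner.measurableSet
      exact (hg.continuousOn_fderiv_of_isOpen Exterior.isOpen_inner (by simp)).clm_apply
        continuousOn_const
  refine le_trans (le_of_eq ?_) (lintegral_mono_set (subset_univ (Metric.closedBall 0 R)))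
  refine setLIntegral_congr_fun_ae hB ?_
  filter_upwards [hd10] with p hp hpB
  rw [hp]
  have : (fun p => (χ p : ℂ) * f p) =ᶠ[𝓝 p] f := by
    have hn : Metric.ball (0 : ℝ × ℝ) (R + 1) ∈ 𝓝 p := by
      refine Metric.isOpen_ball.mem_nhds ?_
      rw [mem_closedBall_zero_iff] at hpB
      rw [mem_ball_zero_iff]
      linarith
    filter_upwards [hn] with q hq
    rw [mem_ball_zero_iff] at hq
    simp [h1 q hq.le]
  rw [this.fderiv_eq]

/-- By Fatou's lemma on each ball, a pointwise limit and a local L² limit of the same sequence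
coincide almost everywhere. -/
theorem ae_eq_of_tendsto_of_ball {v : ℝ × ℝ → ℂ} {vn fn : ℕ → ℝ × ℝ → ℂ} {f : ℝ × ℝ → ℂ}
    (hv : AEStronglyMeasurable v X.vol) (hvn : ∀ n, AEStronglyMeasurable (vn n) X.vol)
    (hfn : ∀ n, vn n =ᵐ[X.vol] fn n)
    (hf : ∀ᵐ p ∂X.vol, Tendsto (fun n => fn n p) atTop (𝓝 (f p)))
    (hlim : ∀ N : ℕ, Tendsto (fun n => ∫⁻ p in Metric.closedBall 0 N, ‖vn n p - v p‖ₑ ^ 2 ∂X.vol)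
      atTop (𝓝 0)) : v =ᵐ[X.vol] f := by
  have key : ∀ N : ℕ, ∀ᵐ p ∂X.vol.restrict (Metric.closedBall 0 (N : ℝ)), v p = f p := by
    intro N
    set μ := X.vol.restrict (Metric.closedBall 0 (N : ℝ))
    have hμ : μ ≤ X.vol := Measure.restrict_le_self
    have hf' : ∀ᵐ p ∂μ, Tendsto (fun n => vn n p) atTop (𝓝 (f p)) := by
      refine ae_restrict_of_ae ?_
      filter_upwards [hf, ae_all_iff.2 hfn] with p hp hpn
      exact hp.congr fun n => (hpn n).symm
    have hm : ∀ n, AEMeasurable (fun p => ‖vn n p - v p‖ₑ ^ 2) μ := fun n =>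
      (((hvn n).sub hv).mono_measure hμ).enorm.pow_const 2
    have h0 : ∫⁻ p, ‖f p - v p‖ₑ ^ 2 ∂μ = 0 := by
      refine le_antisymm ?_ zero_le
      calc ∫⁻ p, ‖f p - v p‖ₑ ^ 2 ∂μ
          ≤ ∫⁻ p, liminf (fun n => ‖vn n p - v p‖ₑ ^ 2) atTop ∂μ := by
            refine lintegral_mono_ae ?_
            filter_upwards [hf'] with p hp
            have : Tendsto (fun n => ‖vn n p - v p‖ₑ ^ 2) atTop (𝓝 (‖f p - v p‖ₑ ^ 2)) :=
              ((ENNReal.continuous_pow 2).tendsto _).comp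
                ((continuous_enorm.tendsto _).comp (hp.sub_const _))
            rw [this.liminf_eq]
        _ ≤ liminf (fun n => ∫⁻ p, ‖vn n p - v p‖ₑ ^ 2 ∂μ) atTop := lintegral_liminf_le' hm
        _ = 0 := (hlim N).liminf_eq
    have hfm : AEStronglyMeasurable f μ :=
      aestronglyMeasurable_of_tendsto_ae atTop (fun n => (hvn n).mono_measure hμ) hf'
    have hm0 : AEMeasurable (fun p => ‖f p - v p‖ₑ ^ 2) μ :=
      (hfm.sub (hv.mono_measure hμ)).enorm.pow_const 2
    rw [lintegral_eq_zero_iff' hm0] at h0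
    filter_upwards [h0] with p hp
    have : ‖f p - v p‖ₑ = 0 := by simpa using hp
    exact (sub_eq_zero.1 (enorm_eq_zero.1 this)).symm
  have hU : (⋃ N : ℕ, Metric.closedBall (0 : ℝ × ℝ) N) = univ := by
    refine eq_univ_of_forall fun p => mem_iUnion.2 ?_
    obtain ⟨N, hN⟩ := exists_nat_ge ‖p‖
    exact ⟨N, by rwa [mem_closedBall_zero_iff]⟩
  have := (ae_restrict_iUnion_iff (fun N : ℕ => Metric.closedBall (0 : ℝ × ℝ) N)
    (fun p => v p = f p)).2 key
  rwa [hU, Measure.restrict_univ] at this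

theorem tendsto_enorm_sub {A : ℕ → W.E s} {A₀ : W.E s} (hA : Tendsto A atTop (𝓝 A₀)) (C : ℝ≥0) :
    Tendsto (fun n => (C * ‖A n - A₀‖ₑ) ^ 2) atTop (𝓝 0) := by
  have h2 : Tendsto (fun n => ‖A n - A₀‖ₑ) atTop (𝓝 0) := by
    have : Tendsto (fun n => A n - A₀) atTop (𝓝 0) := by
      simpa using hA.sub_const A₀
    simpa [Function.comp_def] using (continuous_enorm.tendsto _).comp this
  have h3 := ENNReal.Tendsto.const_mul (a := (C : ℝ≥0∞)) h2 (Or.inr ENNReal.coe_ne_top)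
  have := ((ENNReal.continuous_pow 2).tendsto _).comp h3
  simpa [Function.comp_def] using this

theorem data_sub_ae (U V : W.E s) :
    (∀ᵐ p ∂X.vol, (W.data s (U - V)).1 p = (W.data s U).1 p - (W.data s V).1 p) ∧
      ∀ᵐ p ∂X.vol, (W.data s (U - V)).2 p = (W.data s U).2 p - (W.data s V).2 p :=
  (hasData_self U).sub (hasData_self V)

/-- Data of a limit, from the pointwise limits of the data. -/
theorem BH3.hasData_of_tendsto (h : W.BH3 s) {A : ℕ → W.E s} {A₀ : W.E s}
    (hA : Tendsto A atTop (𝓝 A₀)) {fn gn : ℕ → ℝ × ℝ → ℂ} {f g : ℝ × ℝ → ℂ}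
    (hd : ∀ n, W.HasData s (A n) (fn n) (gn n))
    (hf : ∀ᵐ p ∂X.vol, Tendsto (fun n => fn n p) atTop (𝓝 (f p)))
    (hg : ∀ᵐ p ∂X.vol, Tendsto (fun n => gn n p) atTop (𝓝 (g p))) : W.HasData s A₀ f g := by
  constructor
  · refine ae_eq_of_tendsto_of_ball (AEEqFun.aestronglyMeasurable _)
      (fun n => (W.data s (A n)).1.aestronglyMeasurable) (fun n => (hd n).1) hf fun N => ?_
    obtain ⟨C, hC⟩ := h.ball_bound N
    refine tendsto_of_tendsto_of_tendsto_of_le_of_le tendsto_const_nhds (tendsto_enorm_sub hA C)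
      (fun _ => zero_le) fun n => ?_
    refine le_trans (le_of_eq ?_) (hC (A n - A₀)).1
    refine lintegral_congr_ae (ae_restrict_of_ae ?_)
    filter_upwards [(data_sub_ae (A n) A₀).1] with p hp
    rw [hp]
  · refine ae_eq_of_tendsto_of_ball (AEEqFun.aestronglyMeasurable _)
      (fun n => (W.data s (A n)).2.aestronglyMeasurable) (fun n => (hd n).2) hg fun N => ?_
    obtain ⟨C, hC⟩ := h.ball_bound N
    refine tendsto_of_tendsto_of_tendsto_of_le_of_le tendsto_const_nhds (tendsto_enorm_sub hA C)
      (fun _ => zero_le) fun n => ?_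
    refine le_trans (le_of_eq ?_) (hC (A n - A₀)).2.1
    refine lintegral_congr_ae (ae_restrict_of_ae ?_)
    filter_upwards [(data_sub_ae (A n) A₀).2] with p hp
    rw [hp]

end Realization

namespace Exterior

variable {X : Exterior}

/-! ### Time slices of classical solutions -/

/-- `f` is the restriction to a slice `τ = const` of a smooth solution of the wave equation, with
spatial derivatives `fr`, `fx` and time derivatives `w`, `y` of the first and second order;
`wr` is the radial derivative of `w`. -/
structure TimeSlice (X : Exterior) {E : Type*} [NormedAddCommGroup E] [NormedSpace ℝ E]
    (f fr fx w wr y : ℝ × ℝ → E) : Prop where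
  smooth : ContDiffOn ℝ ∞ f X.slice
  smooth_r : ContDiffOn ℝ ∞ fr X.slice
  smooth_x : ContDiffOn ℝ ∞ fx X.slice
  smooth_w : ContDiffOn ℝ ∞ w X.slice
  smooth_wr : ContDiffOn ℝ ∞ wr X.slice
  smooth_y : ContDiffOn ℝ ∞ y X.slice
  deriv_r : ∀ p ∈ X.inner, fderiv ℝ f p (1, 0) = fr p
  deriv_x : ∀ p ∈ X.inner, fderiv ℝ f p (0, 1) = fx p
  deriv_w : ∀ p ∈ X.inner, fderiv ℝ w p (1, 0) = wr p
  eqn : ∀ p ∈ X.inner, X.deltaR p.1 • fderiv ℝ fr p (1, 0) + deriv X.deltaR p.1 • fr p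
    + deriv X.H p.1 • w p + (2 * X.H p.1) • wr p - X.N p • y p
    + X.deltaX p.2 • fderiv ℝ fx p (0, 1) + deriv X.deltaX p.2 • fx p = 0
  neumann : ∀ R, X.outer = .wall R (.robin 0 0) → ∀ x ∈ Icc X.xl X.xu,
    X.deltaR R • fr (R, x) + X.H R • w (R, x) = 0

/-- The equation has real coefficients, so real-linear maps respect it; real and imaginary parts
reduce the complex estimates to real ones. -/
theorem TimeSlice.map {E E' : Type*} [NormedAddCommGroup E] [NormedSpace ℝ E]
    [NormedAddCommGroup E'] [NormedSpace ℝ E'] {f fr fx w wr y : ℝ × ℝ → E}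
    (h : X.TimeSlice f fr fx w wr y) (L : E →L[ℝ] E') :
    X.TimeSlice (fun p => L (f p)) (fun p => L (fr p)) (fun p => L (fx p)) (fun p => L (w p))
      (fun p => L (wr p)) (fun p => L (y p)) := by
  have hc : ∀ {g : ℝ × ℝ → E}, ContDiffOn ℝ ∞ g X.slice →
      ContDiffOn ℝ ∞ (fun p => L (g p)) X.slice := fun hg => L.contDiff.comp_contDiffOn hg
  have hd : ∀ {g : ℝ × ℝ → E}, ContDiffOn ℝ ∞ g X.slice → ∀ p ∈ X.inner, ∀ e,
      fderiv ℝ (fun p => L (g p)) p e = L (fderiv ℝ g p e) := by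
    intro g hg p hp e
    have h1 : DifferentiableAt ℝ g p :=
      (hg.contDiffAt (mem_of_superset (isOpen_inner.mem_nhds hp) inner_subset_slice)).differentiableAt
        (by simp)
    have h2 := (L.hasFDerivAt.comp p h1.hasFDerivAt).fderiv
    exact congrArg (fun M => M e) h2
  refine ⟨hc h.smooth, hc h.smooth_r, hc h.smooth_x, hc h.smooth_w, hc h.smooth_wr,
    hc h.smooth_y, ?_, ?_, ?_, ?_, ?_⟩
  · intro p hp
    rw [hd h.smooth p hp, h.deriv_r p hp]
  · intro p hp
    rw [hd h.smooth p hp, h.deriv_x p hp]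
  · intro p hp
    rw [hd h.smooth_w p hp, h.deriv_w p hp]
  · intro p hp
    have := congrArg L (h.eqn p hp)
    simp only [map_add, map_sub, map_smul, map_zero] at this
    rw [hd h.smooth_r p hp, hd h.smooth_x p hp]
    exact this
  · intro R hR x hx
    have := congrArg L (h.neumann R hR x hx)
    simpa only [map_add, map_smul, map_zero] using this

/-- The spacetime domain of solutions on `[0, ∞)`. -/
def future (X : Exterior) : Set (ℝ × (ℝ × ℝ)) := Ici (0 : ℝ) ×ˢ X.slice

theorem uniqueDiffOn_radial (h : X.radialInt.Nonempty) : UniqueDiffOn ℝ X.radial := by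
  obtain ⟨r, hr⟩ := h
  unfold radial
  unfold radialInt at hr
  split at hr
  · exact uniqueDiffOn_Icc (hr.1.trans hr.2)
  · exact uniqueDiffOn_Icc (hr.1.trans hr.2)
  · exact uniqueDiffOn_Ici _

theorem BH1.uniqueDiffOn_future (hX : X.BH1) : UniqueDiffOn ℝ X.future :=
  (uniqueDiffOn_Ici 0).prod
    ((uniqueDiffOn_radial hX.radial_nonempty).prod (uniqueDiffOn_Icc hX.xl_lt_xu))

theorem future_mem_nhds {τ : ℝ} (hτ : 0 < τ) {p : ℝ × ℝ} (hp : p ∈ X.inner) :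
    X.future ∈ 𝓝 (τ, p) :=
  prod_mem_nhds (Ici_mem_nhds hτ)
    (mem_of_superset (isOpen_inner.mem_nhds hp) inner_subset_slice)

/-- Directional derivatives up to the boundary. -/
def bd (X : Exterior) (e : ℝ × (ℝ × ℝ)) (F : ℝ × (ℝ × ℝ) → ℂ) (z : ℝ × (ℝ × ℝ)) : ℂ :=
  fderivWithin ℝ F X.future z e

theorem BH1.contDiffOn_bd (hX : X.BH1) {F : ℝ × (ℝ × ℝ) → ℂ} (hF : ContDiffOn ℝ ∞ F X.future)
    (e : ℝ × (ℝ × ℝ)) : ContDiffOn ℝ ∞ (X.bd e F) X.future :=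
  (hF.fderivWithin hX.uniqueDiffOn_future (by simp)).clm_apply contDiffOn_const

theorem bd_eq_dd {F : ℝ × (ℝ × ℝ) → ℂ} (e : ℝ × (ℝ × ℝ)) {τ : ℝ} (hτ : 0 < τ) {p : ℝ × ℝ}
    (hp : p ∈ X.inner) : X.bd e F (τ, p) = dd e F (τ, p) := by
  unfold bd
  rw [fderivWithin_of_mem_nhds (future_mem_nhds hτ hp)]

theorem bd_eventuallyEq_dd {F : ℝ × (ℝ × ℝ) → ℂ} (e : ℝ × (ℝ × ℝ)) {τ : ℝ} (hτ : 0 < τ)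
    {p : ℝ × ℝ} (hp : p ∈ X.inner) : X.bd e F =ᶠ[𝓝 (τ, p)] dd e F := by
  have h : Ioi (0 : ℝ) ×ˢ X.inner ∈ 𝓝 (τ, p) :=
    prod_mem_nhds (Ioi_mem_nhds hτ) (isOpen_inner.mem_nhds hp)
  filter_upwards [h] with z hz
  exact bd_eq_dd e hz.1 hz.2

theorem fderiv_slice {G : ℝ × (ℝ × ℝ) → ℂ} (hG : ContDiffOn ℝ ∞ G X.future) {τ : ℝ} (hτ : 0 < τ)
    {p : ℝ × ℝ} (hp : p ∈ X.inner) (e : ℝ × ℝ) :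
    fderiv ℝ (fun p => G (τ, p)) p e = dd (0, e) G (τ, p) := by
  have h1 : HasFDerivAt G (fderiv ℝ G (τ, p)) (τ, p) :=
    ((hG.contDiffAt (future_mem_nhds hτ hp)).differentiableAt (by simp)).hasFDerivAt
  have h2 : HasFDerivAt (fun p : ℝ × ℝ => (τ, p)) (ContinuousLinearMap.inr ℝ ℝ (ℝ × ℝ)) p :=
    hasFDerivAt_prodMk_right τ p
  have := (h1.comp p h2).fderiv
  exact congrArg (fun M => M e) this

theorem contDiffOn_slice {G : ℝ × (ℝ × ℝ) → ℂ} (hG : ContDiffOn ℝ ∞ G X.future) {τ : ℝ}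
    (hτ : 0 < τ) : ContDiffOn ℝ ∞ (fun p => G (τ, p)) X.slice := by
  refine hG.comp (f := fun p : ℝ × ℝ => (τ, p)) (by fun_prop) fun p hp => ⟨hτ.le, hp⟩

theorem hasDerivAt_time {G : ℝ × (ℝ × ℝ) → ℂ} (hG : ContDiffOn ℝ ∞ G X.future) {τ : ℝ}
    (hτ : 0 < τ) {p : ℝ × ℝ} (hp : p ∈ X.inner) :
    HasDerivAt (fun t => G (t, p)) (dd (1, (0, 0)) G (τ, p)) τ := by
  have h1 : HasFDerivAt G (fderiv ℝ G (τ, p)) (τ, p) :=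
    ((hG.contDiffAt (future_mem_nhds hτ hp)).differentiableAt (by simp)).hasFDerivAt
  have h2 : HasDerivAt (fun t : ℝ => (t, p)) (1, (0, 0)) τ :=
    (hasDerivAt_id τ).prodMk (hasDerivAt_const _ _)
  exact h1.comp_hasDerivAt τ h2

theorem BH1.timeSlice (hX : X.BH1) {u : ℝ → ℝ × ℝ → ℂ} (hu : X.Admissible (Ici 0) u)
    (he : ∀ τ > 0, ∀ p ∈ X.inner, X.waveOp u τ p = 0) {τ : ℝ} (hτ : 0 < τ) :
    let F := fun z : ℝ × (ℝ × ℝ) => u z.1 z.2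
    X.TimeSlice (u τ) (fun p => X.bd (0, (1, 0)) F (τ, p)) (fun p => X.bd (0, (0, 1)) F (τ, p))
      (fun p => X.bd (1, (0, 0)) F (τ, p)) (fun p => X.bd (0, (1, 0)) (X.bd (1, (0, 0)) F) (τ, p))
      (fun p => X.bd (1, (0, 0)) (X.bd (1, (0, 0)) F) (τ, p)) := by
  intro F
  have hF : ContDiffOn ℝ ∞ F X.future := hu.1
  have hb := fun e => hX.contDiffOn_bd hF e
  refine ⟨contDiffOn_slice hF hτ, contDiffOn_slice (hb _) hτ, contDiffOn_slice (hb _) hτ,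
    contDiffOn_slice (hb _) hτ, contDiffOn_slice (hX.contDiffOn_bd (hb _) _) hτ,
    contDiffOn_slice (hX.contDiffOn_bd (hb _) _) hτ, ?_, ?_, ?_, ?_, ?_⟩
  · intro p hp
    rw [bd_eq_dd _ hτ hp]
    exact fderiv_slice hF hτ hp _
  · intro p hp
    rw [bd_eq_dd _ hτ hp]
    exact fderiv_slice hF hτ hp _
  · intro p hp
    rw [bd_eq_dd (F := X.bd (1, (0, 0)) F) _ hτ hp]
    exact fderiv_slice (hb _) hτ hp _
  · intro p hp
    have hFa : ContDiffAt ℝ ∞ F (τ, p) := hF.contDiffAt (future_mem_nhds hτ hp)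
    have h1 := hX.rho_mul_waveOp hp hFa
    rw [he τ hτ p hp, mul_zero] at h1
    -- Derivatives up to the boundary agree with ordinary ones near an interior point at positive
    -- time, hence may be differentiated once more.
    have hsecond : ∀ e e', dd e' (X.bd e F) (τ, p) = dd e' (dd e F) (τ, p) := fun e e' => by
      simp only [dd, (bd_eventuallyEq_dd e hτ hp).fderiv_eq]
    -- The two mixed terms H ∂_r∂_τ and H ∂_τ∂_r merge into the coefficient 2H of `wr`.
    have hsymm : dd (1, (0, 0)) (dd (0, (1, 0)) F) (τ, p)
        = dd (0, (1, 0)) (dd (1, (0, 0)) F) (τ, p) := by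
      have hd : DifferentiableAt ℝ (fderiv ℝ F) (τ, p) :=
        (hFa.fderiv_right (m := ∞) (by simp)).differentiableAt (by simp)
      have hdd : ∀ e e', dd e' (dd e F) (τ, p) = fderiv ℝ (fderiv ℝ F) (τ, p) e' e := by
        intro e e'
        have := (hd.hasFDerivAt.clm_apply (hasFDerivAt_const e (τ, p))).fderiv
        simp only [dd, this]
        simp
      rw [hdd, hdd]
      exact (hFa.isSymmSndFDerivAt (by
        rw [minSmoothness_of_isRCLikeNormedField]
        exact WithTop.coe_le_coe.2 le_top)).eq _ _
    rw [fderiv_slice (hb _) hτ hp, fderiv_slice (hb _) hτ hp, bd_eq_dd _ hτ hp,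
      bd_eq_dd _ hτ hp, bd_eq_dd _ hτ hp, bd_eq_dd _ hτ hp, bd_eq_dd _ hτ hp]
    simp only [hsecond]
    change 0 = _ at h1
    rw [hsymm] at h1
    simp only [Complex.real_smul]
    refine Eq.trans ?_ h1.symm
    push_cast
    ring
  · intro R ho x hx
    have hbc := hu.2.1 R _ ho τ hτ.le x hx
    simp only [Pi.zero_apply, Complex.ofReal_zero, zero_mul, add_zero] at hbc
    have hR : R ∈ X.radial := wall_mem_radial hX.radial_nonempty ho
    have hz : (τ, (R, x)) ∈ X.future := ⟨hτ.le, hR, hx⟩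
    have hFd : HasFDerivWithinAt F (fderivWithin ℝ F X.future (τ, (R, x))) X.future (τ, (R, x)) :=
      ((hF.differentiableOn (by simp)) _ hz).hasFDerivWithinAt
    have d1 : HasDerivWithinAt (fun r => u τ (r, x)) (X.bd (0, (1, 0)) F (τ, (R, x))) X.radial R := by
      have hc : HasDerivWithinAt (fun r : ℝ => ((τ, (r, x)) : ℝ × (ℝ × ℝ))) (0, (1, 0)) X.radial R :=
        (hasDerivWithinAt_const _ _ _).prodMk
          ((hasDerivWithinAt_id _ _).prodMk (hasDerivWithinAt_const _ _ _))
      exact hFd.comp_hasDerivWithinAt R hc fun r (hr : r ∈ X.radial) =>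
        show (τ, (r, x)) ∈ X.future from ⟨hτ.le, hr, hx⟩
    have d2 : HasDerivWithinAt (fun t => u t (R, x)) (X.bd (1, (0, 0)) F (τ, (R, x))) (Ici 0) τ := by
      have hc : HasDerivWithinAt (fun t : ℝ => ((t, (R, x)) : ℝ × (ℝ × ℝ))) (1, (0, 0)) (Ici 0) τ :=
        (hasDerivWithinAt_id _ _).prodMk (hasDerivWithinAt_const _ _ _)
      exact hFd.comp_hasDerivWithinAt τ hc fun t (ht : t ∈ Ici (0 : ℝ)) =>
        show (t, (R, x)) ∈ X.future from ⟨ht, hR, hx⟩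
    rw [d1.derivWithin (uniqueDiffOn_radial hX.radial_nonempty R hR),
      d2.derivWithin (uniqueDiffOn_Ici 0 τ hτ.le)] at hbc
    simpa only [Complex.real_smul] using hbc

end Exterior

namespace Realization

variable {X : Exterior} {W : Realization.{u} X} {s : ℕ}

theorem tendsto_one_div_nhdsGT : Tendsto (fun n : ℕ => 1 / ((n : ℝ) + 1)) atTop (𝓝[>] 0) :=
  tendsto_nhdsWithin_iff.2 ⟨tendsto_one_div_add_atTop_nhds_zero_nat,
    Eventually.of_forall fun n => by
      rw [mem_Ioi]
      positivity⟩

/-- S(τ)V' is the limit of difference quotients of the orbit of V, and their data converge pointwise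
to time derivatives of the smooth solution; `BH3.hasData_of_tendsto` identifies the two limits. -/
theorem BH3.data_of_regular (h : W.BH3 s) (hX : X.BH1) {u : ℝ → ℝ × ℝ → ℂ} {V V' : W.E s}
    (hu : X.Admissible (Ici 0) u) (htr : W.Traces s (Ici 0) u (fun t => W.S s t V))
    (hG : W.Gen s V V') {τ : ℝ} (hτ : 0 < τ) :
    let F := fun z : ℝ × (ℝ × ℝ) => u z.1 z.2
    W.HasData s (W.S s τ V) (u τ) (fun p => X.bd (1, (0, 0)) F (τ, p)) ∧
      W.HasData s (W.S s τ V') (fun p => X.bd (1, (0, 0)) F (τ, p))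
        (fun p => X.bd (1, (0, 0)) (X.bd (1, (0, 0)) F) (τ, p)) := by
  intro F
  have hF : ContDiffOn ℝ ∞ F X.future := hu.1
  have hb := hX.contDiffOn_bd hF (1, (0, 0))
  have hdata : ∀ t > 0, W.HasData s (W.S s t V) (u t) (fun p => X.bd (1, (0, 0)) F (t, p)) := by
    intro t ht
    refine (htr t (mem_Ici.2 (le_of_lt ht))).congr ae_eq_rfl ?_
    filter_upwards [Exterior.ae_mem_inner] with p hp
    rw [Exterior.bd_eq_dd _ ht hp, derivWithin_of_mem_nhds (Ici_mem_nhds ht)]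
    exact (Exterior.hasDerivAt_time hF ht hp).deriv
  refine ⟨hdata τ hτ, ?_⟩
  have hlim := (GenOf.map h.isC0 hG hτ.le).comp tendsto_one_div_nhdsGT
  refine h.hasData_of_tendsto hlim
    (fn := fun n p => (((1 / ((n : ℝ) + 1))⁻¹ : ℝ) : ℂ) • (u (1 / ((n : ℝ) + 1) + τ) p - u τ p))
    (gn := fun n p => (((1 / ((n : ℝ) + 1))⁻¹ : ℝ) : ℂ) •
      (X.bd (1, (0, 0)) F (1 / ((n : ℝ) + 1) + τ, p) - X.bd (1, (0, 0)) F (τ, p))) ?_ ?_ ?_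
  · intro n
    have hn : (0 : ℝ) < 1 / ((n : ℝ) + 1) := by positivity
    have := ((hdata _ (add_pos hn hτ)).sub (hdata τ hτ)).smul (((1 / ((n : ℝ) + 1))⁻¹ : ℝ) : ℂ)
    simp only [Function.comp]
    rw [← h.isC0.apply_add hn.le hτ.le]
    exact this
  · filter_upwards [Exterior.ae_mem_inner] with p hp
    have h1 := (Exterior.hasDerivAt_time hF hτ hp).tendsto_slope_zero_right.comp
      tendsto_one_div_nhdsGT
    rw [Exterior.bd_eq_dd _ hτ hp]
    refine h1.congr fun n => ?_
    simp only [Function.comp, Complex.coe_smul]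
    rw [add_comm τ]
  · filter_upwards [Exterior.ae_mem_inner] with p hp
    have h1 := (Exterior.hasDerivAt_time hb hτ hp).tendsto_slope_zero_right.comp
      tendsto_one_div_nhdsGT
    rw [Exterior.bd_eq_dd (F := X.bd (1, (0, 0)) F) _ hτ hp]
    refine h1.congr fun n => ?_
    simp only [Function.comp, Complex.coe_smul]
    rw [add_comm τ]

/-- Elements of the graph of the generator are limits of time slices of classical solutions. -/
theorem BH3.exists_timeSlice_near (h : W.BH3 s) (hX : X.BH1) {V V' : W.E s} (hG : W.Gen s V V')
    {ε : ℝ} (hε : 0 < ε) : ∃ (A B : W.E s) (f fr fx w wr y : ℝ × ℝ → ℂ), ‖V - A‖ < ε ∧ ‖V' - B‖ < ε ∧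
      X.TimeSlice f fr fx w wr y ∧ W.HasData s A f w ∧ W.HasData s B w y := by
  obtain ⟨U, U', hGU, ⟨u, hu, he, htr⟩, h1, h2⟩ := h.dense V V' hG (ε / 2) (half_pos hε)
  -- A small positive time is used because the equation holds for τ > 0 and time derivatives are
  -- two-sided there; strong continuity keeps both elements of the graph close.
  have hc : ∀ Y : W.E s, ∀ᶠ t in 𝓝[>] (0 : ℝ), ‖Y - W.S s t Y‖ < ε / 2 := by
    intro Y
    have h3 : Tendsto (fun t => W.S s t Y) (𝓝[>] 0) (𝓝 (W.S s 0 Y)) :=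
      (h.S_cont Y 0 (by simp)).mono_left (nhdsWithin_mono _ Ioi_subset_Ici_self)
    rw [h.isC0.apply_zero] at h3
    filter_upwards [Metric.tendsto_nhds.1 h3 _ (half_pos hε)] with t ht
    rwa [dist_comm, dist_eq_norm] at ht
  obtain ⟨τ, ⟨h3, h4⟩, hτ⟩ := ((hc U).and (hc U')).and
    (self_mem_nhdsWithin : ∀ᶠ t in 𝓝[>] (0 : ℝ), t ∈ Ioi (0 : ℝ)) |>.exists
  obtain ⟨d1, d2⟩ := h.data_of_regular hX hu htr hGU hτ
  refine ⟨W.S s τ U, W.S s τ U', _, _, _, _, _, _, ?_, ?_, hX.timeSlice hu he hτ, d1, d2⟩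
  · calc ‖V - W.S s τ U‖ = ‖(V - U) + (U - W.S s τ U)‖ := by rw [sub_add_sub_cancel]
      _ ≤ ‖V - U‖ + ‖U - W.S s τ U‖ := norm_add_le _ _
      _ < ε := by linarith
  · calc ‖V' - W.S s τ U'‖ = ‖(V' - U') + (U' - W.S s τ U')‖ := by rw [sub_add_sub_cancel]
      _ ≤ ‖V' - U'‖ + ‖U' - W.S s τ U'‖ := norm_add_le _ _
      _ < ε := by linarith

end Realization

/-! ### Integration by parts on a rectangle -/

theorem integrableOn_openRect {a b c d : ℝ} {g : ℝ × ℝ → ℝ}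
    (hg : ContinuousOn g (Icc a b ×ˢ Icc c d)) : IntegrableOn g (Ioo a b ×ˢ Ioo c d) :=
  (hg.integrableOn_compact (isCompact_Icc.prod isCompact_Icc)).mono_set
    (prod_mono Ioo_subset_Icc_self Ioo_subset_Icc_self)

theorem setIntegral_rect_deriv_fst {a b c d : ℝ} (hab : a ≤ b) {P Pr : ℝ × ℝ → ℝ}
    (hP : ContinuousOn P (Icc a b ×ˢ Icc c d)) (hPr : ContinuousOn Pr (Icc a b ×ˢ Icc c d))
    (hd : ∀ p ∈ Ioo a b ×ˢ Ioo c d, HasDerivAt (fun r => P (r, p.2)) (Pr p) p.1) :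
    ∫ p in Ioo a b ×ˢ Ioo c d, Pr p = ∫ x in Ioo c d, (P (b, x) - P (a, x)) := by
  have hi : IntegrableOn (fun z : ℝ × ℝ => Pr z.swap) (Ioo c d ×ˢ Ioo a b)
      ((volume : Measure ℝ).prod volume) := by
    have h1 := integrableOn_openRect (a := c) (b := d) (c := a) (d := b)
      (g := fun z : ℝ × ℝ => Pr z.swap)
      (hPr.comp continuous_swap.continuousOn fun z hz => ⟨hz.2, hz.1⟩)
    rwa [Measure.volume_eq_prod] at h1
  rw [Measure.volume_eq_prod, ← setIntegral_prod_swap, setIntegral_prod _ hi]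
  refine setIntegral_congr_fun measurableSet_Ioo fun x hx => ?_
  have hline : ContinuousOn (fun r : ℝ => (r, x)) (Icc a b) := by fun_prop
  have hmaps : MapsTo (fun r : ℝ => (r, x)) (Icc a b) (Icc a b ×ˢ Icc c d) :=
    fun r hr => ⟨hr, Ioo_subset_Icc_self hx⟩
  have h1 : ContinuousOn (fun r => Pr (r, x)) (Icc a b) := hPr.comp hline hmaps
  have := intervalIntegral.integral_eq_sub_of_hasDerivAt_of_le hab (hP.comp hline hmaps)
    (f' := fun r => Pr (r, x)) (fun r hr => hd (r, x) ⟨hr, hx⟩)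
    (ContinuousOn.intervalIntegrable (by rwa [uIcc_of_le hab]))
  rw [intervalIntegral.integral_of_le hab, integral_Ioc_eq_integral_Ioo] at this
  exact this

theorem setIntegral_rect_deriv_snd {a b c d : ℝ} (hcd : c ≤ d) {Q Qx : ℝ × ℝ → ℝ}
    (hQ : ContinuousOn Q (Icc a b ×ˢ Icc c d)) (hQx : ContinuousOn Qx (Icc a b ×ˢ Icc c d))
    (hd : ∀ p ∈ Ioo a b ×ˢ Ioo c d, HasDerivAt (fun x => Q (p.1, x)) (Qx p) p.2) :
    ∫ p in Ioo a b ×ˢ Ioo c d, Qx p = ∫ r in Ioo a b, (Q (r, d) - Q (r, c)) := by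
  have h := setIntegral_rect_deriv_fst (a := c) (b := d) (c := a) (d := b) hcd
    (P := fun z => Q z.swap) (Pr := fun z => Qx z.swap)
    (hQ.comp continuous_swap.continuousOn fun z hz => ⟨hz.2, hz.1⟩)
    (hQx.comp continuous_swap.continuousOn fun z hz => ⟨hz.2, hz.1⟩)
    (fun p hp => hd p.swap ⟨hp.2, hp.1⟩)
  refine Eq.trans ?_ h
  rw [Measure.volume_eq_prod, ← setIntegral_prod_swap]

/-! ### The weak form of the wave equation on a truncated slice -/

namespace Exterior

variable {X : Exterior}

/-- The closed radial interval from the inner horizon to `R` lies in the exterior. -/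
structure InnerRadius (X : Exterior) (R : ℝ) : Prop where
  lt : X.rh < R
  closed : Icc X.rh R ⊆ X.radial
  opened : Ioo X.rh R ⊆ X.radialInt

theorem BH1.innerRadius_wall (hX : X.BH1) {R : ℝ} {law : WallLaw} (ho : X.outer = .wall R law) :
    X.InnerRadius R := by
  obtain ⟨r, hr⟩ := hX.radial_nonempty
  simp only [radialInt, ho] at hr
  refine ⟨hr.1.trans hr.2, ?_, ?_⟩
  · simp only [radial, ho]
    exact subset_rfl
  · simp only [radialInt, ho]
    exact subset_rfl

theorem innerRadius_infinity (ho : X.outer = .infinity) {R : ℝ} (hR : X.rh < R) :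
    X.InnerRadius R := by
  refine ⟨hR, ?_, ?_⟩
  · simp only [radial, ho]
    exact Icc_subset_Ici_self
  · simp only [radialInt, ho]
    exact Ioo_subset_Ioi_self

/-- The part `r ≤ R` of the slice. -/
def closedBox (X : Exterior) (R : ℝ) : Set (ℝ × ℝ) := Icc X.rh R ×ˢ Icc X.xl X.xu

/-- The part `r < R` of the interior. -/
def openBox (X : Exterior) (R : ℝ) : Set (ℝ × ℝ) := Ioo X.rh R ×ˢ Ioo X.xl X.xu

theorem InnerRadius.box_subset {R : ℝ} (h : X.InnerRadius R) : X.closedBox R ⊆ X.slice :=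
  prod_mono h.closed subset_rfl

theorem InnerRadius.openBox_subset {R : ℝ} (h : X.InnerRadius R) : X.openBox R ⊆ X.inner :=
  prod_mono h.opened subset_rfl

theorem integrableOn_openBox {R : ℝ} {g : ℝ × ℝ → ℝ} (hg : ContinuousOn g (X.closedBox R)) :
    IntegrableOn g (X.openBox R) :=
  integrableOn_openRect hg

theorem measurableSet_openBox (R : ℝ) : MeasurableSet (X.openBox R) :=
  measurableSet_Ioo.prod measurableSet_Ioo

theorem BH1.uniqueDiffOn_slice (hX : X.BH1) : UniqueDiffOn ℝ X.slice :=
  (uniqueDiffOn_radial hX.radial_nonempty).prod (uniqueDiffOn_Icc hX.xl_lt_xu)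

theorem BH1.exists_lineDeriv (hX : X.BH1) {g : ℝ × ℝ → ℝ} (hg : ContDiffOn ℝ ∞ g X.slice)
    (e : ℝ × ℝ) : ∃ g' : ℝ × ℝ → ℝ, ContinuousOn g' X.slice ∧
      ∀ p ∈ X.inner, fderiv ℝ g p e = g' p := by
  refine ⟨fun p => fderivWithin ℝ g X.slice p e, ?_, fun p hp => ?_⟩
  · exact (hg.continuousOn_fderivWithin hX.uniqueDiffOn_slice (by simp)).clm_apply
      continuousOn_const
  · dsimp only
    rw [fderivWithin_of_mem_nhds (mem_of_superset (isOpen_inner.mem_nhds hp) inner_subset_slice)]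

theorem hasDerivAt_fst {g : ℝ × ℝ → ℝ} (hg : ContDiffOn ℝ ∞ g X.slice) {p : ℝ × ℝ}
    (hp : p ∈ X.inner) : HasDerivAt (fun r => g (r, p.2)) (fderiv ℝ g p (1, 0)) p.1 := by
  have h1 : HasFDerivAt g (fderiv ℝ g p) p :=
    ((hg.contDiffAt (mem_of_superset (isOpen_inner.mem_nhds hp)
      inner_subset_slice)).differentiableAt (by simp)).hasFDerivAt
  have h2 : HasDerivAt (fun r : ℝ => (r, p.2)) ((1, 0) : ℝ × ℝ) p.1 :=
    (hasDerivAt_id _).prodMk (hasDerivAt_const _ _)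
  exact h1.comp_hasDerivAt p.1 h2

theorem hasDerivAt_snd {g : ℝ × ℝ → ℝ} (hg : ContDiffOn ℝ ∞ g X.slice) {p : ℝ × ℝ}
    (hp : p ∈ X.inner) : HasDerivAt (fun x => g (p.1, x)) (fderiv ℝ g p (0, 1)) p.2 := by
  have h1 : HasFDerivAt g (fderiv ℝ g p) p :=
    ((hg.contDiffAt (mem_of_superset (isOpen_inner.mem_nhds hp)
      inner_subset_slice)).differentiableAt (by simp)).hasFDerivAt
  have h2 : HasDerivAt (fun x : ℝ => (p.1, x)) ((0, 1) : ℝ × ℝ) p.2 :=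
    (hasDerivAt_const _ _).prodMk (hasDerivAt_id _)
  exact h1.comp_hasDerivAt p.2 h2

theorem hasDerivAt_deltaR (r : ℝ) : HasDerivAt X.deltaR (deriv X.deltaR r) r := by
  refine DifferentiableAt.hasDerivAt ?_
  unfold CarterParams.deltaR
  fun_prop

theorem hasDerivAt_deltaX (x : ℝ) : HasDerivAt X.deltaX (deriv X.deltaX x) x := by
  refine DifferentiableAt.hasDerivAt ?_
  unfold CarterParams.deltaX
  fun_prop

theorem contDiff_deltaR : ContDiff ℝ ∞ X.deltaR := by
  unfold CarterParams.deltaR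
  fun_prop

theorem contDiff_deltaX : ContDiff ℝ ∞ X.deltaX := by
  unfold CarterParams.deltaX
  fun_prop

/-- The radial derivative of `H`, up to the ends. -/
def dH (X : Exterior) (r : ℝ) : ℝ := derivWithin X.H X.radial r

theorem dH_eq {r : ℝ} (hr : r ∈ X.radialInt) : X.dH r = deriv X.H r :=
  derivWithin_of_mem_nhds (mem_of_superset (radialInt_mem_nhds hr) radialInt_subset_radial)

theorem BH1.continuousOn_dH (hX : X.BH1) : ContinuousOn X.dH X.radial :=
  hX.H_smooth.continuousOn_derivWithin (uniqueDiffOn_radial hX.radial_nonempty) (by simp)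

/-- `H` times the linear function of `r` that vanishes at the horizon and is `1` at `r = R`. -/
def kH (X : Exterior) (R r : ℝ) : ℝ := (r - X.rh) / (R - X.rh) * X.H r

/-- The derivative of `kH`. -/
def dkH (X : Exterior) (R r : ℝ) : ℝ := 1 / (R - X.rh) * X.H r + (r - X.rh) / (R - X.rh) * X.dH r

theorem BH1.hasDerivAt_kH (hX : X.BH1) (R : ℝ) {r : ℝ} (hr : r ∈ X.radialInt) :
    HasDerivAt (X.kH R) (X.dkH R r) r := by
  have h1 := hX.hasDerivAt_H hr
  rw [← dH_eq hr] at h1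
  have h2 : HasDerivAt (fun r => (r - X.rh) / (R - X.rh)) (1 / (R - X.rh)) r :=
    ((hasDerivAt_id r).sub_const _).div_const _
  exact h2.mul h1

theorem InnerRadius.continuousOn_fst {R : ℝ} (h : X.InnerRadius R) {k : ℝ → ℝ}
    (hk : ContinuousOn k X.radial) : ContinuousOn (fun p : ℝ × ℝ => k p.1) (X.closedBox R) :=
  hk.comp continuous_fst.continuousOn fun _ hp => h.closed hp.1

theorem BH1.continuousOn_kH (hX : X.BH1) (R : ℝ) : ContinuousOn (X.kH R) X.radial := by
  have := hX.H_smooth.continuousOn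
  unfold kH
  fun_prop

theorem BH1.continuousOn_dkH (hX : X.BH1) (R : ℝ) : ContinuousOn (X.dkH R) X.radial := by
  have := hX.H_smooth.continuousOn
  have := hX.continuousOn_dH
  unfold dkH
  fun_prop

theorem continuousOn_deltaR_fst (s : Set (ℝ × ℝ)) :
    ContinuousOn (fun p : ℝ × ℝ => X.deltaR p.1) s :=
  (contDiff_deltaR.continuous.comp continuous_fst).continuousOn

theorem continuousOn_deltaX_snd (s : Set (ℝ × ℝ)) :
    ContinuousOn (fun p : ℝ × ℝ => X.deltaX p.2) s :=
  (contDiff_deltaX.continuous.comp continuous_snd).continuousOn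

/-- The weak form of the wave equation on a slice.  The multiplier `kH` turns the flux of the
time derivative through `r = R` into a volume term. -/
theorem BH1.weak_form (hX : X.BH1) (hl : X.deltaX X.xl = 0) (hu : X.deltaX X.xu = 0) {R : ℝ}
    (hR : X.InnerRadius R) {f fr fx w wr y : ℝ × ℝ → ℝ} (h : X.TimeSlice f fr fx w wr y)
    {φ φr φx : ℝ × ℝ → ℝ} (hφ : ContinuousOn φ (X.closedBox R)) (hφr : ContinuousOn φr (X.closedBox R))
    (hφx : ContinuousOn φx (X.closedBox R))
    (hdr : ∀ p ∈ X.openBox R, HasDerivAt (fun r => φ (r, p.2)) (φr p) p.1)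
    (hdx : ∀ p ∈ X.openBox R, HasDerivAt (fun x => φ (p.1, x)) (φx p) p.2)
    (hbc : ∀ x ∈ Icc X.xl X.xu,
      (X.deltaR R * fr (R, x) + X.H R * w (R, x)) * φ (R, x) = 0) :
    ∫ p in X.openBox R, (((X.dkH R p.1 - X.dH p.1) * w p + (X.kH R p.1 - 2 * X.H p.1) * wr p
      + X.N p * y p) * φ p + (X.deltaR p.1 * fr p + X.kH R p.1 * w p) * φr p
      + X.deltaX p.2 * fx p * φx p) = 0 := by
  have hbs := hR.box_subset
  have hos := hR.openBox_subset
  obtain ⟨frr, hfrr, hfrr'⟩ := hX.exists_lineDeriv h.smooth_r (1, 0)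
  obtain ⟨fxx, hfxx, hfxx'⟩ := hX.exists_lineDeriv h.smooth_x (0, 1)
  have cfr := h.smooth_r.continuousOn.mono hbs
  have cfx := h.smooth_x.continuousOn.mono hbs
  have cw := h.smooth_w.continuousOn.mono hbs
  have cwr := h.smooth_wr.continuousOn.mono hbs
  have cfrr := hfrr.mono hbs
  have cfxx := hfxx.mono hbs
  have ck := hR.continuousOn_fst (hX.continuousOn_kH R)
  have cdk := hR.continuousOn_fst (hX.continuousOn_dkH R)
  have cD := continuousOn_deltaR_fst (X := X) (X.closedBox R)
  have cX := continuousOn_deltaX_snd (X := X) (X.closedBox R)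
  have cdD : ContinuousOn (fun p : ℝ × ℝ => deriv X.deltaR p.1) (X.closedBox R) :=
    ((contDiff_deltaR.continuous_deriv (by simp)).comp continuous_fst).continuousOn
  have cdX : ContinuousOn (fun p : ℝ × ℝ => deriv X.deltaX p.2) (X.closedBox R) :=
    ((contDiff_deltaX.continuous_deriv (by simp)).comp continuous_snd).continuousOn
  set P : ℝ × ℝ → ℝ := fun p => (X.deltaR p.1 * fr p + X.kH R p.1 * w p) * φ p with hP
  set Pr : ℝ × ℝ → ℝ := fun p => (deriv X.deltaR p.1 * fr p + X.deltaR p.1 * frr p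
    + (X.dkH R p.1 * w p + X.kH R p.1 * wr p)) * φ p
    + (X.deltaR p.1 * fr p + X.kH R p.1 * w p) * φr p with hPr
  set Q : ℝ × ℝ → ℝ := fun p => X.deltaX p.2 * fx p * φ p with hQ
  set Qx : ℝ × ℝ → ℝ := fun p => (deriv X.deltaX p.2 * fx p + X.deltaX p.2 * fxx p) * φ p
    + X.deltaX p.2 * fx p * φx p with hQx
  have cP : ContinuousOn P (X.closedBox R) := by fun_prop
  have cPr : ContinuousOn Pr (X.closedBox R) := by fun_prop
  have cQ : ContinuousOn Q (X.closedBox R) := by fun_prop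
  have cQx : ContinuousOn Qx (X.closedBox R) := by fun_prop
  have dP : ∀ p ∈ X.openBox R, HasDerivAt (fun r => P (r, p.2)) (Pr p) p.1 := by
    intro p hp
    have hpi := hos hp
    have d1 := hasDerivAt_fst h.smooth_r hpi
    have d2 := hasDerivAt_fst h.smooth_w hpi
    rw [hfrr' p hpi] at d1
    rw [h.deriv_w p hpi] at d2
    exact (((hasDerivAt_deltaR p.1).mul d1).add ((hX.hasDerivAt_kH R hpi.1).mul d2)).mul
      (hdr p hp)
  have dQ : ∀ p ∈ X.openBox R, HasDerivAt (fun x => Q (p.1, x)) (Qx p) p.2 := by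
    intro p hp
    have hpi := hos hp
    have d1 := hasDerivAt_snd h.smooth_x hpi
    rw [hfxx' p hpi] at d1
    exact ((hasDerivAt_deltaX p.2).mul d1).mul (hdx p hp)
  have iP := setIntegral_rect_deriv_fst hR.lt.le cP cPr dP
  have iQ := setIntegral_rect_deriv_snd hX.xl_lt_xu.le cQ cQx dQ
  -- At the horizon both Δ_r and `kH` vanish; at r = R, `kH` equals H, so the flux is exactly the
  -- boundary expression that `hbc` annihilates.
  have zP : ∫ x in Ioo X.xl X.xu, (P (R, x) - P (X.rh, x)) = 0 := by
    refine setIntegral_eq_zero_of_forall_eq_zero fun x hx => ?_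
    have h0 : X.deltaR X.rh = 0 := (hX.horizon X.rh (by
      unfold horizons
      split <;> simp)).1
    have hk1 : X.kH R R = X.H R := by
      unfold kH
      rw [div_self (sub_pos.2 hR.lt).ne', one_mul]
    have hk0 : X.kH R X.rh = 0 := by simp [kH]
    simp only [hP, h0, hk0, hk1, hbc x (Ioo_subset_Icc_self hx)]
    ring
  -- The angular flux carries the factor Δ_x, which vanishes at both axes.
  have zQ : ∫ r in Ioo X.rh R, (Q (r, X.xu) - Q (r, X.xl)) = 0 := by
    refine setIntegral_eq_zero_of_forall_eq_zero fun r hr => ?_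
    simp only [hQ, hl, hu]
    ring
  rw [zP] at iP
  rw [zQ] at iQ
  have hsum : ∫ p in X.openBox R, (Pr p + Qx p) = 0 := by
    rw [integral_add (integrableOn_openBox cPr) (integrableOn_openBox cQx)]
    change (∫ p in Ioo X.rh R ×ˢ Ioo X.xl X.xu, Pr p)
      + ∫ p in Ioo X.rh R ×ˢ Ioo X.xl X.xu, Qx p = 0
    rw [iP, iQ, add_zero]
  rw [← hsum]
  refine setIntegral_congr_fun (measurableSet_openBox R) fun p hp => ?_
  have hpi := hos hp
  have he := h.eqn p hpi
  rw [hfrr' p hpi, hfxx' p hpi, ← dH_eq hpi.1] at he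
  simp only [smul_eq_mul] at he
  simp only [hPr, hQx]
  linear_combination (-φ p) * he

end Exterior

/-! ### A Poincaré inequality on rectangles -/

theorem enorm_sub_sq_le_lintegral {a b : ℝ} {g g' : ℝ → ℂ}
    (hg : ∀ r ∈ Icc a b, HasDerivAt g (g' r) r) (hg' : ContinuousOn g' (Icc a b)) {s t : ℝ}
    (hs : s ∈ Icc a b) (ht : t ∈ Icc a b) :
    ‖g s - g t‖ₑ ^ 2 ≤ ENNReal.ofReal (b - a) * ∫⁻ r in Icc a b, ‖g' r‖ₑ ^ 2 := by
  have hsub : uIcc t s ⊆ Icc a b := (uIcc_subset_Icc ht hs)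
  have h1 : ∫ r in t..s, g' r = g s - g t :=
    intervalIntegral.integral_eq_sub_of_hasDerivAt (fun r hr => hg r (hsub hr))
      (ContinuousOn.intervalIntegrable (hg'.mono hsub))
  have h2 : ‖g s - g t‖ₑ ≤ ∫⁻ r in Icc a b, ‖g' r‖ₑ * 1 := by
    rw [← h1]
    have h3 : ‖∫ r in t..s, g' r‖ₑ = ‖∫ r in uIoc t s, g' r‖ₑ := by
      rw [← ofReal_norm, intervalIntegral.norm_intervalIntegral_eq, ofReal_norm]
    rw [h3]
    simp only [mul_one]
    exact (enorm_integral_le_lintegral_enorm _).trans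
      (lintegral_mono_set (uIoc_subset_uIcc.trans hsub))
  have hm : AEMeasurable (fun r => ‖g' r‖ₑ) (volume.restrict (Icc a b)) :=
    (hg'.aestronglyMeasurable measurableSet_Icc).enorm
  have h4 := ENNReal.lintegral_mul_le_Lp_mul_Lq (volume.restrict (Icc a b))
    Real.HolderConjugate.two_two hm (aemeasurable_const (b := (1 : ℝ≥0∞)))
  have h5 := pow_le_pow_left₀ zero_le (h2.trans h4) 2
  refine h5.trans (le_of_eq ?_)
  simp only [ENNReal.rpow_ofNat, one_pow, lintegral_const, one_mul, Measure.restrict_apply_univ,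
    Real.volume_Icc]
  rw [mul_pow, ← ENNReal.rpow_natCast, ← ENNReal.rpow_mul, ← ENNReal.rpow_natCast,
    ← ENNReal.rpow_mul]
  norm_num
  rw [mul_comm]

theorem lintegral_rect_fst {a b c d : ℝ} {A : ℝ → ℝ≥0∞} (hA : Measurable A) :
    ∫⁻ p in Icc a b ×ˢ Icc c d, A p.1 = ENNReal.ofReal (d - c) * ∫⁻ r in Icc a b, A r := by
  rw [Measure.volume_eq_prod, ← Measure.prod_restrict, lintegral_prod _ (by fun_prop)]
  simp only [lintegral_const, Measure.restrict_apply_univ, Real.volume_Icc]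
  rw [lintegral_mul_const _ hA, mul_comm]

theorem lintegral_rect_snd {a b c d : ℝ} {A : ℝ → ℝ≥0∞} (hA : Measurable A) :
    ∫⁻ p in Icc a b ×ˢ Icc c d, A p.2 = ENNReal.ofReal (b - a) * ∫⁻ x in Icc c d, A x := by
  rw [Measure.volume_eq_prod, ← Measure.prod_restrict, lintegral_prod _ (by fun_prop)]
  simp only [lintegral_const, Measure.restrict_apply_univ, Real.volume_Icc]
  rw [mul_comm]

/-- A Poincaré inequality in terms of differences. -/
theorem poincare_rect (a b c d : ℝ) : ∃ K : ℝ≥0, ∀ f fr fx : ℝ × ℝ → ℂ,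
    (∀ p ∈ Icc a b ×ˢ Icc c d, HasDerivAt (fun r => f (r, p.2)) (fr p) p.1) →
    (∀ p ∈ Icc a b ×ˢ Icc c d, HasDerivAt (fun x => f (p.1, x)) (fx p) p.2) →
    ContinuousOn fr (Icc a b ×ˢ Icc c d) → ContinuousOn fx (Icc a b ×ˢ Icc c d) →
    ∫⁻ p in Icc a b ×ˢ Icc c d, ∫⁻ q in Icc a b ×ˢ Icc c d, ‖f p - f q‖ₑ ^ 2
      ≤ K * ∫⁻ p in Icc a b ×ˢ Icc c d, (‖fr p‖ₑ ^ 2 + ‖fx p‖ₑ ^ 2) := by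
  set Q := Icc a b ×ˢ Icc c d with hQ
  have hQm : MeasurableSet Q := measurableSet_Icc.prod measurableSet_Icc
  set L₁ := ENNReal.ofReal (b - a) with hL₁
  set L₂ := ENNReal.ofReal (d - c) with hL₂
  have hvol : (volume : Measure (ℝ × ℝ)) Q = L₁ * L₂ := by
    rw [hQ, Measure.volume_eq_prod, Measure.prod_prod, Real.volume_Icc, Real.volume_Icc]
  refine ⟨(2 * L₁ * L₁ * (L₁ * L₂) + 2 * L₂ * L₂ * (L₁ * L₂)).toNNReal,
    fun f fr fx hfr hfx cfr cfx => ?_⟩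
  have hKtop : (2 * L₁ * L₁ * (L₁ * L₂) + 2 * L₂ * L₂ * (L₁ * L₂)) ≠ ⊤ := by
    have h1 : L₁ ≠ ⊤ := ENNReal.ofReal_ne_top
    have h2 : L₂ ≠ ⊤ := ENNReal.ofReal_ne_top
    finiteness
  rw [ENNReal.coe_toNNReal hKtop]
  have hmeas : ∀ {g : ℝ × ℝ → ℂ}, ContinuousOn g Q →
      Measurable (Q.indicator fun p => ‖g p‖ₑ ^ 2) := by
    intro g hg
    have : ContinuousOn (fun p => ‖g p‖ₑ ^ 2) Q :=
      (ENNReal.continuous_pow 2).comp_continuousOn (continuous_enorm.comp_continuousOn hg)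
    have h := this.measurable_piecewise (g := (0 : ℝ × ℝ → ℝ≥0∞)) continuousOn_const hQm
    rwa [piecewise_eq_indicator] at h
  -- Extension by zero gives functions measurable on the whole plane, as needed for Tonelli; fr and
  -- fx are only known to be continuous on Q.
  set α := Q.indicator fun p => ‖fr p‖ₑ ^ 2 with hα
  set β := Q.indicator fun p => ‖fx p‖ₑ ^ 2 with hβ
  have mα : Measurable α := hmeas cfr
  have mβ : Measurable β := hmeas cfx
  set A : ℝ → ℝ≥0∞ := fun x => ∫⁻ r in Icc a b, α (r, x) with hA
  set B : ℝ → ℝ≥0∞ := fun r => ∫⁻ x in Icc c d, β (r, x) with hB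
  have mA : Measurable A := mα.lintegral_prod_left'
  have mB : Measurable B := mβ.lintegral_prod_right'
  -- The points are joined through the corner (q.1, p.2): the radial leg is bounded by a function of
  -- p.2 alone, the angular leg by a function of q.1 alone.
  have hpt : ∀ p ∈ Q, ∀ q ∈ Q, ‖f p - f q‖ₑ ^ 2 ≤ 2 * L₁ * A p.2 + 2 * L₂ * B q.1 := by
    intro p hp q hq
    have h1 := enorm_sub_sq_le_lintegral (g := fun r => f (r, p.2)) (g' := fun r => fr (r, p.2))
      (fun r hr => hfr (r, p.2) ⟨hr, hp.2⟩)
      (cfr.comp (by fun_prop) fun r hr => ⟨hr, hp.2⟩) hp.1 hq.1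
    have h2 := enorm_sub_sq_le_lintegral (g := fun x => f (q.1, x)) (g' := fun x => fx (q.1, x))
      (fun x hx => hfx (q.1, x) ⟨hq.1, hx⟩)
      (cfx.comp (by fun_prop) fun x hx => ⟨hq.1, hx⟩) hp.2 hq.2
    have e1 : ∫⁻ r in Icc a b, ‖fr (r, p.2)‖ₑ ^ 2 = A p.2 :=
      setLIntegral_congr_fun measurableSet_Icc fun r hr => by
        rw [hα, indicator_of_mem (show (r, p.2) ∈ Q from ⟨hr, hp.2⟩)]
    have e2 : ∫⁻ x in Icc c d, ‖fx (q.1, x)‖ₑ ^ 2 = B q.1 :=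
      setLIntegral_congr_fun measurableSet_Icc fun x hx => by
        rw [hβ, indicator_of_mem (show (q.1, x) ∈ Q from ⟨hq.1, hx⟩)]
    rw [e1] at h1
    rw [e2] at h2
    have h3 : ‖f p - f q‖ₑ ≤ ‖f (p.1, p.2) - f (q.1, p.2)‖ₑ + ‖f (q.1, p.2) - f (q.1, q.2)‖ₑ := by
      have : f p - f q = (f (p.1, p.2) - f (q.1, p.2)) + (f (q.1, p.2) - f (q.1, q.2)) := by ring
      rw [this]
      exact enorm_add_le _ _
    calc ‖f p - f q‖ₑ ^ 2 ≤ _ := pow_le_pow_left₀ zero_le h3 2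
      _ ≤ _ := ennreal_add_sq_le _ _
      _ ≤ 2 * (L₁ * A p.2 + L₂ * B q.1) := by gcongr
      _ = _ := by ring
  have iA : ∫⁻ x in Icc c d, A x = ∫⁻ p in Q, ‖fr p‖ₑ ^ 2 := by
    have : ∫⁻ p in Q, ‖fr p‖ₑ ^ 2 = ∫⁻ p in Q, α p :=
      setLIntegral_congr_fun hQm fun p hp => by rw [hα, indicator_of_mem hp]
    rw [this, hQ, Measure.volume_eq_prod, ← Measure.prod_restrict,
      lintegral_prod_symm' _ mα]
  have iB : ∫⁻ r in Icc a b, B r = ∫⁻ p in Q, ‖fx p‖ₑ ^ 2 := by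
    have : ∫⁻ p in Q, ‖fx p‖ₑ ^ 2 = ∫⁻ p in Q, β p :=
      setLIntegral_congr_fun hQm fun p hp => by rw [hβ, indicator_of_mem hp]
    rw [this, hQ, Measure.volume_eq_prod, ← Measure.prod_restrict,
      lintegral_prod _ mβ.aemeasurable]
  have mA2 : Measurable fun p : ℝ × ℝ => A p.2 := mA.comp measurable_snd
  have mB1 : Measurable fun p : ℝ × ℝ => B p.1 := mB.comp measurable_fst
  calc ∫⁻ p in Q, ∫⁻ q in Q, ‖f p - f q‖ₑ ^ 2
      ≤ ∫⁻ p in Q, ∫⁻ q in Q, (2 * L₁ * A p.2 + 2 * L₂ * B q.1) :=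
        setLIntegral_mono' hQm fun p hp => setLIntegral_mono' hQm fun q hq => hpt p hp q hq
    _ = 2 * L₁ * L₁ * (L₁ * L₂) * (∫⁻ p in Q, ‖fr p‖ₑ ^ 2)
          + 2 * L₂ * L₂ * (L₁ * L₂) * ∫⁻ p in Q, ‖fx p‖ₑ ^ 2 := by
        have inner_eq : ∀ p : ℝ × ℝ, ∫⁻ q in Q, (2 * L₁ * A p.2 + 2 * L₂ * B q.1) =
            2 * L₁ * A p.2 * (L₁ * L₂) + 2 * L₂ * (L₂ * ∫⁻ p in Q, ‖fx p‖ₑ ^ 2) := by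
          intro p
          rw [lintegral_add_left measurable_const, setLIntegral_const, hvol,
            lintegral_const_mul _ mB1, hQ, lintegral_rect_fst mB, iB]
        simp_rw [inner_eq]
        rw [lintegral_add_right _ measurable_const, setLIntegral_const, hvol,
          lintegral_mul_const _ (by fun_prop), lintegral_const_mul _ mA2]
        nth_rewrite 1 [hQ]
        rw [lintegral_rect_snd mA, iA]
        ring
    _ ≤ (2 * L₁ * L₁ * (L₁ * L₂) + 2 * L₂ * L₂ * (L₁ * L₂)) * (∫⁻ p in Q, ‖fr p‖ₑ ^ 2)
          + (2 * L₁ * L₁ * (L₁ * L₂) + 2 * L₂ * L₂ * (L₁ * L₂)) * ∫⁻ p in Q, ‖fx p‖ₑ ^ 2 := by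
        gcongr
        · exact le_self_add
        · exact le_add_self
    _ = _ := by
        rw [← mul_add, lintegral_add_left']
        exact ((cfr.aestronglyMeasurable hQm).enorm).pow_const 2

namespace Exterior

variable {X : Exterior}

/-! ### Energy and flux identities on a slice -/

theorem exists_bound_closedBox {R : ℝ} {g : ℝ × ℝ → ℝ} (hg : ContinuousOn g (X.closedBox R)) :
    ∃ B : ℝ, 0 ≤ B ∧ ∀ p ∈ X.openBox R, |g p| ≤ B := by
  obtain ⟨B, hB⟩ := (isCompact_Icc.prod isCompact_Icc).exists_bound_of_continuousOn hg
  exact ⟨max B 0, le_max_right _ _, fun p hp => (hB p (prod_mono Ioo_subset_Icc_self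
    Ioo_subset_Icc_self hp)).trans (le_max_left _ _)⟩

/-- A Caccioppoli estimate: the equation is tested against (α + βr)² f. The boundary term at R
vanishes either by the Neumann law or because the weight does; only the derivative of the weight
produces the term with β². -/
theorem BH1.real_energy_bound (hX : X.BH1) (hl : X.deltaX X.xl = 0) (hu : X.deltaX X.xu = 0)
    {R : ℝ} (hR : X.InnerRadius R) (α β : ℝ) : ∃ C : ℝ, 0 ≤ C ∧
    ∀ f fr fx w wr y : ℝ × ℝ → ℝ, X.TimeSlice f fr fx w wr y →
      (X.outer = .wall R (.robin 0 0) ∨ α + β * R = 0) →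
      ∫ p in X.openBox R, (α + β * p.1) ^ 2 * (X.deltaR p.1 * fr p ^ 2 + X.deltaX p.2 * fx p ^ 2)
        ≤ 4 * β ^ 2 * (∫ p in X.openBox R, X.deltaR p.1 * f p ^ 2)
          + C * ∫ p in X.openBox R, (|w p| + |wr p| + |y p|) * (|f p| + |fr p|) := by
  have hbs := hR.box_subset
  have hos := hR.openBox_subset
  have cH := hR.continuousOn_fst hX.H_smooth.continuousOn
  have cdH := hR.continuousOn_fst hX.continuousOn_dH
  have ck := hR.continuousOn_fst (hX.continuousOn_kH R)
  have cdk := hR.continuousOn_fst (hX.continuousOn_dkH R)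
  have cN := hX.N_smooth.continuousOn.mono hbs
  have cD := continuousOn_deltaR_fst (X := X) (X.closedBox R)
  have cX := continuousOn_deltaX_snd (X := X) (X.closedBox R)
  obtain ⟨B₁, hB₁, b₁⟩ := exists_bound_closedBox (X := X) (R := R)
    (g := fun p => (X.dkH R p.1 - X.dH p.1) * (α + β * p.1) ^ 2) (by fun_prop)
  obtain ⟨B₂, hB₂, b₂⟩ := exists_bound_closedBox (X := X) (R := R)
    (g := fun p => (X.kH R p.1 - 2 * X.H p.1) * (α + β * p.1) ^ 2) (by fun_prop)
  obtain ⟨B₃, hB₃, b₃⟩ := exists_bound_closedBox (X := X) (R := R)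
    (g := fun p => X.N p * (α + β * p.1) ^ 2) (by fun_prop)
  obtain ⟨B₄, hB₄, b₄⟩ := exists_bound_closedBox (X := X) (R := R)
    (g := fun p => X.kH R p.1 * (2 * (α + β * p.1) * β)) (by fun_prop)
  obtain ⟨B₅, hB₅, b₅⟩ := exists_bound_closedBox (X := X) (R := R)
    (g := fun p => X.kH R p.1 * (α + β * p.1) ^ 2) (by fun_prop)
  set C := B₁ + B₂ + B₃ + B₄ + B₅ with hC
  refine ⟨2 * C, by positivity, fun f fr fx w wr y h hbc => ?_⟩
  have cf := h.smooth.continuousOn.mono hbs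
  have cfr := h.smooth_r.continuousOn.mono hbs
  have cfx := h.smooth_x.continuousOn.mono hbs
  have cw := h.smooth_w.continuousOn.mono hbs
  have cwr := h.smooth_wr.continuousOn.mono hbs
  have cy := h.smooth_y.continuousOn.mono hbs
  set φ : ℝ × ℝ → ℝ := fun p => (α + β * p.1) ^ 2 * f p with hφ
  set φr : ℝ × ℝ → ℝ := fun p => 2 * (α + β * p.1) * β * f p + (α + β * p.1) ^ 2 * fr p with hφr
  set φx : ℝ × ℝ → ℝ := fun p => (α + β * p.1) ^ 2 * fx p with hφx
  have hweak := hX.weak_form hl hu hR h (φ := φ) (φr := φr) (φx := φx) (by fun_prop)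
    (by fun_prop) (by fun_prop) (fun p hp => by
      have d1 := hasDerivAt_fst h.smooth (hos hp)
      rw [h.deriv_r p (hos hp)] at d1
      have d2 : HasDerivAt (fun r => (α + β * r) ^ 2) (2 * (α + β * p.1) * β) p.1 := by
        have d3 : HasDerivAt (fun r => α + β * r) (β * 1) p.1 :=
          ((hasDerivAt_id p.1).const_mul β).const_add α
        exact (d3.fun_pow 2).congr_deriv (by push_cast; ring)
      exact d2.mul d1) (fun p hp => by
      have d1 := hasDerivAt_snd h.smooth (hos hp)
      rw [h.deriv_x p (hos hp)] at d1
      exact d1.const_mul ((α + β * p.1) ^ 2)) (fun x hx => by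
      rcases hbc with hw | h0
      · have := h.neumann R hw x hx
        simp only [smul_eq_mul] at this
        rw [this, zero_mul]
      · simp [hφ, h0])
  set G : ℝ × ℝ → ℝ := fun p => ((X.dkH R p.1 - X.dH p.1) * w p
    + (X.kH R p.1 - 2 * X.H p.1) * wr p + X.N p * y p) * φ p
    + (X.deltaR p.1 * fr p + X.kH R p.1 * w p) * φr p + X.deltaX p.2 * fx p * φx p with hG
  have cG : ContinuousOn G (X.closedBox R) := by fun_prop
  have hpt : ∀ p ∈ X.openBox R,
      1 / 2 * ((α + β * p.1) ^ 2 * (X.deltaR p.1 * fr p ^ 2 + X.deltaX p.2 * fx p ^ 2)) ≤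
        G p + (2 * β ^ 2 * (X.deltaR p.1 * f p ^ 2)
          + C * ((|w p| + |wr p| + |y p|) * (|f p| + |fr p|))) := by
    intro p hp
    have hD : 0 ≤ X.deltaR p.1 := (hX.deltaR_pos p.1 (hos hp).1).le
    have hXx : 0 ≤ X.deltaX p.2 := (hX.deltaX_pos p.2 (hos hp).2).le
    set c := α + β * p.1 with hc
    have e1 : G p = c ^ 2 * (X.deltaR p.1 * fr p ^ 2 + X.deltaX p.2 * fx p ^ 2)
        + 2 * c * β * X.deltaR p.1 * f p * fr p
        + ((X.dkH R p.1 - X.dH p.1) * c ^ 2 * (w p * f p)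
          + (X.kH R p.1 - 2 * X.H p.1) * c ^ 2 * (wr p * f p) + X.N p * c ^ 2 * (y p * f p)
          + X.kH R p.1 * (2 * c * β) * (w p * f p) + X.kH R p.1 * c ^ 2 * (w p * fr p)) := by
      simp only [hG, hφ, hφr, hφx, ← hc]
      ring
    have hmul : ∀ {g B a b A A' : ℝ}, |g| ≤ B → |a| ≤ A → |b| ≤ A' → 0 ≤ B → 0 ≤ A →
        -(B * (A * A')) ≤ g * (a * b) := by
      intro g B a b A A' h1 h2 h3 hB hA
      have : |g * (a * b)| ≤ B * (A * A') := by
        rw [abs_mul, abs_mul]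
        gcongr
      exact (abs_le.1 this).1
    set S := |w p| + |wr p| + |y p| with hS
    set S' := |f p| + |fr p| with hS'
    have hS0 : 0 ≤ S := by positivity
    have w1 : |w p| ≤ S := by linarith [abs_nonneg (wr p), abs_nonneg (y p)]
    have w2 : |wr p| ≤ S := by linarith [abs_nonneg (w p), abs_nonneg (y p)]
    have w3 : |y p| ≤ S := by linarith [abs_nonneg (w p), abs_nonneg (wr p)]
    have f1 : |f p| ≤ S' := by linarith [abs_nonneg (fr p)]
    have f2 : |fr p| ≤ S' := by linarith [abs_nonneg (f p)]
    have m1 := hmul (b₁ p hp) w1 f1 hB₁ hS0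
    have m2 := hmul (b₂ p hp) w2 f1 hB₂ hS0
    have m3 := hmul (b₃ p hp) w3 f1 hB₃ hS0
    have m4 := hmul (b₄ p hp) w1 f1 hB₄ hS0
    have m5 := hmul (b₅ p hp) w1 f2 hB₅ hS0
    -- Completing the square absorbs the cross term 2cβΔ_r f f_r into half of the energy and the
    -- term 2β²Δ_r f².
    have m6 : 0 ≤ X.deltaR p.1 * (c * fr p + 2 * β * f p) ^ 2 := by positivity
    have m7 : 0 ≤ X.deltaX p.2 * (c * fx p) ^ 2 := by positivity
    have e2 : C * (S * S') = B₁ * (S * S') + B₂ * (S * S') + B₃ * (S * S') + B₄ * (S * S')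
        + B₅ * (S * S') := by rw [hC]; ring
    have e3 : 1 / 2 * (X.deltaR p.1 * (c * fr p + 2 * β * f p) ^ 2)
          + 1 / 2 * (X.deltaX p.2 * (c * fx p) ^ 2)
        = 1 / 2 * (c ^ 2 * (X.deltaR p.1 * fr p ^ 2 + X.deltaX p.2 * fx p ^ 2))
          + 2 * c * β * X.deltaR p.1 * f p * fr p + 2 * β ^ 2 * (X.deltaR p.1 * f p ^ 2) := by
      ring
    rw [e1, e2]
    linarith only [m1, m2, m3, m4, m5, m6, m7, e3]
  have i1 := integrableOn_openBox (X := X) (R := R) (g := fun p =>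
    (α + β * p.1) ^ 2 * (X.deltaR p.1 * fr p ^ 2 + X.deltaX p.2 * fx p ^ 2)) (by fun_prop)
  have i2 := integrableOn_openBox (X := X) (R := R)
    (g := fun p => X.deltaR p.1 * f p ^ 2) (by fun_prop)
  have i3 := integrableOn_openBox (X := X) (R := R)
    (g := fun p => (|w p| + |wr p| + |y p|) * (|f p| + |fr p|)) (by fun_prop)
  have i4 : IntegrableOn (fun p => 2 * β ^ 2 * (X.deltaR p.1 * f p ^ 2)
      + C * ((|w p| + |wr p| + |y p|) * (|f p| + |fr p|))) (X.openBox R) :=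
    (i2.const_mul (2 * β ^ 2)).add (i3.const_mul C)
  have hmono := setIntegral_mono_on (i1.const_mul (1 / 2)) ((integrableOn_openBox cG).add i4)
    (measurableSet_openBox R) hpt
  have hsplit : ∫ p in X.openBox R, (G p + (2 * β ^ 2 * (X.deltaR p.1 * f p ^ 2)
          + C * ((|w p| + |wr p| + |y p|) * (|f p| + |fr p|))))
      = 0 + (2 * β ^ 2 * (∫ p in X.openBox R, X.deltaR p.1 * f p ^ 2)
        + C * ∫ p in X.openBox R, (|w p| + |wr p| + |y p|) * (|f p| + |fr p|)) := by
    rw [integral_add (integrableOn_openBox cG) i4,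
      integral_add (i2.const_mul (2 * β ^ 2)) (i3.const_mul C), integral_const_mul,
      integral_const_mul, hweak]
  simp only [Pi.add_apply] at hmono
  rw [integral_const_mul] at hmono
  have hmono' := hmono.trans (le_of_eq hsplit)
  linarith

theorem norm_sq_eq_re_im (z : ℂ) : ‖z‖ ^ 2 = Complex.reCLM z ^ 2 + Complex.imCLM z ^ 2 := by
  rw [Complex.sq_norm, Complex.normSq_apply, Complex.reCLM_apply, Complex.imCLM_apply]
  ring

/-- The real bound for real and imaginary parts, with Young's inequality on the error. The free
parameter δ will be matched to the size of w, w_r and y. -/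
theorem BH1.energy_bound (hX : X.BH1) (hl : X.deltaX X.xl = 0) (hu : X.deltaX X.xu = 0)
    {R : ℝ} (hR : X.InnerRadius R) (α β : ℝ) : ∃ C : ℝ, 0 ≤ C ∧
    ∀ f fr fx w wr y : ℝ × ℝ → ℂ, X.TimeSlice f fr fx w wr y →
      (X.outer = .wall R (.robin 0 0) ∨ α + β * R = 0) → ∀ δ > 0,
      ∫ p in X.openBox R,
          (α + β * p.1) ^ 2 * (X.deltaR p.1 * ‖fr p‖ ^ 2 + X.deltaX p.2 * ‖fx p‖ ^ 2)
        ≤ 4 * β ^ 2 * (∫ p in X.openBox R, X.deltaR p.1 * ‖f p‖ ^ 2)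
          + C * (δ * (∫ p in X.openBox R, (‖f p‖ ^ 2 + ‖fr p‖ ^ 2))
            + δ⁻¹ * ∫ p in X.openBox R, (‖w p‖ ^ 2 + ‖wr p‖ ^ 2 + ‖y p‖ ^ 2)) := by
  obtain ⟨C, hC, hbound⟩ := hX.real_energy_bound hl hu hR α β
  refine ⟨3 * C, by positivity, fun f fr fx w wr y h hbc δ hδ => ?_⟩
  have hbs := hR.box_subset
  have cD := continuousOn_deltaR_fst (X := X) (X.closedBox R)
  have cX := continuousOn_deltaX_snd (X := X) (X.closedBox R)
  have cf := h.smooth.continuousOn.mono hbs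
  have cfr := h.smooth_r.continuousOn.mono hbs
  have cfx := h.smooth_x.continuousOn.mono hbs
  have cw := h.smooth_w.continuousOn.mono hbs
  have cwr := h.smooth_wr.continuousOn.mono hbs
  have cy := h.smooth_y.continuousOn.mono hbs
  have key : ∀ L : ℂ →L[ℝ] ℝ,
      ∫ p in X.openBox R,
          (α + β * p.1) ^ 2 * (X.deltaR p.1 * L (fr p) ^ 2 + X.deltaX p.2 * L (fx p) ^ 2)
        ≤ 4 * β ^ 2 * (∫ p in X.openBox R, X.deltaR p.1 * L (f p) ^ 2)
          + 3 * C * (δ * (∫ p in X.openBox R, (L (f p) ^ 2 + L (fr p) ^ 2))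
            + δ⁻¹ * ∫ p in X.openBox R, (L (w p) ^ 2 + L (wr p) ^ 2 + L (y p) ^ 2)) := by
    intro L
    refine (hbound _ _ _ _ _ _ (h.map L) hbc).trans ?_
    have lc : ∀ {g : ℝ × ℝ → ℂ}, ContinuousOn g (X.closedBox R) →
        ContinuousOn (fun p => L (g p)) (X.closedBox R) := fun hg =>
      L.continuous.comp_continuousOn hg
    have lf := lc cf
    have lfr := lc cfr
    have lw := lc cw
    have lwr := lc cwr
    have ly := lc cy
    have i1 := integrableOn_openBox (X := X) (R := R)
      (g := fun p => L (f p) ^ 2 + L (fr p) ^ 2) (by fun_prop)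
    have i2 := integrableOn_openBox (X := X) (R := R)
      (g := fun p => L (w p) ^ 2 + L (wr p) ^ 2 + L (y p) ^ 2) (by fun_prop)
    have i3 := integrableOn_openBox (X := X) (R := R)
      (g := fun p => (|L (w p)| + |L (wr p)| + |L (y p)|) * (|L (f p)| + |L (fr p)|))
      (by fun_prop)
    have hm := setIntegral_mono_on i3 ((i1.const_mul (3 * δ)).add (i2.const_mul (3 * δ⁻¹)))
      (measurableSet_openBox R) (fun p _ => by
        have e := fun z : ℝ => sq_abs z
        simp only [Pi.add_apply]
        rw [← e (L (f p)), ← e (L (fr p)), ← e (L (w p)), ← e (L (wr p)), ← e (L (y p))]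
        generalize |L (f p)| = a
        generalize |L (fr p)| = b
        generalize |L (w p)| = c
        generalize |L (wr p)| = d
        generalize |L (y p)| = e
        have hi : δ * δ⁻¹ = 1 := mul_inv_cancel₀ hδ.ne'
        have hi0 : 0 < δ⁻¹ := inv_pos.2 hδ
        have hq : ∀ s t : ℝ, s * t ≤ δ * t ^ 2 + δ⁻¹ * s ^ 2 := by
          intro s t
          have h1 : 0 ≤ δ⁻¹ * (s - δ * t) ^ 2 := by positivity
          have h2 : δ⁻¹ * (s - δ * t) ^ 2
              = δ⁻¹ * s ^ 2 - 2 * (δ * δ⁻¹) * (s * t) + (δ * δ⁻¹) * (δ * t ^ 2) := by ring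
          rw [h2, hi] at h1
          have h3 : 0 ≤ δ * t ^ 2 := by positivity
          have h4 : 0 ≤ δ⁻¹ * s ^ 2 := by positivity
          linarith
        have h1 := hq c a
        have h2 := hq c b
        have h3 := hq d a
        have h4 := hq d b
        have h5 := hq e a
        have h6 := hq e b
        have h7 : 0 ≤ δ⁻¹ * c ^ 2 := by positivity
        have h8 : 0 ≤ δ⁻¹ * d ^ 2 := by positivity
        have h9 : 0 ≤ δ⁻¹ * e ^ 2 := by positivity
        nlinarith)
    simp only [Pi.add_apply] at hm
    rw [integral_add (i1.const_mul (3 * δ)) (i2.const_mul (3 * δ⁻¹)), integral_const_mul,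
      integral_const_mul] at hm
    have := mul_le_mul_of_nonneg_left hm hC
    linarith
  have hre := key Complex.reCLM
  have him := key Complex.imCLM
  have lre : ∀ {g : ℝ × ℝ → ℂ}, ContinuousOn g (X.closedBox R) →
      ContinuousOn (fun p => Complex.reCLM (g p)) (X.closedBox R) := fun hg =>
    Complex.reCLM.continuous.comp_continuousOn hg
  have lim : ∀ {g : ℝ × ℝ → ℂ}, ContinuousOn g (X.closedBox R) →
      ContinuousOn (fun p => Complex.imCLM (g p)) (X.closedBox R) := fun hg =>
    Complex.imCLM.continuous.comp_continuousOn hg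
  have rf := lre cf
  have rfr := lre cfr
  have rfx := lre cfx
  have rw' := lre cw
  have rwr := lre cwr
  have ry := lre cy
  have jf := lim cf
  have jfr := lim cfr
  have jfx := lim cfx
  have jw := lim cw
  have jwr := lim cwr
  have jy := lim cy
  have split : ∀ {g h k : ℝ × ℝ → ℝ}, ContinuousOn g (X.closedBox R) →
      ContinuousOn h (X.closedBox R) → (∀ p, k p = g p + h p) →
      ∫ p in X.openBox R, k p = (∫ p in X.openBox R, g p) + ∫ p in X.openBox R, h p := by
    intro g h k hg hh hk
    rw [← integral_add (integrableOn_openBox hg) (integrableOn_openBox hh)]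
    exact integral_congr_ae (Eventually.of_forall hk)
  have s1 := split (k := fun p => (α + β * p.1) ^ 2 *
      (X.deltaR p.1 * ‖fr p‖ ^ 2 + X.deltaX p.2 * ‖fx p‖ ^ 2))
    (g := fun p => (α + β * p.1) ^ 2 * (X.deltaR p.1 * Complex.reCLM (fr p) ^ 2
      + X.deltaX p.2 * Complex.reCLM (fx p) ^ 2))
    (h := fun p => (α + β * p.1) ^ 2 * (X.deltaR p.1 * Complex.imCLM (fr p) ^ 2
      + X.deltaX p.2 * Complex.imCLM (fx p) ^ 2)) (by fun_prop) (by fun_prop)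
    (fun p => by simp only [norm_sq_eq_re_im]; ring)
  have s2 := split (k := fun p => X.deltaR p.1 * ‖f p‖ ^ 2)
    (g := fun p => X.deltaR p.1 * Complex.reCLM (f p) ^ 2)
    (h := fun p => X.deltaR p.1 * Complex.imCLM (f p) ^ 2) (by fun_prop) (by fun_prop)
    (fun p => by simp only [norm_sq_eq_re_im]; ring)
  have s3 := split (k := fun p => ‖f p‖ ^ 2 + ‖fr p‖ ^ 2)
    (g := fun p => Complex.reCLM (f p) ^ 2 + Complex.reCLM (fr p) ^ 2)
    (h := fun p => Complex.imCLM (f p) ^ 2 + Complex.imCLM (fr p) ^ 2) (by fun_prop) (by fun_prop)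
    (fun p => by simp only [norm_sq_eq_re_im]; ring)
  have s4 := split (k := fun p => ‖w p‖ ^ 2 + ‖wr p‖ ^ 2 + ‖y p‖ ^ 2)
    (g := fun p => Complex.reCLM (w p) ^ 2 + Complex.reCLM (wr p) ^ 2 + Complex.reCLM (y p) ^ 2)
    (h := fun p => Complex.imCLM (w p) ^ 2 + Complex.imCLM (wr p) ^ 2 + Complex.imCLM (y p) ^ 2)
    (by fun_prop) (by fun_prop) (fun p => by simp only [norm_sq_eq_re_im]; ring)
  rw [s1, s2, s3, s4]
  refine (add_le_add hre him).trans (le_of_eq ?_)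
  ring

/-- Testing against the constant 1 gives an identity that is linear in w. Replacing w by w - z moves
z to the other side with the total horizon flux as coefficient, which is nonzero because H = r_h² +
a² there. -/
theorem BH1.real_flux_bound (hX : X.BH1) (hl : X.deltaX X.xl = 0) (hu : X.deltaX X.xu = 0)
    {R : ℝ} (ho : X.outer = .wall R (.robin 0 0)) (hH : 0 < X.rh ^ 2 + X.a ^ 2) :
    ∃ C : ℝ, 0 ≤ C ∧ ∀ f fr fx w wr y : ℝ × ℝ → ℝ, X.TimeSlice f fr fx w wr y → ∀ z : ℝ,
      |z| ≤ C * ∫ p in X.openBox R, (|w p - z| + |wr p| + |y p|) := by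
  have hR := hX.innerRadius_wall ho
  have hbs := hR.box_subset
  have hos := hR.openBox_subset
  have cH := hR.continuousOn_fst hX.H_smooth.continuousOn
  have cdH := hR.continuousOn_fst hX.continuousOn_dH
  have ck := hR.continuousOn_fst (hX.continuousOn_kH R)
  have cdk := hR.continuousOn_fst (hX.continuousOn_dkH R)
  have cN := hX.N_smooth.continuousOn.mono hbs
  obtain ⟨B₁, hB₁, b₁⟩ := exists_bound_closedBox (X := X) (R := R)
    (g := fun p => X.dkH R p.1 - X.dH p.1) (by fun_prop)
  obtain ⟨B₂, hB₂, b₂⟩ := exists_bound_closedBox (X := X) (R := R)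
    (g := fun p => X.kH R p.1 - 2 * X.H p.1) (by fun_prop)
  obtain ⟨B₃, hB₃, b₃⟩ := exists_bound_closedBox (X := X) (R := R) (g := X.N) (by fun_prop)
  set κ := (X.rh ^ 2 + X.a ^ 2) * (X.xu - X.xl) with hκ
  have hκ0 : 0 < κ := mul_pos hH (sub_pos.2 hX.xl_lt_xu)
  -- The integrand is the radial derivative of `kH` - H, which is 0 at r = R and -H at the horizon.
  have hflux : ∫ p in X.openBox R, (X.dkH R p.1 - X.dH p.1) = κ := by
    have h1 := setIntegral_rect_deriv_fst (a := X.rh) (b := R) (c := X.xl) (d := X.xu) hR.lt.le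
      (P := fun p => X.kH R p.1 - X.H p.1) (Pr := fun p => X.dkH R p.1 - X.dH p.1)
      (ck.sub cH) (cdk.sub cdH) (fun p hp => by
        have d1 := hX.hasDerivAt_H (hos hp).1
        rw [← dH_eq (hos hp).1] at d1
        exact (hX.hasDerivAt_kH R (hos hp).1).sub d1)
    refine h1.trans ?_
    have hk1 : X.kH R R = X.H R := by
      unfold kH
      rw [div_self (sub_pos.2 hR.lt).ne', one_mul]
    have hk0 : X.kH R X.rh = 0 := by simp [kH]
    simp only [hk1, hk0, hX.H_inner]
    rw [setIntegral_const, Measure.real, Real.volume_Ioo,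
      ENNReal.toReal_ofReal (sub_pos.2 hX.xl_lt_xu).le, smul_eq_mul, hκ]
    ring
  refine ⟨(B₁ + B₂ + B₃) / κ, by positivity, fun f fr fx w wr y h z => ?_⟩
  have cw := h.smooth_w.continuousOn.mono hbs
  have cwr := h.smooth_wr.continuousOn.mono hbs
  have cy := h.smooth_y.continuousOn.mono hbs
  have hweak := hX.weak_form hl hu hR h (φ := fun _ => 1) (φr := fun _ => 0) (φx := fun _ => 0)
    (by fun_prop) (by fun_prop) (by fun_prop) (fun p _ => hasDerivAt_const _ _)
    (fun p _ => hasDerivAt_const _ _) (fun x hx => by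
      have := h.neumann R ho x hx
      simp only [smul_eq_mul] at this
      rw [this, zero_mul])
  set G : ℝ × ℝ → ℝ := fun p => (X.dkH R p.1 - X.dH p.1) * (w p - z)
    + (X.kH R p.1 - 2 * X.H p.1) * wr p + X.N p * y p with hG
  have cG : ContinuousOn G (X.closedBox R) := by fun_prop
  have hz : ∫ p in X.openBox R, G p = -(κ * z) := by
    have i1 := integrableOn_openBox (X := X) (R := R)
      (g := fun p => X.dkH R p.1 - X.dH p.1) (by fun_prop)
    have i2 := integrableOn_openBox (X := X) (R := R)
      (g := fun p => (X.dkH R p.1 - X.dH p.1) * w p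
        + (X.kH R p.1 - 2 * X.H p.1) * wr p + X.N p * y p) (by fun_prop)
    have e : ∀ p, G p = ((X.dkH R p.1 - X.dH p.1) * w p
        + (X.kH R p.1 - 2 * X.H p.1) * wr p + X.N p * y p)
        - z * (X.dkH R p.1 - X.dH p.1) := fun p => by simp only [hG]; ring
    simp only [mul_one, mul_zero, add_zero] at hweak
    simp_rw [e]
    rw [integral_sub i2 (i1.const_mul z), hweak, integral_const_mul, hflux]
    ring
  have hle : |∫ p in X.openBox R, G p| ≤
      ∫ p in X.openBox R, (B₁ + B₂ + B₃) * (|w p - z| + |wr p| + |y p|) := by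
    rw [← Real.norm_eq_abs]
    refine (norm_integral_le_integral_norm _).trans ?_
    refine setIntegral_mono_on (integrableOn_openBox cG).norm
      (integrableOn_openBox (by fun_prop)) (measurableSet_openBox R) fun p hp => ?_
    rw [Real.norm_eq_abs]
    calc |G p| ≤ |X.dkH R p.1 - X.dH p.1| * |w p - z|
          + |X.kH R p.1 - 2 * X.H p.1| * |wr p| + |X.N p| * |y p| := by
          simp only [hG, ← abs_mul]
          exact (abs_add_le _ _).trans (by gcongr; exact abs_add_le _ _)
      _ ≤ B₁ * |w p - z| + B₂ * |wr p| + B₃ * |y p| := by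
          gcongr
          · exact b₁ p hp
          · exact b₂ p hp
          · exact b₃ p hp
      _ ≤ _ := by
          have a1 := abs_nonneg (w p - z)
          have a2 := abs_nonneg (wr p)
          have a3 := abs_nonneg (y p)
          nlinarith [mul_nonneg hB₁ a2, mul_nonneg hB₁ a3, mul_nonneg hB₂ a1, mul_nonneg hB₂ a3,
            mul_nonneg hB₃ a1, mul_nonneg hB₃ a2]
  rw [hz, abs_neg, abs_mul, abs_of_pos hκ0, integral_const_mul] at hle
  rw [div_mul_eq_mul_div, le_div_iff₀ hκ0]
  linarith

theorem BH1.flux_bound (hX : X.BH1) (hl : X.deltaX X.xl = 0) (hu : X.deltaX X.xu = 0)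
    {R : ℝ} (ho : X.outer = .wall R (.robin 0 0)) (hH : 0 < X.rh ^ 2 + X.a ^ 2) :
    ∃ C : ℝ, 0 ≤ C ∧ ∀ f fr fx w wr y : ℝ × ℝ → ℂ, X.TimeSlice f fr fx w wr y → ∀ z : ℂ,
      ‖z‖ ≤ C * ∫ p in X.openBox R, (‖w p - z‖ + ‖wr p‖ + ‖y p‖) := by
  obtain ⟨C, hC, hb⟩ := hX.real_flux_bound hl hu ho hH
  have hR := hX.innerRadius_wall ho
  have hbs := hR.box_subset
  refine ⟨2 * C, by positivity, fun f fr fx w wr y h z => ?_⟩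
  have cw := h.smooth_w.continuousOn.mono hbs
  have cwr := h.smooth_wr.continuousOn.mono hbs
  have cy := h.smooth_y.continuousOn.mono hbs
  have key : ∀ L : ℂ →L[ℝ] ℝ, (∀ v, |L v| ≤ ‖v‖) →
      |L z| ≤ C * ∫ p in X.openBox R, (‖w p - z‖ + ‖wr p‖ + ‖y p‖) := by
    intro L hL
    refine (hb _ _ _ _ _ _ (h.map L) (L z)).trans ?_
    have lc : ∀ {g : ℝ × ℝ → ℂ}, ContinuousOn g (X.closedBox R) →
        ContinuousOn (fun p => L (g p)) (X.closedBox R) := fun hg =>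
      L.continuous.comp_continuousOn hg
    have lw := lc cw
    have lwr := lc cwr
    have ly := lc cy
    refine mul_le_mul_of_nonneg_left ?_ hC
    refine setIntegral_mono_on (integrableOn_openBox (by fun_prop))
      (integrableOn_openBox (by fun_prop)) (measurableSet_openBox R) fun p _ => ?_
    rw [← map_sub]
    exact add_le_add (add_le_add (hL _) (hL _)) (hL _)
  have h1 := key Complex.reCLM fun v => Complex.abs_re_le_norm v
  have h2 := key Complex.imCLM fun v => Complex.abs_im_le_norm v
  have h3 := Complex.norm_le_abs_re_add_abs_im z
  rw [Complex.reCLM_apply] at h1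
  rw [Complex.imCLM_apply] at h2
  linarith

end Exterior

namespace Realization

variable {X : Exterior} {W : Realization.{u} X} {s : ℕ}

/-! ### Square integrals over boxes -/

theorem integral_norm_sq_le {S : Set (ℝ × ℝ)} {g : ℝ × ℝ → ℂ} {c : ℝ} (hc : 0 ≤ c)
    (h : ∫⁻ p in S, ‖g p‖ₑ ^ 2 ≤ ENNReal.ofReal c) : ∫ p in S, ‖g p‖ ^ 2 ≤ c := by
  by_cases hm : AEStronglyMeasurable (fun p => ‖g p‖ ^ 2) (volume.restrict S)
  · rw [integral_eq_lintegral_of_nonneg_ae (Eventually.of_forall fun p => by positivity) hm]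
    refine ENNReal.toReal_le_of_le_ofReal hc (le_trans (le_of_eq ?_) h)
    refine lintegral_congr fun p => ?_
    rw [ENNReal.ofReal_pow (norm_nonneg _), ofReal_norm]
  · rw [integral_non_aestronglyMeasurable hm]
    exact hc

theorem lintegral_inner_eq {S : Set (ℝ × ℝ)} (hS : S ⊆ X.inner) (g : ℝ × ℝ → ℝ≥0∞) :
    ∫⁻ p in S, g p ∂X.vol = ∫⁻ p in S, g p := by
  unfold Exterior.vol
  rw [Measure.restrict_restrict_of_subset hS]

/-- A box is bounded, hence inside a ball, and lies in the interior, where `vol` is Lebesgue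
measure. -/
theorem BH3.box_bound (h : W.BH3 s) {R : ℝ} (hR : X.InnerRadius R) : ∃ C : ℝ, 0 ≤ C ∧
    ∀ (U : W.E s) (f g : ℝ × ℝ → ℂ), W.HasData s U f g →
      ∫⁻ p in X.openBox R, ‖f p‖ₑ ^ 2 ≤ ENNReal.ofReal (C * ‖U‖ ^ 2) ∧
      ∫⁻ p in X.openBox R, ‖g p‖ₑ ^ 2 ≤ ENNReal.ofReal (C * ‖U‖ ^ 2) ∧
      (ContDiffOn ℝ ∞ f X.inner →
        ∫⁻ p in X.openBox R, ‖fderiv ℝ f p (1, 0)‖ₑ ^ 2 ≤ ENNReal.ofReal (C * ‖U‖ ^ 2)) := by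
  have hos := hR.openBox_subset
  obtain ⟨r, hr⟩ := (isCompact_Icc.prod isCompact_Icc : IsCompact
    (Icc X.rh R ×ˢ Icc X.xl X.xu)).isBounded.subset_closedBall (0 : ℝ × ℝ)
  have hob : X.openBox R ⊆ Metric.closedBall 0 r :=
    (Set.prod_mono Ioo_subset_Icc_self Ioo_subset_Icc_self).trans hr
  obtain ⟨C, hC⟩ := h.ball_bound r
  refine ⟨(C : ℝ) ^ 2, by positivity, fun U f g hU => ?_⟩
  have e : ((C : ℝ≥0∞) * ‖U‖ₑ) ^ 2 = ENNReal.ofReal ((C : ℝ) ^ 2 * ‖U‖ ^ 2) := by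
    rw [← mul_pow, ENNReal.ofReal_pow (by positivity), ENNReal.ofReal_mul (by positivity),
      ofReal_norm, ENNReal.ofReal_coe_nnreal]
  obtain ⟨h1, h2, h3⟩ := hC U
  rw [e] at h1 h2 h3
  have key : ∀ v : ℝ × ℝ → ℂ, ∫⁻ p in X.openBox R, ‖v p‖ₑ ^ 2 ≤
      ∫⁻ p in Metric.closedBall 0 r, ‖v p‖ₑ ^ 2 ∂X.vol := fun v => by
    rw [← lintegral_inner_eq hos]
    exact lintegral_mono_set hob
  refine ⟨(key f).trans (le_trans (le_of_eq ?_) h1), (key g).trans (le_trans (le_of_eq ?_) h2),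
    fun hf => (key _).trans (h3 f hf hU.1)⟩
  · exact lintegral_congr_ae (ae_restrict_of_ae (hU.1.mono fun p hp => by simp only [hp]))
  · exact lintegral_congr_ae (ae_restrict_of_ae (hU.2.mono fun p hp => by simp only [hp]))

/-- The second component of data in the domain of the generator. -/
theorem BH3.snd_eq_fst_of_gen (h : W.BH3 s) (hX : X.BH1) {V V' : W.E s} (hG : W.Gen s V V') :
    (W.data s V).2 =ᵐ[X.vol] (W.data s V').1 := by
  have key : ∀ N : ℕ, ∀ᵐ p ∂X.vol.restrict (Metric.closedBall 0 (N : ℝ)),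
      (W.data s V).2 p = (W.data s V').1 p := by
    intro N
    obtain ⟨C, hC⟩ := h.ball_bound N
    have hm : AEStronglyMeasurable (fun p => (W.data s V).2 p - (W.data s V').1 p) X.vol :=
      (AEEqFun.aestronglyMeasurable _).sub (AEEqFun.aestronglyMeasurable _)
    have hb : ∀ n : ℕ, ∫⁻ p in Metric.closedBall 0 (N : ℝ),
        ‖(W.data s V).2 p - (W.data s V').1 p‖ₑ ^ 2 ∂X.vol ≤
          ENNReal.ofReal (1 / ((n : ℝ) + 1)) * (4 * (C : ℝ≥0∞) ^ 2) := by
      intro n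
      have hn : (0 : ℝ) < 1 / ((n : ℝ) + 1) := by positivity
      have hn1 : 1 / ((n : ℝ) + 1) ≤ 1 := by
        rw [div_le_one (by positivity)]
        linarith [(Nat.cast_nonneg n : (0 : ℝ) ≤ n)]
      -- The second component of A and the first component of B are the same function w, so only the
      -- two approximation errors remain.
      obtain ⟨A, B, f, fr, fx, w, wr, y, hA, hB, -, dA, dB⟩ := h.exists_timeSlice_near hX hG hn
      have hsq : ∀ Y : W.E s, ‖Y‖ < 1 / ((n : ℝ) + 1) →
          ((C : ℝ≥0∞) * ‖Y‖ₑ) ^ 2 ≤ ENNReal.ofReal (1 / ((n : ℝ) + 1)) * (C : ℝ≥0∞) ^ 2 := by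
        intro Y hY
        rw [mul_pow, mul_comm]
        gcongr
        rw [← ofReal_norm, ← ENNReal.ofReal_pow (norm_nonneg _)]
        refine ENNReal.ofReal_le_ofReal ?_
        nlinarith [norm_nonneg Y]
      calc ∫⁻ p in Metric.closedBall 0 (N : ℝ), ‖(W.data s V).2 p - (W.data s V').1 p‖ₑ ^ 2 ∂X.vol
          ≤ ∫⁻ p in Metric.closedBall 0 (N : ℝ), 2 * (‖(W.data s (V - A)).2 p‖ₑ ^ 2
              + ‖(W.data s (V' - B)).1 p‖ₑ ^ 2) ∂X.vol := by
            refine lintegral_mono_ae (ae_restrict_of_ae ?_)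
            filter_upwards [(data_sub_ae V A).2, (data_sub_ae V' B).1, dA.2, dB.1]
              with p h1 h2 h3 h4
            rw [h1, h2, h3, h4]
            refine le_trans ?_ (ennreal_add_sq_le _ _)
            have : (W.data s V).2 p - (W.data s V').1 p
              = ((W.data s V).2 p - w p) - ((W.data s V').1 p - w p) := by ring
            rw [this]
            gcongr
            exact enorm_sub_le
        _ = 2 * (∫⁻ p in Metric.closedBall 0 (N : ℝ), ‖(W.data s (V - A)).2 p‖ₑ ^ 2 ∂X.vol
              + ∫⁻ p in Metric.closedBall 0 (N : ℝ), ‖(W.data s (V' - B)).1 p‖ₑ ^ 2 ∂X.vol) := by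
            rw [lintegral_const_mul' _ _ (by simp), lintegral_add_left' ?_]
            exact ((AEEqFun.aestronglyMeasurable _).mono_measure
              Measure.restrict_le_self).enorm.pow_const 2
        _ ≤ 2 * (ENNReal.ofReal (1 / ((n : ℝ) + 1)) * (C : ℝ≥0∞) ^ 2
              + ENNReal.ofReal (1 / ((n : ℝ) + 1)) * (C : ℝ≥0∞) ^ 2) := by
            gcongr
            · exact (hC _).2.1.trans (hsq _ hA)
            · exact (hC _).1.trans (hsq _ hB)
        _ = _ := by ring
    have h0 : ∫⁻ p in Metric.closedBall 0 (N : ℝ),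
        ‖(W.data s V).2 p - (W.data s V').1 p‖ₑ ^ 2 ∂X.vol = 0 := by
      have h1 : Tendsto (fun n : ℕ => ENNReal.ofReal (1 / ((n : ℝ) + 1))) atTop (𝓝 0) := by
        simpa using ENNReal.tendsto_ofReal (tendsto_one_div_add_atTop_nhds_zero_nat (𝕜 := ℝ))
      have h2 := ENNReal.Tendsto.mul_const (b := 4 * (C : ℝ≥0∞) ^ 2) h1
        (Or.inr (by finiteness))
      rw [zero_mul] at h2
      exact le_antisymm (ge_of_tendsto' h2 hb) zero_le
    rw [lintegral_eq_zero_iff' ((hm.mono_measure Measure.restrict_le_self).enorm.pow_const 2)] at h0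
    filter_upwards [h0] with p hp
    have : ‖(W.data s V).2 p - (W.data s V').1 p‖ₑ = 0 := by simpa using hp
    exact sub_eq_zero.1 (enorm_eq_zero.1 this)
  have hU : (⋃ N : ℕ, Metric.closedBall (0 : ℝ × ℝ) N) = univ := by
    refine eq_univ_of_forall fun p => mem_iUnion.2 ?_
    obtain ⟨N, hN⟩ := exists_nat_ge ‖p‖
    exact ⟨N, by rwa [mem_closedBall_zero_iff]⟩
  have := (ae_restrict_iUnion_iff (fun N : ℕ => Metric.closedBall (0 : ℝ × ℝ) N)
    (fun p => (W.data s V).2 p = (W.data s V').1 p)).2 key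
  rwa [hU, Measure.restrict_univ] at this

/-! ### No Jordan block over the constants -/

/-- From ‖g‖ ≤ ε + ε⁻¹‖g‖² the L¹ norm inherits the linear smallness in ε required by the flux
bound. -/
theorem integral_norm_le_of_sq {R : ℝ} {g : ℝ × ℝ → ℂ} (hg : ContinuousOn g (X.closedBox R))
    {ε D : ℝ} (hε : 0 < ε) (hD : 0 ≤ D)
    (h : ∫⁻ p in X.openBox R, ‖g p‖ₑ ^ 2 ≤ ENNReal.ofReal (D * ε ^ 2)) :
    ∫ p in X.openBox R, ‖g p‖ ≤ ε * (volume.real (X.openBox R) + D) := by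
  have h1 := integral_norm_sq_le (by positivity) h
  have i0 : IntegrableOn (fun _ : ℝ × ℝ => ε) (X.openBox R) :=
    Exterior.integrableOn_openBox continuousOn_const
  have i1 : IntegrableOn (fun p => ε⁻¹ * ‖g p‖ ^ 2) (X.openBox R) :=
    Exterior.integrableOn_openBox (by fun_prop)
  calc ∫ p in X.openBox R, ‖g p‖ ≤ ∫ p in X.openBox R, (ε + ε⁻¹ * ‖g p‖ ^ 2) := by
        refine setIntegral_mono_on (Exterior.integrableOn_openBox hg.norm) (i0.add i1)
          (Exterior.measurableSet_openBox R) fun p _ => ?_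
        have h2 : 0 ≤ ε⁻¹ * (‖g p‖ - ε) ^ 2 := by positivity
        have h3 : ε⁻¹ * (‖g p‖ - ε) ^ 2
            = ε⁻¹ * ‖g p‖ ^ 2 - 2 * (ε⁻¹ * ε) * ‖g p‖ + (ε⁻¹ * ε) * ε := by ring
        rw [h3, inv_mul_cancel₀ hε.ne'] at h2
        linarith [norm_nonneg (g p)]
    _ = volume.real (X.openBox R) * ε + ε⁻¹ * ∫ p in X.openBox R, ‖g p‖ ^ 2 := by
        rw [integral_add i0 i1, integral_const_mul, setIntegral_const, smul_eq_mul]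
    _ ≤ volume.real (X.openBox R) * ε + ε⁻¹ * (D * ε ^ 2) := by gcongr
    _ = _ := by field_simp

/-- For slices approximating the graph element, w - z, w_r and y are O(ε) in L², hence in L¹ on the
box. The flux bound then makes z itself O(ε). -/
theorem BH3.eq_zero_of_gen_const (h : W.BH3 s) (hX : X.BH1) (hl : X.deltaX X.xl = 0)
    (hu : X.deltaX X.xu = 0) {R : ℝ} (ho : X.outer = .wall R (.robin 0 0))
    (hH : 0 < X.rh ^ 2 + X.a ^ 2) {V V' : W.E s} (hG : W.Gen s V V') {z : ℂ}
    (hz : W.HasData s V' (fun _ => z) 0) : z = 0 := by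
  obtain ⟨C, hC, hb⟩ := hX.flux_bound hl hu ho hH
  have hR := hX.innerRadius_wall ho
  obtain ⟨D, hD, hbox⟩ := h.box_bound hR
  set m := volume.real (X.openBox R)
  have key : ∀ ε > 0, ‖z‖ ≤ ε * (3 * C * (m + D)) := by
    intro ε hε
    obtain ⟨A, B, f, fr, fx, w, wr, y, -, hB, hts, -, dB⟩ := h.exists_timeSlice_near hX hG hε
    obtain ⟨b1, b2, b3⟩ := hbox (V' - B) _ _ (hz.sub dB)
    have hmono : ENNReal.ofReal (D * ‖V' - B‖ ^ 2) ≤ ENNReal.ofReal (D * ε ^ 2) :=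
      ENNReal.ofReal_le_ofReal (by gcongr)
    have hbs := hR.box_subset
    have cw := hts.smooth_w.continuousOn.mono hbs
    have cwr := hts.smooth_wr.continuousOn.mono hbs
    have cy := hts.smooth_y.continuousOn.mono hbs
    have hsm : ContDiffOn ℝ ∞ ((fun _ => z) - w) X.inner :=
      contDiffOn_const.sub (hts.smooth_w.mono Exterior.inner_subset_slice)
    have e1 : ∫ p in X.openBox R, ‖w p - z‖ ≤ ε * (m + D) := by
      refine integral_norm_le_of_sq (by fun_prop) hε hD (le_trans (le_of_eq ?_) (b1.trans hmono))
      exact lintegral_congr fun p => by rw [Pi.sub_apply, ← enorm_neg, neg_sub]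
    have e2 : ∫ p in X.openBox R, ‖wr p‖ ≤ ε * (m + D) := by
      refine integral_norm_le_of_sq cwr hε hD (le_trans (le_of_eq ?_) ((b3 hsm).trans hmono))
      refine setLIntegral_congr_fun (Exterior.measurableSet_openBox R) fun p hp => ?_
      have hp' := hR.openBox_subset hp
      have hd : fderiv ℝ ((fun _ => z) - w) p = -fderiv ℝ w p := by
        rw [show (fun _ => z) - w = fun q => z - w q from rfl, fderiv_const_sub]
      rw [hd, ← hts.deriv_w p hp', _root_.neg_apply, enorm_neg]
    have e3 : ∫ p in X.openBox R, ‖y p‖ ≤ ε * (m + D) := by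
      refine integral_norm_le_of_sq cy hε hD (le_trans (le_of_eq ?_) (b2.trans hmono))
      exact lintegral_congr fun p => by simp
    have i1 : IntegrableOn (fun p => ‖w p - z‖) (X.openBox R) :=
      Exterior.integrableOn_openBox (by fun_prop)
    have i2 := Exterior.integrableOn_openBox cwr.norm
    have i3 := Exterior.integrableOn_openBox cy.norm
    refine (hb _ _ _ _ _ _ hts z).trans ?_
    have i4 : IntegrableOn (fun p => ‖w p - z‖ + ‖wr p‖) (X.openBox R) := i1.add i2
    rw [integral_add i4 i3, integral_add i1 i2]
    have : C * (∫ p in X.openBox R, ‖w p - z‖) + C * (∫ p in X.openBox R, ‖wr p‖)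
        + C * (∫ p in X.openBox R, ‖y p‖)
        ≤ C * (ε * (m + D)) + C * (ε * (m + D)) + C * (ε * (m + D)) := by gcongr
    linarith
  have hlim : Tendsto (fun ε : ℝ => ε * (3 * C * (m + D))) (𝓝[>] 0) (𝓝 0) := by
    have : Tendsto (fun ε : ℝ => ε * (3 * C * (m + D))) (𝓝 0) (𝓝 (0 * (3 * C * (m + D)))) :=
      tendsto_id.mul_const _
    rw [zero_mul] at this
    exact this.mono_left nhdsWithin_le_nhds
  have := ge_of_tendsto hlim (eventually_mem_of_tendsto_nhdsWithin tendsto_id |>.mono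
    fun ε hε => key ε hε)
  exact norm_le_zero_iff.1 this

end Realization

/-! ### Functions of vanishing mean oscillation -/

/-- Transfers smallness of oscillation from a continuous approximation to a merely measurable
function, at the cost of their L² distance. -/
theorem lintegral_oscillation_le {Q : Set (ℝ × ℝ)} (hQ : MeasurableSet Q) {v f : ℝ × ℝ → ℂ}
    (hv : AEStronglyMeasurable v (volume.restrict Q)) (hf : ContinuousOn f Q) :
    ∫⁻ p in Q, ∫⁻ q in Q, ‖v p - v q‖ₑ ^ 2 ≤
      4 * (∫⁻ p in Q, ∫⁻ q in Q, ‖f p - f q‖ₑ ^ 2)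
        + 8 * volume Q * ∫⁻ p in Q, ‖v p - f p‖ₑ ^ 2 := by
  set D := ∫⁻ p in Q, ‖v p - f p‖ₑ ^ 2 with hD
  have hfm : AEStronglyMeasurable f (volume.restrict Q) := hf.aestronglyMeasurable hQ
  have hm : AEMeasurable (fun p => ‖v p - f p‖ₑ ^ 2) (volume.restrict Q) :=
    (hv.sub hfm).enorm.pow_const 2
  have hpt : ∀ p q, ‖v p - v q‖ₑ ^ 2 ≤
      4 * ‖f p - f q‖ₑ ^ 2 + 4 * ‖v p - f p‖ₑ ^ 2 + 4 * ‖v q - f q‖ₑ ^ 2 := by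
    intro p q
    have e : v p - v q = (f p - f q) + ((v p - f p) - (v q - f q)) := by ring
    calc ‖v p - v q‖ₑ ^ 2 ≤ (‖f p - f q‖ₑ + (‖v p - f p‖ₑ + ‖v q - f q‖ₑ)) ^ 2 := by
          rw [e]
          gcongr
          exact (enorm_add_le _ _).trans (by gcongr; exact enorm_sub_le)
      _ ≤ 2 * (‖f p - f q‖ₑ ^ 2 + 2 * (‖v p - f p‖ₑ ^ 2 + ‖v q - f q‖ₑ ^ 2)) := by
          refine (ennreal_add_sq_le _ _).trans ?_
          gcongr
          exact ennreal_add_sq_le _ _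
      _ ≤ _ := by
          have : 2 * (‖f p - f q‖ₑ ^ 2 + 2 * (‖v p - f p‖ₑ ^ 2 + ‖v q - f q‖ₑ ^ 2))
            = 2 * ‖f p - f q‖ₑ ^ 2 + 4 * ‖v p - f p‖ₑ ^ 2 + 4 * ‖v q - f q‖ₑ ^ 2 := by ring
          rw [this]
          gcongr
          norm_num
  have hinner : ∀ p, ∫⁻ q in Q, ‖v p - v q‖ₑ ^ 2 ≤
      4 * (∫⁻ q in Q, ‖f p - f q‖ₑ ^ 2) + (4 * ‖v p - f p‖ₑ ^ 2 * volume Q + 4 * D) := by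
    intro p
    have m1 : AEMeasurable (fun q => 4 * ‖f p - f q‖ₑ ^ 2) (volume.restrict Q) :=
      ((aestronglyMeasurable_const.sub hfm).enorm.pow_const 2).const_mul 4
    calc ∫⁻ q in Q, ‖v p - v q‖ₑ ^ 2 ≤ ∫⁻ q in Q, (4 * ‖f p - f q‖ₑ ^ 2
          + (4 * ‖v p - f p‖ₑ ^ 2 + 4 * ‖v q - f q‖ₑ ^ 2)) :=
          lintegral_mono fun q => (hpt p q).trans (le_of_eq (add_assoc _ _ _))
      _ = _ := by
          rw [lintegral_add_left' m1, lintegral_add_left measurable_const,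
            lintegral_const_mul' _ _ (by simp), setLIntegral_const,
            lintegral_const_mul' _ _ (by simp)]
  have m2 : AEMeasurable (fun p => 4 * ‖v p - f p‖ₑ ^ 2 * volume Q + 4 * D)
      (volume.restrict Q) := ((hm.const_mul 4).mul_const _).add_const _
  calc ∫⁻ p in Q, ∫⁻ q in Q, ‖v p - v q‖ₑ ^ 2
      ≤ ∫⁻ p in Q, (4 * (∫⁻ q in Q, ‖f p - f q‖ₑ ^ 2)
          + (4 * ‖v p - f p‖ₑ ^ 2 * volume Q + 4 * D)) := lintegral_mono hinner
    _ = 4 * (∫⁻ p in Q, ∫⁻ q in Q, ‖f p - f q‖ₑ ^ 2) + (4 * D * volume Q + 4 * D * volume Q) := by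
        rw [lintegral_add_right' _ m2, lintegral_const_mul' _ _ (by simp),
          lintegral_add_right _ measurable_const, setLIntegral_const,
          lintegral_mul_const'' _ (hm.const_mul 4), lintegral_const_mul' _ _ (by simp)]
    _ = _ := by ring

/-- Since there are countably many sets Q n, one base point p can be chosen outside all exceptional
null sets. Every other interior point eventually shares a Q n with p. -/
theorem Exterior.ae_eq_const_of_oscillation {X : Exterior} (hne : X.inner.Nonempty)
    {v : ℝ × ℝ → ℂ} (hv : AEStronglyMeasurable v X.vol) {Q : ℕ → Set (ℝ × ℝ)}
    (hm : ∀ n, MeasurableSet (Q n)) (hQ : ∀ n, Q n ⊆ X.inner)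
    (hex : ∀ p ∈ X.inner, ∀ᶠ n in atTop, p ∈ Q n)
    (h0 : ∀ n, ∫⁻ p in Q n, ∫⁻ q in Q n, ‖v p - v q‖ₑ ^ 2 = 0) :
    ∃ z : ℂ, v =ᵐ[X.vol] fun _ => z := by
  have hvm : ∀ n, AEStronglyMeasurable v (volume.restrict (Q n)) := fun n =>
    hv.mono_measure (Measure.restrict_mono (hQ n) le_rfl)
  have h1 : ∀ n, ∀ᵐ p ∂X.vol, p ∈ Q n → ∀ᵐ q ∂X.vol, q ∈ Q n → v q = v p := by
    intro n
    have hm2 : AEMeasurable (fun z : (ℝ × ℝ) × (ℝ × ℝ) => ‖v z.1 - v z.2‖ₑ ^ 2)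
        ((volume.restrict (Q n)).prod (volume.restrict (Q n))) :=
      (((hvm n).comp_fst).sub ((hvm n).comp_snd)).enorm.pow_const 2
    have h2 := h0 n
    rw [lintegral_eq_zero_iff' hm2.lintegral_prod_right'] at h2
    have h3 : ∀ᵐ p ∂volume.restrict (Q n), ∀ᵐ q ∂volume.restrict (Q n), v q = v p := by
      filter_upwards [h2] with p hp
      have hm3 : AEMeasurable (fun q => ‖v p - v q‖ₑ ^ 2) (volume.restrict (Q n)) :=
        (aestronglyMeasurable_const.sub (hvm n)).enorm.pow_const 2
      have hp' : ∫⁻ q in Q n, ‖v p - v q‖ₑ ^ 2 = 0 := hp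
      rw [lintegral_eq_zero_iff' hm3] at hp'
      filter_upwards [hp'] with q hq
      have : ‖v p - v q‖ₑ = 0 := by simpa using hq
      exact (sub_eq_zero.1 (enorm_eq_zero.1 this)).symm
    have e : volume.restrict (Q n) = X.vol.restrict (Q n) := by
      unfold Exterior.vol
      rw [Measure.restrict_restrict_of_subset (hQ n)]
    rw [e, ae_restrict_iff' (hm n)] at h3
    filter_upwards [h3] with p hp hpn
    exact (ae_restrict_iff' (hm n)).1 (hp hpn)
  have hpos : X.vol ≠ 0 := by
    intro h
    have : X.vol univ ≠ 0 := by
      unfold Exterior.vol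
      rw [Measure.restrict_apply_univ]
      exact (isOpen_inner.measure_pos volume hne).ne'
    exact this (by rw [h]; rfl)
  have : (ae X.vol).NeBot := ae_neBot.2 hpos
  obtain ⟨p, hp, hpi⟩ := ((ae_all_iff.2 h1).and ae_mem_inner).exists
  refine ⟨v p, ?_⟩
  have h4 : ∀ᵐ q ∂X.vol, ∀ n, p ∈ Q n → q ∈ Q n → v q = v p := by
    rw [ae_all_iff]
    intro n
    by_cases hn : p ∈ Q n
    · filter_upwards [hp n hn] with q hq _ using hq
    · exact Eventually.of_forall fun q h => absurd h hn
  filter_upwards [h4, ae_mem_inner] with q hq hqi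
  obtain ⟨n, h5, h6⟩ := ((hex p hpi).and (hex q hqi)).exists
  exact hq n h5 h6

namespace Realization

variable {X : Exterior} {W : Realization.{u} X} {s : ℕ}

/-! ### Oscillation of stationary data -/

/-- The energy degenerates at the horizon, at the axes and where α + βr vanishes; on Q the weights
are at least m, and it controls the plain gradient. -/
theorem lintegral_grad_le (hX : X.BH1) {R α β m : ℝ} (hR : X.InnerRadius R) (hm : 0 < m)
    {Q : Set (ℝ × ℝ)} (hQm : MeasurableSet Q) (hQ : Q ⊆ X.openBox R)
    (hmr : ∀ p ∈ Q, m ≤ (α + β * p.1) ^ 2 * X.deltaR p.1)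
    (hmx : ∀ p ∈ Q, m ≤ (α + β * p.1) ^ 2 * X.deltaX p.2) {fr fx : ℝ × ℝ → ℂ}
    (cfr : ContinuousOn fr (X.closedBox R)) (cfx : ContinuousOn fx (X.closedBox R)) :
    ∫⁻ p in Q, (‖fr p‖ₑ ^ 2 + ‖fx p‖ₑ ^ 2) ≤ ENNReal.ofReal (m⁻¹ * ∫ p in X.openBox R,
      (α + β * p.1) ^ 2 * (X.deltaR p.1 * ‖fr p‖ ^ 2 + X.deltaX p.2 * ‖fx p‖ ^ 2)) := by
  have cD := Exterior.continuousOn_deltaR_fst (X := X) (X.closedBox R)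
  have cX := Exterior.continuousOn_deltaX_snd (X := X) (X.closedBox R)
  have hi : IntegrableOn (fun p => (α + β * p.1) ^ 2 *
      (X.deltaR p.1 * ‖fr p‖ ^ 2 + X.deltaX p.2 * ‖fx p‖ ^ 2)) (X.openBox R) :=
    Exterior.integrableOn_openBox (by fun_prop)
  have hnn : ∀ p ∈ X.openBox R, 0 ≤ m⁻¹ * ((α + β * p.1) ^ 2 *
      (X.deltaR p.1 * ‖fr p‖ ^ 2 + X.deltaX p.2 * ‖fx p‖ ^ 2)) := fun p hp => by
    have h1 := (hX.deltaR_pos p.1 (hR.openBox_subset hp).1).le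
    have h2 := (hX.deltaX_pos p.2 (hR.openBox_subset hp).2).le
    positivity
  rw [← integral_const_mul, ofReal_integral_eq_lintegral_ofReal (hi.const_mul _)
    ((ae_restrict_iff' (Exterior.measurableSet_openBox R)).2 (Eventually.of_forall hnn))]
  refine le_trans ?_ (lintegral_mono_set hQ)
  refine setLIntegral_mono_ae' hQm (Eventually.of_forall fun p hp => ?_)
  rw [← ofReal_norm, ← ofReal_norm, ← ENNReal.ofReal_pow (norm_nonneg _),
    ← ENNReal.ofReal_pow (norm_nonneg _), ← ENNReal.ofReal_add (by positivity) (by positivity)]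
  refine ENNReal.ofReal_le_ofReal ?_
  rw [inv_mul_eq_div, le_div_iff₀ hm]
  nlinarith [mul_le_mul_of_nonneg_right (hmr p hp) (sq_nonneg ‖fr p‖),
    mul_le_mul_of_nonneg_right (hmx p hp) (sq_nonneg ‖fx p‖)]

/-- Energy bound and Poincaré inequality for approximating slices, followed by the limit in the
graph norm. The 4 comes from `lintegral_oscillation_le`, and 8 = 2 · 4 from passing between f and V
in the weighted term. -/
theorem BH3.oscillation_le (h : W.BH3 s) (hX : X.BH1) (hl : X.deltaX X.xl = 0)
    (hu : X.deltaX X.xu = 0) {R : ℝ} (hR : X.InnerRadius R) {α β : ℝ}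
    (hbc : X.outer = .wall R (.robin 0 0) ∨ α + β * R = 0) {V : W.E s} (hV : W.Gen s V 0)
    {a b c d m : ℝ} (hQ : Icc a b ×ˢ Icc c d ⊆ X.openBox R) (hm : 0 < m)
    (hmr : ∀ p ∈ Icc a b ×ˢ Icc c d, m ≤ (α + β * p.1) ^ 2 * X.deltaR p.1)
    (hmx : ∀ p ∈ Icc a b ×ˢ Icc c d, m ≤ (α + β * p.1) ^ 2 * X.deltaX p.2) {K : ℝ≥0}
    (hK : ∀ f fr fx : ℝ × ℝ → ℂ,
      (∀ p ∈ Icc a b ×ˢ Icc c d, HasDerivAt (fun r => f (r, p.2)) (fr p) p.1) →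
      (∀ p ∈ Icc a b ×ˢ Icc c d, HasDerivAt (fun x => f (p.1, x)) (fx p) p.2) →
      ContinuousOn fr (Icc a b ×ˢ Icc c d) → ContinuousOn fx (Icc a b ×ˢ Icc c d) →
      ∫⁻ p in Icc a b ×ˢ Icc c d, ∫⁻ q in Icc a b ×ˢ Icc c d, ‖f p - f q‖ₑ ^ 2 ≤
        K * ∫⁻ p in Icc a b ×ˢ Icc c d, (‖fr p‖ₑ ^ 2 + ‖fx p‖ₑ ^ 2)) :
    ∫⁻ p in Icc a b ×ˢ Icc c d, ∫⁻ q in Icc a b ×ˢ Icc c d,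
        ‖(W.data s V).1 p - (W.data s V).1 q‖ₑ ^ 2 ≤
      4 * K * ENNReal.ofReal (8 * β ^ 2 / m) *
        ∫⁻ p in X.openBox R, ENNReal.ofReal (X.deltaR p.1) * ‖(W.data s V).1 p‖ₑ ^ 2 := by
  obtain ⟨C, hC, hen⟩ := hX.energy_bound hl hu hR α β
  obtain ⟨D, hD, hbox⟩ := h.box_bound hR
  have cD := Exterior.continuousOn_deltaR_fst (X := X) (X.closedBox R)
  obtain ⟨L, hL, hLb⟩ := Exterior.exists_bound_closedBox cD
  set Q := Icc a b ×ˢ Icc c d with hQdef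
  set v : ℝ × ℝ → ℂ := ⇑(W.data s V).1 with hv
  set T := ∫⁻ p in X.openBox R, ENNReal.ofReal (X.deltaR p.1) * ‖v p‖ₑ ^ 2 with hT
  have hbs := hR.box_subset
  have hos := hR.openBox_subset
  have hQm : MeasurableSet Q := measurableSet_Icc.prod measurableSet_Icc
  have hQi := hQ.trans hos
  have hvm : AEStronglyMeasurable v X.vol := AEEqFun.aestronglyMeasurable _
  have hvo : AEStronglyMeasurable v (volume.restrict (X.openBox R)) :=
    hvm.mono_measure (Measure.restrict_mono hos le_rfl)
  -- Z collects the coefficients of all errors that are linear in ε; only its finiteness matters.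
  set Z : ℝ≥0∞ := 4 * (K * (ENNReal.ofReal (8 * β ^ 2 / m) * (ENNReal.ofReal L * ENNReal.ofReal D)
      + ENNReal.ofReal (m⁻¹ * (C * (2 * D * (‖V‖ + 1) ^ 2 + 3 * D)))))
      + 8 * volume Q * ENNReal.ofReal D with hZ
  have hvolQ : volume Q ≠ ⊤ := (isCompact_Icc.prod isCompact_Icc).measure_lt_top.ne
  have hZt : Z ≠ ⊤ := by
    rw [hZ]
    finiteness
  have key : ∀ ε : ℝ, 0 < ε → ε ≤ 1 → ∫⁻ p in Q, ∫⁻ q in Q, ‖v p - v q‖ₑ ^ 2 ≤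
      4 * K * ENNReal.ofReal (8 * β ^ 2 / m) * T + ENNReal.ofReal ε * Z := by
    intro ε hε hε1
    obtain ⟨A, B, f, fr, fx, w, wr, y, hA, hB, hts, dA, dB⟩ := h.exists_timeSlice_near hX hV hε
    rw [zero_sub, norm_neg] at hB
    have cf := hts.smooth.continuousOn.mono hbs
    have cfr := hts.smooth_r.continuousOn.mono hbs
    have cfx := hts.smooth_x.continuousOn.mono hbs
    have cw := hts.smooth_w.continuousOn.mono hbs
    have cwr := hts.smooth_wr.continuousOn.mono hbs
    have cy := hts.smooth_y.continuousOn.mono hbs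
    have hQc : Q ⊆ X.closedBox R :=
      hQ.trans (Set.prod_mono Ioo_subset_Icc_self Ioo_subset_Icc_self)
    have hfs : ContDiffOn ℝ ∞ f X.inner := hts.smooth.mono Exterior.inner_subset_slice
    have hws : ContDiffOn ℝ ∞ w X.inner := hts.smooth_w.mono Exterior.inner_subset_slice
    have hA1 : ‖A‖ ≤ ‖V‖ + 1 := by
      have := norm_sub_norm_le A V
      rw [norm_sub_rev] at this
      linarith
    -- the approximation error
    have hdiff : ∫⁻ p in X.openBox R, ‖v p - f p‖ₑ ^ 2
        ≤ ENNReal.ofReal ε * ENNReal.ofReal D := by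
      refine (hbox (V - A) _ _ ((hasData_self V).sub dA)).1.trans ?_
      rw [← ENNReal.ofReal_mul hε.le]
      refine ENNReal.ofReal_le_ofReal ?_
      have : ‖V - A‖ ^ 2 ≤ ε := by nlinarith [norm_nonneg (V - A)]
      nlinarith
    -- the energy of the approximation
    have hder : ∫⁻ p in Q, (‖fr p‖ₑ ^ 2 + ‖fx p‖ₑ ^ 2) ≤
        ENNReal.ofReal (m⁻¹ * ∫ p in X.openBox R, (α + β * p.1) ^ 2 *
          (X.deltaR p.1 * ‖fr p‖ ^ 2 + X.deltaX p.2 * ‖fx p‖ ^ 2)) :=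
      lintegral_grad_le hX hR hm hQm hQ hmr hmx cfr cfx
    obtain ⟨b1, -, b3⟩ := hbox A _ _ dA
    obtain ⟨b4, b5, b6⟩ := hbox B _ _ dB
    have n1 := integral_norm_sq_le (by positivity) b1
    have n3 := integral_norm_sq_le (by positivity) (b3 hfs)
    have n4 := integral_norm_sq_le (by positivity) b4
    have n5 := integral_norm_sq_le (by positivity) b5
    have n6 := integral_norm_sq_le (by positivity) (b6 hws)
    rw [setIntegral_congr_fun (Exterior.measurableSet_openBox R)
      (fun p hp => by rw [hts.deriv_r p (hos hp)])] at n3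
    rw [setIntegral_congr_fun (Exterior.measurableSet_openBox R)
      (fun p hp => by rw [hts.deriv_w p (hos hp)])] at n6
    have i1 : IntegrableOn (fun p => ‖f p‖ ^ 2) (X.openBox R) :=
      Exterior.integrableOn_openBox (by fun_prop)
    have i2 : IntegrableOn (fun p => ‖fr p‖ ^ 2) (X.openBox R) :=
      Exterior.integrableOn_openBox (by fun_prop)
    have i3 : IntegrableOn (fun p => ‖w p‖ ^ 2) (X.openBox R) :=
      Exterior.integrableOn_openBox (by fun_prop)
    have i4 : IntegrableOn (fun p => ‖wr p‖ ^ 2) (X.openBox R) :=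
      Exterior.integrableOn_openBox (by fun_prop)
    have i5 : IntegrableOn (fun p => ‖y p‖ ^ 2) (X.openBox R) :=
      Exterior.integrableOn_openBox (by fun_prop)
    have i6 : IntegrableOn (fun p => X.deltaR p.1 * ‖f p‖ ^ 2) (X.openBox R) :=
      Exterior.integrableOn_openBox (by fun_prop)
    have i34 : IntegrableOn (fun p => ‖w p‖ ^ 2 + ‖wr p‖ ^ 2) (X.openBox R) := i3.add i4
    have hE := hen _ _ _ _ _ _ hts hbc ε hε
    rw [integral_add i1 i2, integral_add i34 i5, integral_add i3 i4] at hE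
    -- With δ = ε in Young's inequality, ε⁻¹‖B‖² is still at most ε, so both halves of the error
    -- vanish in the limit.
    have hB2 : ‖B‖ ^ 2 ≤ ε * ε := by nlinarith [norm_nonneg B]
    have hE2 : ε * ((∫ p in X.openBox R, ‖f p‖ ^ 2) + ∫ p in X.openBox R, ‖fr p‖ ^ 2)
        + ε⁻¹ * ((∫ p in X.openBox R, ‖w p‖ ^ 2) + (∫ p in X.openBox R, ‖wr p‖ ^ 2)
          + ∫ p in X.openBox R, ‖y p‖ ^ 2)
        ≤ ε * (2 * D * (‖V‖ + 1) ^ 2 + 3 * D) := by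
      calc _ ≤ ε * (D * ‖A‖ ^ 2 + D * ‖A‖ ^ 2)
            + ε⁻¹ * (D * ‖B‖ ^ 2 + D * ‖B‖ ^ 2 + D * ‖B‖ ^ 2) := by gcongr
        _ ≤ ε * (D * (‖V‖ + 1) ^ 2 + D * (‖V‖ + 1) ^ 2)
            + ε⁻¹ * (D * (ε * ε) + D * (ε * ε) + D * (ε * ε)) := by gcongr
        _ = _ := by
            field_simp
            ring
    have hP : 0 ≤ ∫ p in X.openBox R, X.deltaR p.1 * ‖f p‖ ^ 2 :=
      setIntegral_nonneg (Exterior.measurableSet_openBox R) fun p hp =>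
        mul_nonneg (hX.deltaR_pos p.1 (hos hp).1).le (by positivity)
    have hweight : ENNReal.ofReal (∫ p in X.openBox R, X.deltaR p.1 * ‖f p‖ ^ 2) ≤
        2 * (T + ENNReal.ofReal L * (ENNReal.ofReal ε * ENNReal.ofReal D)) := by
      rw [ofReal_integral_eq_lintegral_ofReal i6
        ((ae_restrict_iff' (Exterior.measurableSet_openBox R)).2 (Eventually.of_forall fun p hp =>
          mul_nonneg (hX.deltaR_pos p.1 (hos hp).1).le (by positivity)))]
      have mD : AEMeasurable (fun p : ℝ × ℝ => ENNReal.ofReal (X.deltaR p.1) * ‖v p‖ₑ ^ 2)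
          (volume.restrict (X.openBox R)) :=
        ((Exterior.continuousOn_deltaR_fst (X := X) (X.openBox R)).aemeasurable
          (Exterior.measurableSet_openBox R)).ennreal_ofReal.mul (hvo.enorm.pow_const 2)
      calc ∫⁻ p in X.openBox R, ENNReal.ofReal (X.deltaR p.1 * ‖f p‖ ^ 2)
          ≤ ∫⁻ p in X.openBox R, 2 * (ENNReal.ofReal (X.deltaR p.1) * ‖v p‖ₑ ^ 2
              + ENNReal.ofReal L * ‖v p - f p‖ₑ ^ 2) := by
            refine setLIntegral_mono_ae' (Exterior.measurableSet_openBox R)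
              (Eventually.of_forall fun p hp => ?_)
            rw [ENNReal.ofReal_mul (hX.deltaR_pos p.1 (hos hp).1).le,
              ENNReal.ofReal_pow (norm_nonneg _), ofReal_norm]
            have h1 : ‖f p‖ₑ ^ 2 ≤ 2 * (‖v p‖ₑ ^ 2 + ‖v p - f p‖ₑ ^ 2) := by
              refine le_trans ?_ (ennreal_add_sq_le _ _)
              gcongr
              calc ‖f p‖ₑ = ‖v p - (v p - f p)‖ₑ := by rw [sub_sub_cancel]
                _ ≤ _ := enorm_sub_le
            have h2 : ENNReal.ofReal (X.deltaR p.1) ≤ ENNReal.ofReal L :=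
              ENNReal.ofReal_le_ofReal ((le_abs_self _).trans (hLb p hp))
            calc ENNReal.ofReal (X.deltaR p.1) * ‖f p‖ₑ ^ 2
                ≤ ENNReal.ofReal (X.deltaR p.1) * (2 * (‖v p‖ₑ ^ 2 + ‖v p - f p‖ₑ ^ 2)) := by
                  gcongr
              _ = 2 * (ENNReal.ofReal (X.deltaR p.1) * ‖v p‖ₑ ^ 2
                  + ENNReal.ofReal (X.deltaR p.1) * ‖v p - f p‖ₑ ^ 2) := by ring
              _ ≤ _ := by gcongr
        _ = 2 * (T + ENNReal.ofReal L * ∫⁻ p in X.openBox R, ‖v p - f p‖ₑ ^ 2) := by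
            rw [lintegral_const_mul' _ _ (by simp), lintegral_add_left' mD,
              lintegral_const_mul' _ _ (by simp)]
        _ ≤ _ := by gcongr
    have hgrad : ∫⁻ p in Q, (‖fr p‖ₑ ^ 2 + ‖fx p‖ₑ ^ 2) ≤
        ENNReal.ofReal (8 * β ^ 2 / m) * (T + ENNReal.ofReal L * (ENNReal.ofReal ε
          * ENNReal.ofReal D))
        + ENNReal.ofReal ε * ENNReal.ofReal (m⁻¹ * (C * (2 * D * (‖V‖ + 1) ^ 2 + 3 * D))) := by
      refine hder.trans ?_
      calc _ ≤ ENNReal.ofReal (4 * β ^ 2 / m * (∫ p in X.openBox R, X.deltaR p.1 * ‖f p‖ ^ 2)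
            + ε * (m⁻¹ * (C * (2 * D * (‖V‖ + 1) ^ 2 + 3 * D)))) := by
            refine ENNReal.ofReal_le_ofReal ?_
            calc _ ≤ m⁻¹ * (4 * β ^ 2 * (∫ p in X.openBox R, X.deltaR p.1 * ‖f p‖ ^ 2)
                  + C * (ε * (2 * D * (‖V‖ + 1) ^ 2 + 3 * D))) := by
                  gcongr
                  exact hE.trans (by gcongr)
              _ = _ := by ring
        _ = ENNReal.ofReal (4 * β ^ 2 / m)
              * ENNReal.ofReal (∫ p in X.openBox R, X.deltaR p.1 * ‖f p‖ ^ 2)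
            + ENNReal.ofReal ε * ENNReal.ofReal (m⁻¹ * (C * (2 * D * (‖V‖ + 1) ^ 2 + 3 * D))) := by
            rw [ENNReal.ofReal_add (by positivity) (by positivity),
              ENNReal.ofReal_mul (by positivity), ENNReal.ofReal_mul hε.le]
        _ ≤ ENNReal.ofReal (4 * β ^ 2 / m) * (2 * (T + ENNReal.ofReal L * (ENNReal.ofReal ε
              * ENNReal.ofReal D)))
            + ENNReal.ofReal ε * ENNReal.ofReal (m⁻¹ * (C * (2 * D * (‖V‖ + 1) ^ 2 + 3 * D))) := by
            gcongr
        _ = _ := by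
            have : ENNReal.ofReal (8 * β ^ 2 / m) = ENNReal.ofReal (4 * β ^ 2 / m) * 2 := by
              rw [← ENNReal.ofReal_ofNat 2, ← ENNReal.ofReal_mul (by positivity)]
              congr 1
              ring
            rw [this]
            ring
    have hpoin := hK f fr fx
      (fun p hp => by
        have hd : DifferentiableAt ℝ f p :=
          (hfs.contDiffAt (Exterior.isOpen_inner.mem_nhds (hQi hp))).differentiableAt (by simp)
        have := hd.hasFDerivAt.comp_hasDerivAt p.1
          ((hasDerivAt_id p.1).prodMk (hasDerivAt_const p.1 p.2))
        rw [← hts.deriv_r p (hQi hp)]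
        exact this)
      (fun p hp => by
        have hd : DifferentiableAt ℝ f p :=
          (hfs.contDiffAt (Exterior.isOpen_inner.mem_nhds (hQi hp))).differentiableAt (by simp)
        have := hd.hasFDerivAt.comp_hasDerivAt p.2
          ((hasDerivAt_const p.2 p.1).prodMk (hasDerivAt_id p.2))
        rw [← hts.deriv_x p (hQi hp)]
        exact this)
      (cfr.mono hQc) (cfx.mono hQc)
    calc ∫⁻ p in Q, ∫⁻ q in Q, ‖v p - v q‖ₑ ^ 2
        ≤ 4 * (∫⁻ p in Q, ∫⁻ q in Q, ‖f p - f q‖ₑ ^ 2)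
          + 8 * volume Q * ∫⁻ p in Q, ‖v p - f p‖ₑ ^ 2 :=
          lintegral_oscillation_le hQm (hvo.mono_measure (Measure.restrict_mono hQ le_rfl))
            (cf.mono hQc)
      _ ≤ 4 * (K * (ENNReal.ofReal (8 * β ^ 2 / m) * (T + ENNReal.ofReal L * (ENNReal.ofReal ε
            * ENNReal.ofReal D))
          + ENNReal.ofReal ε * ENNReal.ofReal (m⁻¹ * (C * (2 * D * (‖V‖ + 1) ^ 2 + 3 * D)))))
          + 8 * volume Q * (ENNReal.ofReal ε * ENNReal.ofReal D) := by
          gcongr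
          · exact hpoin.trans (by gcongr)
          · exact (lintegral_mono_set hQ).trans hdiff
      _ = _ := by
          rw [hZ]
          ring
  have hlim : Tendsto (fun n : ℕ => 4 * K * ENNReal.ofReal (8 * β ^ 2 / m) * T
      + ENNReal.ofReal (1 / ((n : ℝ) + 1)) * Z) atTop
      (𝓝 (4 * K * ENNReal.ofReal (8 * β ^ 2 / m) * T)) := by
    have h1 : Tendsto (fun n : ℕ => ENNReal.ofReal (1 / ((n : ℝ) + 1))) atTop (𝓝 0) := by
      simpa using ENNReal.tendsto_ofReal (tendsto_one_div_add_atTop_nhds_zero_nat (𝕜 := ℝ))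
    have h2 := ENNReal.Tendsto.mul_const (b := Z) h1 (Or.inr hZt)
    rw [zero_mul] at h2
    simpa using h2.const_add (4 * K * ENNReal.ofReal (8 * β ^ 2 / m) * T)
  refine ge_of_tendsto' hlim fun n => key _ (by positivity) ?_
  rw [div_le_one (by positivity)]
  linarith [(Nat.cast_nonneg n : (0 : ℝ) ≤ n)]

end Realization

/-! ### Kerr–Newman coefficients, exhausting rectangles and constant solutions -/

namespace Exterior

variable {X : Exterior}

theorem IsKerrNewman.deltaX_ends {Q : ℝ} (h : X.IsKerrNewman Q) :
    X.deltaX X.xl = 0 ∧ X.deltaX X.xu = 0 := by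
  rw [h.deltaX_eq, h.deltaX_eq, h.xl_eq, h.xu_eq]
  norm_num

theorem IsKerrNewman.mass_le_rh {Q : ℝ} (h : X.IsKerrNewman Q) : X.M ≤ X.rh := by
  rw [h.rh_eq]
  linarith [Real.sqrt_nonneg (X.M ^ 2 - X.a ^ 2 - Q ^ 2)]

/-- Outside the horizon r ≥ M, so 2Mr ≥ 2M² > a² + Q². This converts the weight Δ_r/R² into (r/R)².
-/
theorem IsKerrNewman.deltaR_le {Q : ℝ} (h : X.IsKerrNewman Q) {r : ℝ} (hr : X.rh ≤ r) :
    X.deltaR r ≤ r ^ 2 := by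
  rw [h.deltaR_eq]
  nlinarith [h.subextremal, h.mass_pos, h.mass_le_rh]

theorem BH1.inner_nonempty (hX : X.BH1) : X.inner.Nonempty :=
  hX.radial_nonempty.prod (nonempty_Ioo.2 hX.xl_lt_xu)

/-- A compact rectangle in `Ioo a b ×ˢ Ioo c d`; these rectangles exhaust it. -/
def innerRect (a b c d : ℝ) (n : ℕ) : Set (ℝ × ℝ) :=
  Icc (a + 1 / ((n : ℝ) + 1)) (b - 1 / ((n : ℝ) + 1)) ×ˢ
    Icc (c + 1 / ((n : ℝ) + 1)) (d - 1 / ((n : ℝ) + 1))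

theorem innerRect_subset (a b c d : ℝ) (n : ℕ) : innerRect a b c d n ⊆ Ioo a b ×ˢ Ioo c d := by
  have hn : 0 < 1 / ((n : ℝ) + 1) := by positivity
  rintro p ⟨⟨h1, h2⟩, h3, h4⟩
  exact ⟨⟨by linarith, by linarith⟩, by linarith, by linarith⟩

theorem eventually_mem_innerRect {a b c d : ℝ} {p : ℝ × ℝ} (hp : p ∈ Ioo a b ×ˢ Ioo c d) :
    ∀ᶠ n in atTop, p ∈ innerRect a b c d n := by
  obtain ⟨⟨h1, h2⟩, h3, h4⟩ := hp
  have hlim := tendsto_one_div_add_atTop_nhds_zero_nat (𝕜 := ℝ)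
  filter_upwards [hlim.eventually_lt_const (sub_pos.2 h1), hlim.eventually_lt_const (sub_pos.2 h2),
    hlim.eventually_lt_const (sub_pos.2 h3), hlim.eventually_lt_const (sub_pos.2 h4)]
    with n e1 e2 e3 e4
  exact ⟨⟨by linarith, by linarith⟩, by linarith, by linarith⟩

theorem BH1.exists_lower_bound (hX : X.BH1) {a b c d : ℝ} (hQ : Icc a b ×ˢ Icc c d ⊆ X.inner) :
    ∃ m > 0, ∀ p ∈ Icc a b ×ˢ Icc c d, m ≤ X.deltaR p.1 ∧ m ≤ X.deltaX p.2 := by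
  have hc : IsCompact (Icc a b ×ˢ Icc c d) := isCompact_Icc.prod isCompact_Icc
  obtain ⟨m₁, h1, b1⟩ := hc.exists_forall_le' (continuousOn_deltaR_fst (X := X) _)
    (a := 0) fun p hp => hX.deltaR_pos p.1 (hQ hp).1
  obtain ⟨m₂, h2, b2⟩ := hc.exists_forall_le' (continuousOn_deltaX_snd (X := X) _)
    (a := 0) fun p hp => hX.deltaX_pos p.2 (hQ hp).2
  exact ⟨min m₁ m₂, lt_min h1 h2, fun p hp =>
    ⟨(min_le_left _ _).trans (b1 p hp), (min_le_right _ _).trans (b2 p hp)⟩⟩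

theorem admissible_const (J : Set ℝ) (z : ℂ)
    (hw : ∀ R law, X.outer = .wall R law → law = .robin 0 0) :
    X.Admissible J (fun _ _ => z) := by
  refine ⟨contDiffOn_const, fun R law ho τ _ x _ => ?_, fun e _ τ _ r _ => ?_⟩
  · obtain rfl := hw R law ho
    simp
  · simp

theorem waveOp_const (z : ℂ) (τ : ℝ) (p : ℝ × ℝ) : X.waveOp (fun _ _ => z) τ p = 0 := by
  simp [waveOp, CarterParams.box, CarterParams.pderiv, lift]

end Exterior

/-! ### The threshold spaces of the Kerr–Newman exteriors -/

namespace Realization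

variable {X : Exterior} {W : Realization.{u} X} {s : ℕ}

theorem hasData_zero : W.HasData s 0 0 0 := by
  constructor <;> rw [map_zero] <;> exact AEEqFun.coeFn_zero

theorem BH3.eq_of_hasData (h : W.BH3 s) {U V : W.E s} {f g : ℝ × ℝ → ℂ} (hU : W.HasData s U f g)
    (hV : W.HasData s V f g) : U = V :=
  h.data_injective (Prod.ext (AEEqFun.ext (hU.1.trans hV.1.symm))
    (AEEqFun.ext (hU.2.trans hV.2.symm)))

/-- Data with a constant first component are stationary at a Neumann wall. -/
theorem BH3.gen_zero_of_const (h : W.BH3 s)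
    (hw : ∀ R law, X.outer = .wall R law → law = .robin 0 0) {U : W.E s} {z : ℂ}
    (hU : W.HasData s U (fun _ => z) 0) : W.Gen s U 0 := by
  have hm := (h.first_order 1 one_pos (fun _ _ => z) 0 (fun _ => U) 0
    (Exterior.admissible_const _ z hw) contDiffOn_const
    (fun t _ => hU.congr (ae_eq_refl _) (Eventually.of_forall fun p => by simp))
    continuousOn_const
    (fun t _ => hasData_zero.congr (ae_eq_refl _) (Eventually.of_forall fun p => by simp))).1
    fun τ _ p _ => Exterior.waveOp_const z τ p
  -- For a constant curve the integral over [0, 1] is the datum itself, so the integrated equation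
  -- at time 1 says that the generator annihilates it.
  have := hm.2 1 (by simp)
  simpa using this

theorem BH3.hasData_of_gen_zero (h : W.BH3 s) (hX : X.BH1) {V : W.E s} (hV : W.Gen s V 0) {z : ℂ}
    (hz : (W.data s V).1 =ᵐ[X.vol] fun _ => z) : W.HasData s V (fun _ => z) 0 :=
  ⟨hz, (h.snd_eq_fst_of_gen hX hV).trans hasData_zero.1⟩

/-- At a Neumann wall the weight may be identically 1; then β = 0 and the right side of
`BH3.oscillation_le` is zero. -/
theorem BH3.const_of_gen_zero_wall (h : W.BH3 s) (hX : X.BH1) (hl : X.deltaX X.xl = 0)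
    (hu : X.deltaX X.xu = 0) {R : ℝ} (ho : X.outer = .wall R (.robin 0 0)) {V : W.E s}
    (hV : W.Gen s V 0) : ∃ z : ℂ, W.HasData s V (fun _ => z) 0 := by
  have hR := hX.innerRadius_wall ho
  have hi : X.inner = Ioo X.rh R ×ˢ Ioo X.xl X.xu := by
    simp only [Exterior.inner, Exterior.radialInt, ho]
  have hsub : ∀ n, Exterior.innerRect X.rh R X.xl X.xu n ⊆ X.openBox R := fun n =>
    Exterior.innerRect_subset _ _ _ _ n
  obtain ⟨z, hz⟩ := Exterior.ae_eq_const_of_oscillation hX.inner_nonempty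
    (AEEqFun.aestronglyMeasurable (W.data s V).1) (Q := Exterior.innerRect X.rh R X.xl X.xu)
    (fun n => measurableSet_Icc.prod measurableSet_Icc) (fun n => (hsub n).trans hR.openBox_subset)
    (fun p hp => Exterior.eventually_mem_innerRect (hi ▸ hp)) (fun n => by
      obtain ⟨m, hm, hb⟩ := hX.exists_lower_bound ((hsub n).trans hR.openBox_subset)
      obtain ⟨K, hK⟩ := poincare_rect (X.rh + 1 / ((n : ℝ) + 1)) (R - 1 / ((n : ℝ) + 1))
        (X.xl + 1 / ((n : ℝ) + 1)) (X.xu - 1 / ((n : ℝ) + 1))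
      have := h.oscillation_le hX hl hu hR (α := 1) (β := 0) (Or.inl ho) hV (hsub n) hm
        (fun p hp => by simpa using (hb p hp).1) (fun p hp => by simpa using (hb p hp).2) hK
      exact le_antisymm (this.trans (by simp)) zero_le)
  exact ⟨z, h.hasData_of_gen_zero hX hV hz⟩

/-- The threshold space at a Neumann wall. -/
theorem BH3.threshold_wall (h : W.BH3 s) (hX : X.BH1) (hl : X.deltaX X.xl = 0)
    (hu : X.deltaX X.xu = 0) (hH : 0 < X.rh ^ 2 + X.a ^ 2) {R : ℝ}
    (ho : X.outer = .wall R (.robin 0 0)) :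
    W.threshold s = {U | ∃ z : ℂ, W.HasData s U (fun _ => z) 0} ∧
      ∀ V ∈ W.threshold s, W.Gen s V 0 := by
  have hw : ∀ R' law, X.outer = .wall R' law → law = .robin 0 0 := by
    intro R' law h'
    rw [ho] at h'
    simp only [OuterEnd.wall.injEq] at h'
    exact h'.2.symm
  have hker : ∀ n, ∀ U ∈ W.kerPow s n, ∃ z : ℂ, W.HasData s U (fun _ => z) 0 := by
    intro n
    induction n with
    | zero =>
      rintro U rfl
      exact ⟨0, hasData_zero⟩
    | succ n ih =>
      rintro U ⟨V, hV, hG⟩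
      obtain ⟨z, hz⟩ := ih V hV
      -- The image of U under the generator is constant by induction, and the horizon flux forces
      -- this constant to be zero; thus U is already in the kernel.
      obtain rfl := h.eq_zero_of_gen_const hX hl hu ho hH hG hz
      obtain rfl : V = 0 := h.eq_of_hasData hz hasData_zero
      exact h.const_of_gen_zero_wall hX hl hu ho hG
  have heq : W.threshold s = {U | ∃ z : ℂ, W.HasData s U (fun _ => z) 0} := by
    ext U
    constructor
    · intro hU
      obtain ⟨n, -, hn⟩ := mem_iUnion₂.1 hU
      exact hker n U hn
    · rintro ⟨z, hz⟩
      exact kerPow_subset_threshold 1 ⟨0, rfl, h.gen_zero_of_const hw hz⟩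
  refine ⟨heq, fun V hV => ?_⟩
  rw [heq] at hV
  obtain ⟨z, hz⟩ := hV
  exact h.gen_zero_of_const hw hz

/-- Dominated convergence: for fixed r the weight tends to zero, and the integrand never exceeds
that of the finite Hardy term. -/
theorem tendsto_lintegral_weight {v : ℝ × ℝ → ℂ} (hv : AEStronglyMeasurable v X.vol)
    (hfin : ∫⁻ p, ‖v p‖ₑ ^ 2 ∂X.vol < ⊤) :
    Tendsto (fun n : ℕ => ∫⁻ p, ENNReal.ofReal (min 1 ((p.1 / ((n : ℝ) + 1)) ^ 2)) * ‖v p‖ₑ ^ 2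
      ∂X.vol) atTop (𝓝 0) := by
  have hz : (0 : ℝ≥0∞) = ∫⁻ _ : ℝ × ℝ, 0 ∂X.vol := by simp
  rw [hz]
  refine tendsto_lintegral_of_dominated_convergence' (fun p => ‖v p‖ₑ ^ 2) (fun n => ?_)
    (fun n => Eventually.of_forall fun p => ?_) hfin.ne ?_
  · refine AEMeasurable.mul ?_ (hv.enorm.pow_const 2)
    exact (by fun_prop : Measurable fun p : ℝ × ℝ =>
      ENNReal.ofReal (min 1 ((p.1 / ((n : ℝ) + 1)) ^ 2))).aemeasurable
  · refine mul_le_of_le_one_left zero_le ?_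
    rw [← ENNReal.ofReal_one]
    exact ENNReal.ofReal_le_ofReal (min_le_left _ _)
  · have hf : ∀ᵐ p ∂X.vol, ‖v p‖ₑ ^ 2 < ⊤ := Eventually.of_forall fun p => by finiteness
    filter_upwards [hf] with p hp
    have h1 : Tendsto (fun n : ℕ => (p.1 / ((n : ℝ) + 1)) ^ 2) atTop (𝓝 0) := by
      have := ((tendsto_one_div_add_atTop_nhds_zero_nat (𝕜 := ℝ)).const_mul p.1).pow 2
      simpa [div_eq_mul_inv] using this
    have h2 : Tendsto (fun n : ℕ => ENNReal.ofReal (min 1 ((p.1 / ((n : ℝ) + 1)) ^ 2))) atTop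
        (𝓝 0) := by
      have h3 := (tendsto_const_nhds (x := (1 : ℝ))).min h1
      simpa using ENNReal.tendsto_ofReal h3
    simpa using ENNReal.Tendsto.mul_const h2 (Or.inr hp.ne)

/-- The rectangle stays fixed while the box grows: the weight 1 - r/R vanishes at r = R, so no
boundary condition is needed there, and the price for its slope tends to zero. This makes V
constant, and infinite volume excludes a nonzero constant. -/
theorem BH3.eq_zero_of_gen_zero_infinity (h : W.BH3 s) (hX : X.BH1) (hl : X.deltaX X.xl = 0)
    (hu : X.deltaX X.xu = 0) (ho : X.outer = .infinity) (hrh : 0 ≤ X.rh)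
    (hD : ∀ r, X.rh ≤ r → X.deltaR r ≤ r ^ 2) {V : W.E s} (hV : W.Gen s V 0)
    (hfin : ∫⁻ p, ‖(W.data s V).1 p‖ₑ ^ 2 ∂X.vol < ⊤) : V = 0 := by
  have hi : X.inner = Ioi X.rh ×ˢ Ioo X.xl X.xu := by
    simp only [Exterior.inner, Exterior.radialInt, ho]
  set v : ℝ × ℝ → ℂ := ⇑(W.data s V).1 with hv
  have hvm : AEStronglyMeasurable v X.vol := AEEqFun.aestronglyMeasurable _
  have hlim := tendsto_lintegral_weight hvm hfin
  have hosc : ∀ a b c d : ℝ, X.rh < a → Icc a b ×ˢ Icc c d ⊆ X.inner →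
      ∫⁻ p in Icc a b ×ˢ Icc c d, ∫⁻ q in Icc a b ×ˢ Icc c d, ‖v p - v q‖ₑ ^ 2 = 0 := by
    intro a b c d ha hQ
    obtain ⟨m, hm, hb⟩ := hX.exists_lower_bound hQ
    obtain ⟨K, hK⟩ := poincare_rect a b c d
    have hlim' : Tendsto (fun n : ℕ => 4 * K * ENNReal.ofReal (32 / m) *
        ∫⁻ p, ENNReal.ofReal (min 1 ((p.1 / ((n : ℝ) + 1)) ^ 2)) * ‖v p‖ₑ ^ 2 ∂X.vol)
        atTop (𝓝 0) := by
      have := ENNReal.Tendsto.const_mul (a := 4 * K * ENNReal.ofReal (32 / m)) hlim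
        (Or.inr (by finiteness))
      rwa [mul_zero] at this
    refine le_antisymm (ge_of_tendsto hlim' ?_) zero_le
    obtain ⟨N, hN⟩ := exists_nat_ge (max (2 * b) X.rh)
    filter_upwards [eventually_ge_atTop N] with n hn
    have hnN : (N : ℝ) ≤ n := by exact_mod_cast hn
    set R : ℝ := (n : ℝ) + 1 with hRdef
    have hRb : 2 * b < R := by linarith [le_max_left (2 * b) X.rh]
    have hRr : X.rh < R := by linarith [le_max_right (2 * b) X.rh]
    have hR0 : 0 < R := by positivity
    have hR := Exterior.innerRadius_infinity ho hRr
    have hQR : Icc a b ×ˢ Icc c d ⊆ X.openBox R := fun p hp =>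
      ⟨⟨by linarith [hp.1.1], by
        have h1 := hp.1.2
        have h2 := hp.1.1
        linarith⟩, (hQ hp).2⟩
    -- Since R > 2b, the weight 1 - r/R is at least 1/2 on the rectangle; this is the source of the
    -- lower bound m/4.
    have hw : ∀ p ∈ Icc a b ×ˢ Icc c d, 1 / 4 ≤ (1 + -1 / R * p.1) ^ 2 := by
      intro p hp
      have h1 : p.1 / R ≤ 1 / 2 := by
        rw [div_le_iff₀ hR0]
        linarith [hp.1.2]
      have h2 : 1 + -1 / R * p.1 = 1 - p.1 / R := by ring
      rw [h2]
      nlinarith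
    have hmain := h.oscillation_le hX hl hu hR (α := 1) (β := -1 / R)
      (Or.inr (by rw [div_mul_cancel₀ _ hR0.ne']; norm_num)) hV hQR (m := m / 4) (by positivity)
      (fun p hp => by
        have h1 := hw p hp
        have h2 := (hb p hp).1
        nlinarith)
      (fun p hp => by
        have h1 := hw p hp
        have h2 := (hb p hp).2
        nlinarith) hK
    refine hmain.trans ?_
    -- The factor 1/R² is separated so that it joins Δ_r in the integral; what remains depends on
    -- the rectangle but not on R.
    have e1 : ENNReal.ofReal (8 * (-1 / R) ^ 2 / (m / 4))
        = ENNReal.ofReal (32 / m) * ENNReal.ofReal (1 / R ^ 2) := by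
      rw [← ENNReal.ofReal_mul (by positivity)]
      congr 1
      field_simp
      norm_num
    rw [e1, ← mul_assoc, mul_assoc (4 * (K : ℝ≥0∞) * _), ← lintegral_const_mul' _ _ (by simp)]
    refine mul_le_mul' le_rfl ?_
    rw [← lintegral_inner_eq hR.openBox_subset]
    refine le_trans (lintegral_mono_ae ?_) (setLIntegral_le_lintegral _ _)
    rw [ae_restrict_iff' (Exterior.measurableSet_openBox R)]
    refine Eventually.of_forall fun p hp => ?_
    rw [← mul_assoc, ← ENNReal.ofReal_mul (by positivity)]
    gcongr
    obtain ⟨h1, h2⟩ := hp.1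
    have hp0 : 0 ≤ p.1 := by linarith
    have hle : 1 / R ^ 2 * X.deltaR p.1 ≤ (p.1 / R) ^ 2 := by
      calc 1 / R ^ 2 * X.deltaR p.1 ≤ 1 / R ^ 2 * p.1 ^ 2 := by
            gcongr
            exact hD p.1 h1.le
        _ = _ := by rw [div_pow, one_div_mul_eq_div]
    refine le_min (hle.trans ?_) hle
    have : p.1 / R ≤ 1 := (div_le_one hR0).2 h2.le
    have h0 : 0 ≤ p.1 / R := by positivity
    nlinarith
  obtain ⟨z, hz⟩ := Exterior.ae_eq_const_of_oscillation hX.inner_nonempty hvm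
    -- The outer radius n of the rectangles grows together with the index, so that they exhaust the
    -- unbounded interior.
    (Q := fun n : ℕ => Exterior.innerRect X.rh n X.xl X.xu n)
    (fun n => measurableSet_Icc.prod measurableSet_Icc)
    (fun n p hp => by
      rw [hi]
      have := Exterior.innerRect_subset _ _ _ _ n hp
      exact ⟨this.1.1, this.2⟩)
    (fun p hp => by
      rw [hi] at hp
      have hl := tendsto_one_div_add_atTop_nhds_zero_nat (𝕜 := ℝ)
      obtain ⟨N, hN⟩ := exists_nat_ge (p.1 + 1)
      filter_upwards [hl.eventually_lt_const (sub_pos.2 hp.1),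
        hl.eventually_lt_const (sub_pos.2 hp.2.1), hl.eventually_lt_const (sub_pos.2 hp.2.2),
        hl.eventually_lt_const one_pos, eventually_ge_atTop N] with n e1 e2 e3 e4 e5
      have e6 : (N : ℝ) ≤ n := by exact_mod_cast e5
      exact ⟨⟨by linarith, by linarith⟩, by linarith, by linarith⟩)
    (fun n => hosc _ _ _ _ (by
        have : (0 : ℝ) < 1 / ((n : ℝ) + 1) := by positivity
        linarith) (fun p hp => by
      rw [hi]
      have := Exterior.innerRect_subset X.rh n X.xl X.xu n hp
      exact ⟨this.1.1, this.2⟩))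
  have hvol : X.vol univ = ⊤ := by
    unfold Exterior.vol
    rw [Measure.restrict_apply_univ, hi, Measure.volume_eq_prod, Measure.prod_prod, Real.volume_Ioi,
      Real.volume_Ioo, ENNReal.top_mul]
    exact (ENNReal.ofReal_pos.2 (sub_pos.2 hX.xl_lt_xu)).ne'
  have hz0 : z = 0 := by
    by_contra hne
    have : ∫⁻ p, ‖v p‖ₑ ^ 2 ∂X.vol = ⊤ := by
      rw [lintegral_congr_ae (hz.mono fun p hp => by simp only [hp] : (fun p => ‖v p‖ₑ ^ 2)
        =ᵐ[X.vol] fun _ => ‖z‖ₑ ^ 2), lintegral_const, hvol, ENNReal.mul_top]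
      simpa using hne
    exact hfin.ne this
  subst hz0
  exact h.eq_of_hasData (h.hasData_of_gen_zero hX hV hz) hasData_zero

/-- The threshold space at a noncompact end, for decaying data. -/
theorem BH3.threshold_infinity (h : W.BH3 s) (hX : X.BH1) (hl : X.deltaX X.xl = 0)
    (hu : X.deltaX X.xu = 0) (ho : X.outer = .infinity) (hrh : 0 ≤ X.rh)
    (hD : ∀ r, X.rh ≤ r → X.deltaR r ≤ r ^ 2)
    (hfin : ∀ U : W.E s, ∫⁻ p, ‖(W.data s U).1 p‖ₑ ^ 2 ∂X.vol < ⊤) : W.threshold s = {0} := by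
  have hker : ∀ n, ∀ U ∈ W.kerPow s n, U = 0 := by
    intro n
    induction n with
    | zero => exact fun U hU => hU
    | succ n ih =>
      rintro U ⟨V, hV, hG⟩
      obtain rfl := ih V hV
      exact h.eq_zero_of_gen_zero_infinity hX hl hu ho hrh hD hG (hfin U)
  refine Subset.antisymm (fun U hU => ?_) (singleton_subset_iff.2 zero_mem_threshold)
  obtain ⟨n, -, hn⟩ := mem_iUnion₂.1 hU
  exact hker n U hn

end Realization

end CarterBH

end

/-! ### Assembly of the theorem -/

theorem mainTheorem4 (X : CarterBH.Exterior) (W : CarterBH.Realization X) (s₀ : ℕ)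
    (hBH : W.Package s₀) :
    (∀ s, s₀ ≤ s → ∃ Pi₀ : W.E s →L[ℂ] W.E s,
      Pi₀.comp Pi₀ = Pi₀ ∧
      FiniteDimensional ℂ (LinearMap.range (Pi₀ : W.E s →ₗ[ℂ] W.E s)) ∧
      Set.range Pi₀ = W.threshold s ∧
      (∀ t ≥ 0, (W.S s t).comp Pi₀ = Pi₀.comp (W.S s t)) ∧
      -- decomposition of finite-energy and of classical solutions
      (∀ (U₀ : W.E s) (U : ℝ → W.E s), W.IsSolution s U₀ U →
        ∀ t ≥ 0, U t = W.S s t (Pi₀ U₀) + W.S s t (U₀ - Pi₀ U₀)) ∧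
      (∀ (u : ℝ → ℝ × ℝ → ℂ) (U : ℝ → W.E s), X.Admissible (Ici 0) u →
        (∀ τ > 0, ∀ p ∈ X.inner, X.waveOp u τ p = 0) → W.Traces s (Ici 0) u U →
        ∀ t ≥ 0, U t = W.S s t (Pi₀ (U 0)) + W.S s t (U 0 - Pi₀ (U 0))) ∧
      (∀ U₀ : W.E s, W.IsSolution s U₀ (fun t => W.S s t U₀)) ∧
      -- the threshold term
      (∃ q : ℕ, ∀ V ∈ W.threshold s, V ∈ W.kerPow s q) ∧
      (∀ q : ℕ, (∀ V ∈ W.threshold s, V ∈ W.kerPow s q) → ∀ U₀ : W.E s,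
        ∃ c : ℕ → W.E s, c 0 = Pi₀ U₀ ∧ (∀ j, c j ∈ W.threshold s ∧ W.Gen s (c j) (c (j + 1))) ∧
          (∀ j, q ≤ j → c j = 0) ∧
          ∀ t ≥ 0, W.S s t (Pi₀ U₀) =
            ∑ j ∈ Finset.range q, (((t : ℝ) ^ j / (j.factorial : ℝ) : ℝ) : ℂ) • c j) ∧
      ((∀ V ∈ W.threshold s, W.Gen s V 0) ↔
        ∀ U₀ : W.E s, ∀ t ≥ 0, W.S s t (Pi₀ U₀) = Pi₀ U₀) ∧
      -- the dispersive term
      (∃ C : ℝ≥0, ∀ U₀ : W.E s,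
        (⨆ t ∈ Ici (0 : ℝ), ‖W.S s t (U₀ - Pi₀ U₀)‖ₑ)
            + W.leNorm s (Ici 0) (fun t => W.S s t (U₀ - Pi₀ U₀))
          ≤ C * ‖U₀ - Pi₀ U₀‖ₑ) ∧
      (∀ (U₀ : W.E s) (K : Set (ℝ × ℝ)), IsCompact K → K ⊆ X.slice → Disjoint K X.imposed →
        Tendsto (fun t : ℝ =>
            X.hNorm 1 K (W.data s (W.S s t (U₀ - Pi₀ U₀))).1
              + X.hNorm 0 K (W.data s (W.S s t (U₀ - Pi₀ U₀))).2) atTop (𝓝 0))) ∧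
    -- absence of growing outgoing modes
    (∀ σ : ℂ, 0 < σ.im → ∀ w, X.Outgoing σ w →
      (∀ τ, ∀ p ∈ X.inner, X.waveOp (CarterBH.Exterior.mode σ w) τ p = 0) →
      ∀ p ∈ X.slice, w p = 0) ∧
    -- the Kerr-Newman wall: the threshold consists of the constants
    (∀ s, s₀ ≤ s → ∀ Q R : ℝ, X.IsKerrNewman Q → X.outer = .wall R (.robin 0 0) →
      (∃ U : W.E s, W.HasData s U 1 0) →
      W.threshold s = {U | ∃ z : ℂ, W.HasData s U (fun _ => z) 0} ∧
        ∀ V ∈ W.threshold s, W.Gen s V 0) ∧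
    -- the asymptotically flat Kerr-Newman exterior with decaying radiation energy
    (∀ s, s₀ ≤ s → ∀ Q : ℝ, X.IsKerrNewman Q → X.outer = .infinity →
      (∀ U : W.E s, ∫⁻ p, ‖(W.data s U).1 p‖ₑ ^ 2 ∂X.vol < ⊤) →
      W.threshold s = {0}) := by
  obtain ⟨hX, hP⟩ := hBH
  refine ⟨fun s hs => ?_, fun σ hσ w hw he p hp => ?_, fun s hs Q R hKN ho _ => ?_,
    fun s hs Q hKN ho hfin => ?_⟩
  · obtain ⟨-, h3, h4, -, -, h7, h8, -⟩ := hP s hs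
    have split : ∀ (U₀ : W.E s) (t : ℝ),
        W.S s t U₀ = W.S s t (W.proj s U₀) + W.S s t (U₀ - W.proj s U₀) := fun U₀ t => by
      rw [← map_add, add_sub_cancel]
    have hmem : ∀ U₀ : W.E s, W.proj s U₀ ∈ W.threshold s := fun U₀ =>
      h8.range_eq ▸ mem_range_self U₀
    obtain ⟨d, ℓ, V, hℓ⟩ := h8.finite_rank
    refine ⟨W.proj s, h8.idem, CarterBH.Realization.finiteDimensional_range_of_sum _ ℓ V hℓ,
      h8.range_eq, h8.commute, fun U₀ U hU t ht => ?_, fun u U hu he hU t ht => ?_,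
      h3.isSolution, h8.nilpotent, fun q hq U₀ => h3.threshold_expansion (hq _ (hmem U₀)),
      ⟨fun h0 U₀ t ht => h3.apply_of_gen_zero (h0 _ (hmem U₀)) ht, fun h0 V hV => ?_⟩,
      CarterBH.Realization.Package.dispersive_bound hX h3 h4 h7,
      fun U₀ K hK hKs hKi => h7.local_decay h3 U₀ hK hKs hKi⟩
    · rw [h3.isSolution_unique hU ht]
      exact split U₀ t
    · rw [h3.classical_eq hX hu he hU ht]
      exact split (U 0) t
    · rw [← h8.range_eq] at hV
      obtain ⟨U₀, rfl⟩ := hV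
      exact CarterBH.Realization.gen_zero_of_stationary (h0 U₀)
  · obtain ⟨-, -, -, h5, -⟩ := hP s₀ le_rfl
    -- By definition P(σ)w is the wave operator on the mode at τ = 0, so the equation is needed at
    -- this one time only.
    exact h5.upper σ hσ w ⟨hw, fun q hq => he 0 q hq⟩ p hp
  · obtain ⟨-, h3, -⟩ := hP s hs
    have hrh : 0 < X.rh := hKN.mass_pos.trans_le hKN.mass_le_rh
    exact h3.threshold_wall hX hKN.deltaX_ends.1 hKN.deltaX_ends.2 (by positivity) ho
  · obtain ⟨-, h3, -⟩ := hP s hs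
    exact h3.threshold_infinity hX hKN.deltaX_ends.1 hKN.deltaX_ends.2 ho
      (hKN.mass_pos.le.trans hKN.mass_le_rh) (fun r hr => hKN.deltaR_le hr) hfin
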